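/- Let $D_4=\{x\in\mathbb Z^4 : x_1+x_2+x_3+x_4 \text{ even}\}$ and let $\Gamma=D_4^*=\{y\in\mathbb R^4 : \langle x,y\rangle\in\mathbb Z \text{ for all } x\in D_4\}$ be its dual lattice (the centred hypercubic lattice, i.e. the Hurwitz integers). A linear isometry $R\in \mathrm O(4)$ is a coincidence isometry of $\Gamma$ if $\Gamma(R):=\Gamma\cap R\Gamma$ has finite index in $\Gamma$; then $\Sigma(R)=[\Gamma:\Gamma(R)]$ is its coincidence index, and $\Gamma(R)$ is called a coincidence site lattice (CSL) of index $\Sigma(R)$. A coincidence rotation is a coincidence isometry of determinant $1$. (a) For every $n\ge 1$ the number of coincidence rotations of $\Gamma$ of index $n$ is finite and equals $576\,f^{\mathrm{rot}}(n)$, where $f^{\mathrm{rot}}:\mathbb N\to\mathbb Z_{\ge 0}$ is multiplicative ($f^{\mathrm{rot}}(1)=1$ and $f^{\mathrm{rot}}(mn)=f^{\mathrm{rot}}(m)f^{\mathrm{rot}}(n)$ for coprime $m,n$), $f^{\mathrm{rot}}(2^r)=0$ for $r\ge1$, and for every odd prime $p$ and $r\ge 1$ $$f^{\mathrm{rot}}(p^r)=\frac{p+1}{p-1}\,p^{r-1}\left(p^{r+1}+p^{r-1}-2\right).$$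 For every $s\in\mathbb C$ with $\operatorname{Re}s>3$ the following Dirichlet series converges absolutely, the Euler product converges unconditionally (independently of the order of factors), and $$\Phi^{\mathrm{rot}}(s)=\sum_{n=1}^\infty\frac{f^{\mathrm{rot}}(n)}{n^s}=\prod_{p\ne2}\frac{(1+p^{-s})(1+p^{1-s})}{(1-p^{1-s})(1-p^{2-s})}=1+\frac{16}{3^s}+\frac{36}{5^s}+\frac{64}{7^s}+\frac{168}{9^s}+\frac{144}{11^s}+\frac{196}{13^s}+\frac{576}{15^s}+\frac{324}{17^s}+\cdots,$$ the product being over all odd primes $p$ and the displayed terms being all non-zero terms with $n\le 17$. (b) For every $n\ge 1$ the number $f(n)$ of distinct CSLs of $\Gamma$ of index $n$ is finite. The function $f$ is multiplicative, $f(2^r)=0$ for $r\ge1$, and for every odd prime $p$ $$f(p^r)=\begin{cases}\dfrac{(p+1)^2}{p^3-1}\left(p^{2r+1}+p^{2r-2}-2p^{(r-1)/2}\right), & r\ge1 \text{ odd},\\[2ex] \dfrac{(p+1)^2}{p^3-1}\left(p^{2r+1}+p^{2r-2}-2p^{r/2-1}\,\dfrac{1+p^2}{1+p}\right), & r\ge2\text{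 even}.\end{cases}$$ For every $s\in\mathbb C$ with $\operatorname{Re}s>3$ the following Dirichlet series converges absolutely, the Euler product converges unconditionally (independently of the order of factors), and $$\Phi(s)=\sum_{n=1}^\infty\frac{f(n)}{n^s}=\prod_{p\ne2}\frac{1+p^{-s}+2p^{1-s}+2p^{-2s}+p^{1-2s}+p^{1-3s}}{(1-p^{2-s})(1-p^{1-2s})}=1+\frac{16}{3^s}+\frac{36}{5^s}+\frac{64}{7^s}+\frac{152}{9^s}+\frac{144}{11^s}+\frac{196}{13^s}+\frac{576}{15^s}+\frac{324}{17^s}+\cdots,$$ again over all odd primes $p$ and with all non-zero terms with $n\le17$ displayed. -/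

import Mathlib

/-- Four-dimensional Euclidean space. -/
abbrev E4 : Type := EuclideanSpace ℝ (Fin 4)

section General

variable {d : ℕ}

/-- `Γ(R) = Γ ∩ RΓ` for a lattice `Γ ⊆ ℝ^d` and a linear isometry `R ∈ O(d)`. -/
noncomputable def csl (Γ : AddSubgroup (EuclideanSpace ℝ (Fin d)))
    (R : EuclideanSpace ℝ (Fin d) ≃ₗᵢ[ℝ] EuclideanSpace ℝ (Fin d)) :
    AddSubgroup (EuclideanSpace ℝ (Fin d)) :=
  Γ ⊓ Γ.map (R.toLinearEquiv.toAddEquiv : EuclideanSpace ℝ (Fin d) →+ EuclideanSpace ℝ (Fin d))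

/-- The coincidence index `Σ(R) = [Γ : Γ(R)]`; it is `0` exactly when the index is infinite. -/
noncomputable def coincidenceIndex (Γ : AddSubgroup (EuclideanSpace ℝ (Fin d)))
    (R : EuclideanSpace ℝ (Fin d) ≃ₗᵢ[ℝ] EuclideanSpace ℝ (Fin d)) : ℕ :=
  (csl Γ R).relIndex Γ

/-- `OC(Γ)`: the linear isometries `R` for which `Γ ∩ RΓ` has finite index in `Γ`. -/
def coincidenceIsometries (Γ : AddSubgroup (EuclideanSpace ℝ (Fin d))) :
    Set (EuclideanSpace ℝ (Fin d) ≃ₗᵢ[ℝ] EuclideanSpace ℝ (Fin d)) :=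
  {R | coincidenceIndex Γ R ≠ 0}

/-- `SOC(Γ)`: the orientation preserving coincidence isometries. -/
def coincidenceRotations (Γ : AddSubgroup (EuclideanSpace ℝ (Fin d))) :
    Set (EuclideanSpace ℝ (Fin d) ≃ₗᵢ[ℝ] EuclideanSpace ℝ (Fin d)) :=
  {R | R ∈ coincidenceIsometries Γ ∧
    LinearMap.det
      (R.toLinearEquiv : EuclideanSpace ℝ (Fin d) →ₗ[ℝ] EuclideanSpace ℝ (Fin d)) = 1}

/-- The coincidence rotations of `Γ` of coincidence index `n`. -/
def coincidenceRotationsOfIndex (Γ : AddSubgroup (EuclideanSpace ℝ (Fin d))) (n : ℕ) :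
    Set (EuclideanSpace ℝ (Fin d) ≃ₗᵢ[ℝ] EuclideanSpace ℝ (Fin d)) :=
  {R | R ∈ coincidenceRotations Γ ∧ coincidenceIndex Γ R = n}

/-- The coincidence site lattices of `Γ` of index `n` (each counted once, however many
coincidence isometries produce it). -/
def cslsOfIndex (Γ : AddSubgroup (EuclideanSpace ℝ (Fin d))) (n : ℕ) :
    Set (AddSubgroup (EuclideanSpace ℝ (Fin d))) :=
  {L | ∃ R ∈ coincidenceIsometries Γ, csl Γ R = L ∧ coincidenceIndex Γ R = n}

/-- The dual lattice: all `y` with `⟨x, y⟩ ∈ ℤ` for every `x ∈ Γ`. -/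
def dualLattice (Γ : AddSubgroup (EuclideanSpace ℝ (Fin d))) :
    AddSubgroup (EuclideanSpace ℝ (Fin d)) where
  carrier := {y | ∀ x ∈ Γ, ∃ m : ℤ, inner ℝ x y = (m : ℝ)}
  zero_mem' := fun x _ => ⟨0, by simp⟩
  add_mem' := by
    intro a b ha hb x hx
    obtain ⟨m, hm⟩ := ha x hx
    obtain ⟨k, hk⟩ := hb x hx
    exact ⟨m + k, by rw [inner_add_right, hm, hk]; push_cast; rfl⟩
  neg_mem' := by
    intro a ha x hx
    obtain ⟨m, hm⟩ := ha x hx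
    exact ⟨-m, by rw [inner_neg_right, hm]; push_cast; rfl⟩

end General

/-- The root lattice `D₄`: integer vectors with even coordinate sum. -/
def latticeD4 : AddSubgroup E4 where
  carrier := {x | ∃ a : Fin 4 → ℤ, (∀ i, x i = (a i : ℝ)) ∧ Even (∑ i, a i)}
  zero_mem' := ⟨0, by simp, by simp⟩
  add_mem' := by
    rintro x y ⟨a, ha, ha'⟩ ⟨b, hb, hb'⟩
    refine ⟨a + b, fun i => by simp [ha, hb], ?_⟩
    simpa [Finset.sum_add_distrib] using ha'.add hb'
  neg_mem' := by
    rintro x ⟨a, ha, ha'⟩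
    refine ⟨-a, fun i => by simp [ha], ?_⟩
    simpa using ha'

/-- The centred hypercubic lattice `D₄*`, the dual of `D₄`. -/
def latticeD4Star : AddSubgroup E4 := dualLattice latticeD4

/-- `D₄*` is the lattice of Hurwitz integers, the `ℤ`-span of `1`, `i`, `j`, `(1+i+j+k)/2`. -/
theorem latticeD4Star_eq_closure :
    latticeD4Star = AddSubgroup.closure
      ({!₂[1, 0, 0, 0], !₂[0, 1, 0, 0], !₂[0, 0, 1, 0], !₂[1/2, 1/2, 1/2, 1/2]} : Set E4) := by
  apply le_antisymm
  · intro y hy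
    have key : ∀ a : Fin 4 → ℤ, Even (∑ i, a i) →
        ∃ m : ℤ, ∑ i, (a i : ℝ) * y i = (m : ℝ) := by
      intro a ha
      obtain ⟨m, hm⟩ := hy (WithLp.toLp 2 fun i => (a i : ℝ)) ⟨a, fun i => rfl, ha⟩
      refine ⟨m, ?_⟩
      rw [← hm]
      simp [PiLp.inner_apply, mul_comm]
    obtain ⟨m0, h0⟩ := key ![1, 0, 0, 1] (by decide)
    obtain ⟨m1, h1⟩ := key ![0, 1, 0, 1] (by decide)
    obtain ⟨m2, h2⟩ := key ![0, 0, 1, 1] (by decide)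
    obtain ⟨m3, h3⟩ := key ![0, 0, 0, 2] (by decide)
    simp [Fin.sum_univ_four] at h0 h1 h2 h3
    have hy' : y = (m0 - m3) • (!₂[1, 0, 0, 0] : E4) + (m1 - m3) • (!₂[0, 1, 0, 0] : E4)
        + (m2 - m3) • (!₂[0, 0, 1, 0] : E4) + m3 • (!₂[1/2, 1/2, 1/2, 1/2] : E4) := by
      ext i
      fin_cases i <;> simp <;> linarith
    rw [hy']
    refine add_mem (add_mem (add_mem ?_ ?_) ?_) ?_ <;>
      exact zsmul_mem (AddSubgroup.subset_closure (by simp)) _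
  · rw [AddSubgroup.closure_le]
    rintro y hy x ⟨a, ha, k, hk⟩
    rw [Fin.sum_univ_four] at hk
    have hk' : (a 0 : ℝ) + a 1 + a 2 + a 3 = k + k := by exact_mod_cast hk
    simp only [Set.mem_insert_iff, Set.mem_singleton_iff] at hy
    rcases hy with rfl | rfl | rfl | rfl
    · exact ⟨a 0, by simp [PiLp.inner_apply, Fin.sum_univ_four, ha]⟩
    · exact ⟨a 1, by simp [PiLp.inner_apply, Fin.sum_univ_four, ha]⟩
    · exact ⟨a 2, by simp [PiLp.inner_apply, Fin.sum_univ_four, ha]⟩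
    · refine ⟨k, ?_⟩
      simp [PiLp.inner_apply, Fin.sum_univ_four, ha]
      linarith

/-! Identify ℝ⁴ with the quaternions so that D₄* becomes the Hurwitz order 𝓗, with norm N. Writing
an isometry as a product of reflections x ↦ -u x̄ u shows that it is x ↦ a x b or x ↦ a x̄ b with
unit a, b, and the determinant singles out the first form (`Quaternion.exists_isometry_eq`). If 𝓗 ∩
R𝓗 has finite index, averaging over 1, i, j, k shows that a and b̄ are real multiples of Hurwitz
integers. They can be normalised to q(1+i)^ε and p(1+i)^ε with q, p primitive of odd norm, a common
ε ∈ {0, 1} and N(q)N(p) = c² (`exists_eq_rotOf`); the triple is unique up to a common sign of q and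
p (`rotOf_eq_iff`). Write N(q) = gk² and N(p) = gl² with k, l coprime, so that c = gkl. Since 1+i
normalises 𝓗, ε drops out and the CSL is K = {x : c divides q̄xp}.

The driving fact is that a primitive element of odd norm generates 𝓗 as a two-sided ideal
(`dvd_of_forall_dvd_mul_mul`). It yields the index of K, namely gk²l² (`index_cslKernel`). Moreover
K depends only on the left divisors of q and p of norms gk and gl, and it determines c and the right
ideals of these divisors (`exists_cslKernel_eq`, `cslKernel_inj`). Conjugation preserves 𝓗, so
orientation-reversing isometries produce no further CSLs.

Let ψ(m) be the number of right ideals generated by primitive elements of odd norm m. There are 24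
units, so for given (g, k, l) there are 24ψ(gk²) · 24ψ(gl²) pairs (q, p); the two values of ε cancel
the sign ambiguity. Hence the rotations of index n number 576 Σ ψ(gk²)ψ(gl²) and the CSLs Σ
ψ(gk)ψ(gl), both sums over n = gk²l² with k, l coprime.

Finally ψ is multiplicative by the Chinese remainder theorem, ψ(p) = p+1 by counting zeros of the
norm form modulo p, and each further factor p multiplies ψ by p because exactly one ideal of norm p
destroys primitivity. The closed forms are geometric sums of these values, and the Euler factors are
sums of geometric series. Comparison with n² d(n), whose Dirichlet series is ζ(s-2)², gives absolute
convergence for Re s > 3. -/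

open scoped Quaternion
open Quaternion

/-! ### The Hurwitz order, its coordinates and its norm -/

/-- The quaternion with coordinates `a, b, c, d` in the basis `1, i, j, (1+i+j+k)/2`. -/
noncomputable def hurwitzCoord (a b c d : ℤ) : ℍ :=
  ⟨a + d / 2, b + d / 2, c + d / 2, d / 2⟩

section Coord

variable (a b c d : ℤ)

@[simp] theorem hurwitzCoord_re : (hurwitzCoord a b c d).re = a + d / 2 := rfl
@[simp] theorem hurwitzCoord_imI : (hurwitzCoord a b c d).imI = b + d / 2 := rfl
@[simp] theorem hurwitzCoord_imJ : (hurwitzCoord a b c d).imJ = c + d / 2 := rfl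
@[simp] theorem hurwitzCoord_imK : (hurwitzCoord a b c d).imK = d / 2 := rfl

end Coord

/-- The Hurwitz order, as a subring of the real quaternions. -/
noncomputable def hurwitzOrder : Subring ℍ where
  carrier := {x | ∃ a b c d : ℤ, hurwitzCoord a b c d = x}
  zero_mem' := ⟨0, 0, 0, 0, by ext <;> simp⟩
  one_mem' := ⟨1, 0, 0, 0, by ext <;> simp⟩
  add_mem' := by
    rintro _ _ ⟨a, b, c, d, rfl⟩ ⟨a', b', c', d', rfl⟩
    exact ⟨a + a', b + b', c + c', d + d', by ext <;> simp <;> ring⟩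
  neg_mem' := by
    rintro _ ⟨a, b, c, d, rfl⟩
    exact ⟨-a, -b, -c, -d, by ext <;> simp <;> ring⟩
  mul_mem' := by
    rintro _ _ ⟨a, b, c, d, rfl⟩ ⟨a', b', c', d', rfl⟩
    exact ⟨a * a' - b * b' - c * c' - b * d' - d * c' - d * d' - b * c' + c * b',
      a * b' + b * a' + d * b' + c * d' - d * c' - b * c' + c * b',
      a * c' + c * a' + c * d' - b * d' + d * b' - b * c' + c * b',
      a * d' + a' * d + d * d' + 2 * b * c' - 2 * c * b' + b * d' + d * c' - c * d' - d * b', by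
      ext <;> simp <;> ring⟩

/-- The type of Hurwitz integers. -/
abbrev HurwitzInt : Type := hurwitzOrder

local notation "𝓗" => HurwitzInt

namespace HurwitzInt

/-- The Hurwitz integer with the given coordinates in the basis `1, i, j, (1+i+j+k)/2`. -/
noncomputable def mk (a b c d : ℤ) : 𝓗 := ⟨hurwitzCoord a b c d, a, b, c, d, rfl⟩

@[simp] theorem coe_mk (a b c d : ℤ) : (mk a b c d : ℍ) = hurwitzCoord a b c d := rfl

theorem exists_eq_mk (x : 𝓗) : ∃ a b c d, x = mk a b c d := by
  obtain ⟨_, a, b, c, d, rfl⟩ := x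
  exact ⟨a, b, c, d, rfl⟩

theorem mk_inj {a b c d a' b' c' d' : ℤ} (h : mk a b c d = mk a' b' c' d') :
    a = a' ∧ b = b' ∧ c = c' ∧ d = d' := by
  have h' := congrArg Subtype.val h
  have h0 := congrArg QuaternionAlgebra.re h'
  have h1 := congrArg QuaternionAlgebra.imI h'
  have h2 := congrArg QuaternionAlgebra.imJ h'
  have h3 := congrArg QuaternionAlgebra.imK h'
  simp at h0 h1 h2 h3
  subst h3
  simp at h0 h1 h2
  exact ⟨h0, h1, h2, rfl⟩

theorem mk_add (a b c d a' b' c' d' : ℤ) :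
    mk a b c d + mk a' b' c' d' = mk (a + a') (b + b') (c + c') (d + d') := by
  apply Subtype.ext; ext <;> simp <;> ring

theorem coe_inj {x y : 𝓗} : (x : ℍ) = y ↔ x = y := Subtype.coe_inj

/-- The coordinates of a Hurwitz integer form an additive equivalence. -/
noncomputable def coordEquiv : (Fin 4 → ℤ) ≃+ 𝓗 :=
  AddEquiv.ofBijective
    ({ toFun := fun v => mk (v 0) (v 1) (v 2) (v 3)
       map_zero' := by apply Subtype.ext; ext <;> simp
       map_add' := fun v w => by simp [mk_add] } : (Fin 4 → ℤ) →+ 𝓗)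
    ⟨fun v w h => by
      obtain ⟨h0, h1, h2, h3⟩ := mk_inj h
      funext i; fin_cases i <;> assumption,
     fun x => by
      obtain ⟨a, b, c, d, rfl⟩ := exists_eq_mk x
      exact ⟨![a, b, c, d], rfl⟩⟩

noncomputable instance : StarRing 𝓗 where
  star x := ⟨star (x : ℍ), by
    obtain ⟨a, b, c, d, rfl⟩ := exists_eq_mk x
    exact ⟨a + d, -b, -c, -d, by ext <;> simp <;> ring⟩⟩
  star_involutive x := Subtype.ext (star_star _)
  star_mul x y := Subtype.ext (star_mul _ _)
  star_add x y := Subtype.ext (star_add _ _)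

@[simp] theorem coe_star (x : 𝓗) : ((star x : 𝓗) : ℍ) = star (x : ℍ) := rfl

theorem normSq_mk (a b c d : ℤ) : normSq (hurwitzCoord a b c d) =
    ((a ^ 2 + b ^ 2 + c ^ 2 + d ^ 2 + (a + b + c) * d : ℤ) : ℝ) := by
  simp [normSq_def']; ring

theorem exists_nat_normSq (x : 𝓗) : ∃ n : ℕ, normSq (x : ℍ) = n := by
  obtain ⟨a, b, c, d, rfl⟩ := exists_eq_mk x
  have h := normSq_mk a b c d
  have h0 := normSq_nonneg (a := hurwitzCoord a b c d)
  rw [h] at h0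
  obtain ⟨n, hn⟩ := Int.eq_ofNat_of_zero_le (by exact_mod_cast h0 :
    0 ≤ a ^ 2 + b ^ 2 + c ^ 2 + d ^ 2 + (a + b + c) * d)
  exact ⟨n, by rw [coe_mk, h, hn]; simp⟩

/-- The norm `x * star x` of a Hurwitz integer, as a natural number. -/
noncomputable def nrm : 𝓗 →*₀ ℕ :=
  have h (x : 𝓗) : ((exists_nat_normSq x).choose : ℝ) = normSq (x : ℍ) :=
    (exists_nat_normSq x).choose_spec.symm
  { toFun := fun x => (exists_nat_normSq x).choose
    map_zero' := by
      rw [← Nat.cast_inj (R := ℝ), h]; simp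
    map_one' := by
      rw [← Nat.cast_inj (R := ℝ), h]; simp
    map_mul' := fun x y => by
      rw [← Nat.cast_inj (R := ℝ), Nat.cast_mul, h, h, h]; simp }

theorem coe_nrm (x : 𝓗) : (nrm x : ℝ) = normSq (x : ℍ) := (exists_nat_normSq x).choose_spec.symm

theorem nrm_mk (a b c d : ℤ) :
    (nrm (mk a b c d) : ℤ) = a ^ 2 + b ^ 2 + c ^ 2 + d ^ 2 + (a + b + c) * d := by
  have := coe_nrm (mk a b c d)
  rw [coe_mk, normSq_mk] at this
  exact_mod_cast this

theorem mul_star (x : 𝓗) : x * star x = (nrm x : 𝓗) := by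
  apply Subtype.ext
  rw [Subring.coe_mul, coe_star, self_mul_star, ← coe_nrm]; rfl

theorem star_mul' (x : 𝓗) : star x * x = (nrm x : 𝓗) := by
  apply Subtype.ext
  rw [Subring.coe_mul, coe_star, star_mul_self, ← coe_nrm]; rfl

@[simp] theorem nrm_star (x : 𝓗) : nrm (star x) = nrm x := by
  have h : (nrm (star x) : ℝ) = nrm x := by rw [coe_nrm, coe_nrm, coe_star, normSq_star]
  exact_mod_cast h

@[simp] theorem nrm_eq_zero {x : 𝓗} : nrm x = 0 ↔ x = 0 := by
  rw [← Nat.cast_eq_zero (R := ℝ), coe_nrm, normSq_eq_zero, ← coe_inj]; rfl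

@[simp] theorem nrm_natCast (n : ℕ) : nrm (n : 𝓗) = n ^ 2 := by
  have h : (nrm (n : 𝓗) : ℝ) = (n : ℝ) ^ 2 := by rw [coe_nrm]; simp [normSq_natCast]
  exact_mod_cast h

instance : CharZero 𝓗 :=
  ⟨fun m n h => by
    have := congrArg (fun x : 𝓗 => (x : ℍ).re) h
    simpa using this⟩

theorem natCast_comm (n : ℕ) (x : 𝓗) : (n : 𝓗) * x = x * n := Nat.cast_comm n x

theorem star_natCast (n : ℕ) : star (n : 𝓗) = n := by simp

/-- A Hurwitz integer that is a real number is an integer. -/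
theorem exists_int_eq_of_im_eq_zero {x : 𝓗} {r : ℝ} (h : (x : ℍ) = r) : ∃ z : ℤ, r = z := by
  obtain ⟨a, b, c, d, rfl⟩ := exists_eq_mk x
  have h0 := congrArg QuaternionAlgebra.re h
  have h3 := congrArg QuaternionAlgebra.imK h
  simp at h0 h3
  subst h3
  exact ⟨a, by simpa using h0.symm⟩

theorem natCast_dvd_natCast {k n : ℕ} : (k : 𝓗) ∣ n ↔ k ∣ n := by
  refine ⟨fun ⟨x, hx⟩ => ?_, fun h => Nat.cast_dvd_cast h⟩
  rcases Nat.eq_zero_or_pos k with rfl | hk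
  · have : n = 0 := by exact_mod_cast (by simpa using hx : (n : 𝓗) = 0)
    simp [this]
  · have hx' : (x : ℍ) = ((n / k : ℝ) : ℝ) := by
      have h1 : (n : ℍ) = k * (x : ℍ) := by exact_mod_cast congrArg Subtype.val hx
      have hk' : (k : ℝ) ≠ 0 := by exact_mod_cast hk.ne'
      have h2 : ((k : ℝ) : ℍ) * ((n / k : ℝ) : ℍ) = n := by
        rw [← Quaternion.coe_mul, mul_div_cancel₀ _ hk']; rfl
      have hk'' : ((k : ℝ) : ℍ) ≠ 0 := by
        intro h; exact hk' (by simpa using congrArg QuaternionAlgebra.re h)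
      exact mul_left_cancel₀ hk'' (h1.symm.trans h2.symm)
    obtain ⟨z, hz⟩ := exists_int_eq_of_im_eq_zero hx'
    have hk0 : (k : ℝ) ≠ 0 := by exact_mod_cast hk.ne'
    rw [div_eq_iff hk0] at hz
    have : (n : ℤ) = z * k := by exact_mod_cast hz
    exact Int.natCast_dvd_natCast.1 ⟨z, by rw [this]; ring⟩

theorem nrm_eq_one_iff {x : 𝓗} : nrm x = 1 ↔ IsUnit x := by
  constructor
  · intro h
    have h1 := mul_star x
    have h2 := star_mul' x
    rw [h, Nat.cast_one] at h1 h2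
    exact ⟨⟨x, star x, h1, h2⟩, rfl⟩
  · intro h
    have := h.map nrm
    exact Nat.isUnit_iff.1 this

/-! ### Euclidean division and principal right ideals -/

/-- Rounding: every quaternion is at distance less than `1` from a Hurwitz integer. -/
theorem exists_normSq_sub_lt (x : ℍ) : ∃ h : 𝓗, normSq (x - (h : ℍ)) < 1 := by
  have key : ∀ t : ℝ, (t - round t) ^ 2 ≤ 1 / 4 ∧
      ((t - round t) ^ 2 = 1 / 4 → ∃ n : ℤ, t = n + 1 / 2) := by
    intro t
    have h := abs_sub_round t
    have h' := abs_le.1 h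
    refine ⟨by nlinarith, fun h2 => ?_⟩
    have : (t - round t - 1 / 2) * (t - round t + 1 / 2) = 0 := by nlinarith
    rcases mul_eq_zero.1 this with h | h
    · exact ⟨round t, by linarith⟩
    · exact ⟨round t - 1, by push_cast; linarith⟩
  obtain ⟨h0, e0⟩ := key x.re
  obtain ⟨h1, e1⟩ := key x.imI
  obtain ⟨h2, e2⟩ := key x.imJ
  obtain ⟨h3, e3⟩ := key x.imK
  by_cases hlt : (x.re - round x.re) ^ 2 + (x.imI - round x.imI) ^ 2 + (x.imJ - round x.imJ) ^ 2 +
      (x.imK - round x.imK) ^ 2 < 1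
  · refine ⟨mk (round x.re - round x.imK) (round x.imI - round x.imK) (round x.imJ - round x.imK)
      (2 * round x.imK), ?_⟩
    rw [normSq_def']
    simp
    exact hlt
  -- Distance 1 from the nearest integer point forces every coordinate to be half an odd integer, so
  -- x is itself a Hurwitz integer.
  · obtain ⟨n0, e0⟩ := e0 (by linarith)
    obtain ⟨n1, e1⟩ := e1 (by linarith)
    obtain ⟨n2, e2⟩ := e2 (by linarith)
    obtain ⟨n3, e3⟩ := e3 (by linarith)
    refine ⟨mk (n0 - n3) (n1 - n3) (n2 - n3) (2 * n3 + 1), ?_⟩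
    rw [normSq_def']
    simp [e0, e1, e2, e3]
    ring_nf
    norm_num

theorem exists_nrm_sub_lt (a : 𝓗) {b : 𝓗} (hb : b ≠ 0) : ∃ q, nrm (a - b * q) < nrm b := by
  have hb' : (b : ℍ) ≠ 0 := by simpa using hb
  obtain ⟨q, hq⟩ := exists_normSq_sub_lt ((b : ℍ)⁻¹ * a)
  refine ⟨q, ?_⟩
  have h : (nrm (a - b * q) : ℝ) < nrm b := by
    rw [coe_nrm, coe_nrm]
    have : ((a - b * q : 𝓗) : ℍ) = b * ((b : ℍ)⁻¹ * a - q) := by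
      rw [mul_sub, mul_inv_cancel_left₀ hb']; rfl
    rw [this, map_mul]
    have := normSq_nonneg (a := (b : ℍ))
    have h0 : 0 < normSq (b : ℍ) := lt_of_le_of_ne this (normSq_ne_zero.2 hb').symm
    nlinarith
  exact_mod_cast h

/-- Every right ideal is principal. -/
theorem exists_generator (I : AddSubgroup 𝓗) (hI : ∀ x ∈ I, ∀ y, x * y ∈ I) :
    ∃ r, ∀ x, x ∈ I ↔ r ∣ x := by
  by_cases hbot : ∃ x ∈ I, x ≠ 0
  · classical
    obtain ⟨x0, hx0, hx0'⟩ := hbot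
    have hex : ∃ n, ∃ x ∈ I, x ≠ 0 ∧ nrm x = n := ⟨_, x0, hx0, hx0', rfl⟩
    obtain ⟨r, hr, hr0, hrn⟩ := Nat.find_spec hex
    refine ⟨r, fun x => ⟨fun hx => ?_, ?_⟩⟩
    · obtain ⟨q, hq⟩ := exists_nrm_sub_lt x hr0
      have hmem : x - r * q ∈ I := I.sub_mem hx (hI r hr q)
      by_cases h0 : x - r * q = 0
      · exact ⟨q, sub_eq_zero.1 h0⟩
      · rw [hrn] at hq
        exact absurd ⟨_, hmem, h0, rfl⟩ (Nat.find_min hex hq)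
    · rintro ⟨y, rfl⟩
      exact hI r hr y
  · push Not at hbot
    refine ⟨0, fun x => ⟨fun hx => by rw [hbot x hx], fun hx => ?_⟩⟩
    rw [zero_dvd_iff.1 hx]; exact I.zero_mem

/-! ### Primitive elements and common left divisors with integers -/

/-- A Hurwitz integer is primitive if no integer greater than `1` divides it. -/
def Prim (x : 𝓗) : Prop := ∀ k : ℕ, (k : 𝓗) ∣ x → k = 1

theorem Prim.ne_zero {x : 𝓗} (h : Prim x) : x ≠ 0 := by
  rintro rfl
  exact absurd (h 0 (dvd_zero _)) (by norm_num)

theorem natCast_dvd_mul_left {k : ℕ} {y : 𝓗} (x : 𝓗) (h : (k : 𝓗) ∣ y) : (k : 𝓗) ∣ x * y := by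
  obtain ⟨z, rfl⟩ := h
  exact ⟨x * z, by rw [← mul_assoc, ← natCast_comm, mul_assoc]⟩

theorem natCast_dvd_star {k : ℕ} {y : 𝓗} : (k : 𝓗) ∣ star y ↔ (k : 𝓗) ∣ y := by
  have key : ∀ y : 𝓗, (k : 𝓗) ∣ y → (k : 𝓗) ∣ star y := by
    rintro _ ⟨z, rfl⟩
    exact ⟨star z, by rw [star_mul, star_natCast, natCast_comm]⟩
  exact ⟨fun h => by simpa using key _ h, key y⟩

theorem Prim.star {x : 𝓗} (h : Prim x) : Prim (star x) := fun k hk => h k (natCast_dvd_star.1 hk)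

theorem natCast_mul_dvd_iff {k : ℕ} (hk : k ≠ 0) {n : ℕ} {x : 𝓗} :
    ((k * n : ℕ) : 𝓗) ∣ k * x ↔ (n : 𝓗) ∣ x := by
  have hk' : (k : 𝓗) ≠ 0 := by exact_mod_cast hk
  constructor
  · rintro ⟨y, hy⟩
    exact ⟨y, mul_left_cancel₀ hk' (by rw [hy]; push_cast; rw [mul_assoc])⟩
  · rintro ⟨y, rfl⟩
    exact ⟨y, by push_cast; rw [mul_assoc]⟩

theorem dvd_of_coprime {k d : ℕ} (h : k.Coprime d) {x : 𝓗} (hx : (k : 𝓗) ∣ d * x) :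
    (k : 𝓗) ∣ x := by
  have hb := Nat.gcd_eq_gcd_ab k d
  rw [h] at hb
  have hb' : (1 : 𝓗) = k * (k.gcdA d : ℤ) + d * (k.gcdB d : ℤ) := by exact_mod_cast congrArg (Int.cast : ℤ → 𝓗) hb
  have : x = k * ((k.gcdA d : ℤ) * x) + (d * x) * (k.gcdB d : ℤ) := by
    conv_lhs => rw [← one_mul x, hb']
    rw [add_mul, mul_assoc, mul_assoc, mul_assoc, (Int.cast_commute (k.gcdB d) x).eq]
  rw [this]
  exact dvd_add (dvd_mul_right _ _) (hx.mul_right _)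

/-- After cancelling gcd(z, d), the remaining factor of z is coprime to the cofactor of d, so it
divides x and equals 1. This is how every divisibility of quaternions is turned into one of
integers. -/
theorem Prim.dvd_of_dvd_mul {x : 𝓗} (hx : Prim x) {z d : ℕ} (h : (z : 𝓗) ∣ d * x) : z ∣ d := by
  rcases Nat.eq_zero_or_pos z with rfl | hz
  · have h0 : (d : 𝓗) * x = 0 := by simpa using h
    rcases mul_eq_zero.1 h0 with h1 | h1
    · rw [Nat.cast_eq_zero.1 h1]
    · exact absurd h1 hx.ne_zero
  · obtain ⟨g, z', d', hg, hc, rfl, rfl⟩ := Nat.exists_coprime' (n := d) (Nat.gcd_pos_of_pos_left d hz)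
    rw [mul_comm z' g, mul_comm d' g, Nat.cast_mul g d', mul_assoc, natCast_mul_dvd_iff hg.ne'] at h
    have := hx _ (dvd_of_coprime hc h)
    rw [this, one_mul]; exact dvd_mul_left _ _

/-- A primitive Hurwitz integer of odd norm generates the unit ideal as a two-sided ideal. -/
theorem dvd_of_forall_dvd_mul_mul {p : 𝓗} (hp : Prim p) (hodd : Odd (nrm p)) {r a : 𝓗}
    (h : ∀ x, r ∣ a * x * p) : r ∣ a := by
  let S : AddSubgroup ℤ :=
    { carrier := {n | r ∣ a * (n : 𝓗)}
      zero_mem' := by simp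
      add_mem' := fun {m n} hm hn => by
        simp only [Set.mem_ofPred_eq] at *
        rw [Int.cast_add, mul_add]; exact dvd_add hm hn
      neg_mem' := fun {m} hm => by
        simp only [Set.mem_ofPred_eq] at *
        rw [Int.cast_neg, mul_neg]; exact dvd_neg.2 hm }
  have hxy : ∀ x y, r ∣ a * (x * p * y) := fun x y => by
    have := (h x).mul_right y
    rwa [show a * (x * p * y) = a * x * p * y by simp only [mul_assoc]]
  have hN : (nrm p : ℤ) ∈ S := by
    change r ∣ a * _
    have := hxy 1 (star p)
    rw [one_mul, mul_star] at this
    exact_mod_cast this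
  -- With e running over 1, i, j, k one has Σ e w ē = 4 Re w, so 4 Re(yp) lies in the two-sided
  -- ideal of p. Taking y = 1, i, j, k extracts each coordinate of p up to sign; the element `mk
  -- (-1) (-1) (-1) 2` is k.
  have hsum : ∀ y, ∀ n : ℤ, ∀ z : 𝓗, z = y * p * 1 + mk 0 1 0 0 * y * p * star (mk 0 1 0 0) +
      mk 0 0 1 0 * y * p * star (mk 0 0 1 0) +
      mk (-1) (-1) (-1) 2 * y * p * star (mk (-1) (-1) (-1) 2) → (z : ℍ).re = n →
      (z : ℍ).imI = 0 → (z : ℍ).imJ = 0 → (z : ℍ).imK = 0 → n ∈ S := by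
    intro y n z hz h0 h1 h2 h3
    change r ∣ a * _
    have : (n : 𝓗) = z := by
      apply Subtype.ext
      ext
      · rw [h0]; simp
      · rw [h1]; simp
      · rw [h2]; simp
      · rw [h3]; simp
    rw [this, hz, mul_add, mul_add, mul_add]
    exact dvd_add (dvd_add (dvd_add (hxy _ _) (hxy _ _)) (hxy _ _)) (hxy _ _)
  obtain ⟨a0, a1, a2, a3, hp'⟩ := exists_eq_mk p
  have h0 : 2 * (2 * a0 + a3) ∈ S := by
    refine hsum 1 _ _ rfl ?_ ?_ ?_ ?_ <;> rw [hp'] <;> simp <;> ring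
  have h1 : -2 * (2 * a1 + a3) ∈ S := by
    refine hsum (mk 0 1 0 0) _ _ rfl ?_ ?_ ?_ ?_ <;> rw [hp'] <;> simp <;> ring
  have h2 : -2 * (2 * a2 + a3) ∈ S := by
    refine hsum (mk 0 0 1 0) _ _ rfl ?_ ?_ ?_ ?_ <;> rw [hp'] <;> simp <;> ring
  have h3 : -2 * a3 ∈ S := by
    refine hsum (mk (-1) (-1) (-1) 2) _ _ rfl ?_ ?_ ?_ ?_ <;> rw [hp'] <;> simp <;> ring
  obtain ⟨g, hg⟩ := Int.subgroup_cyclic S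
  rw [← AddSubgroup.zmultiples_eq_closure] at hg
  have hdvd : ∀ n ∈ S, g ∣ n := fun n hn => by
    rw [hg] at hn; exact Int.mem_zmultiples_iff.1 hn
  have hgS : g ∈ S := by rw [hg]; exact AddSubgroup.mem_zmultiples g
  -- A prime dividing g divides N(p), hence is odd, so it can be cancelled from the factors 2 and
  -- would divide all coordinates of p.
  have hg1 : g.natAbs = 1 := by
    by_contra hne
    obtain ⟨l, hl, hlg⟩ := Nat.exists_prime_and_dvd hne
    have hlg' : (l : ℤ) ∣ g := Int.natCast_dvd.2 hlg
    have hlN : l ∣ nrm p := Int.natCast_dvd_natCast.1 (hlg'.trans (hdvd _ hN))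
    have hl2 : IsCoprime (l : ℤ) 2 := by
      rw [show (2 : ℤ) = ((2 : ℕ) : ℤ) from rfl, Nat.isCoprime_iff_coprime]
      exact (hodd.of_dvd_nat hlN).coprime_two_right
    have e3 : (l : ℤ) ∣ a3 := by
      have := hlg'.trans (hdvd _ h3)
      rw [neg_mul, dvd_neg] at this
      exact hl2.dvd_of_dvd_mul_left this
    have e0 : (l : ℤ) ∣ a0 := hl2.dvd_of_dvd_mul_left
      ((dvd_add_left e3).1 (hl2.dvd_of_dvd_mul_left (hlg'.trans (hdvd _ h0))))
    have e1 : (l : ℤ) ∣ a1 := by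
      have := hlg'.trans (hdvd _ h1)
      rw [neg_mul, dvd_neg] at this
      exact hl2.dvd_of_dvd_mul_left ((dvd_add_left e3).1 (hl2.dvd_of_dvd_mul_left this))
    have e2 : (l : ℤ) ∣ a2 := by
      have := hlg'.trans (hdvd _ h2)
      rw [neg_mul, dvd_neg] at this
      exact hl2.dvd_of_dvd_mul_left ((dvd_add_left e3).1 (hl2.dvd_of_dvd_mul_left this))
    obtain ⟨b0, rfl⟩ := e0
    obtain ⟨b1, rfl⟩ := e1
    obtain ⟨b2, rfl⟩ := e2
    obtain ⟨b3, rfl⟩ := e3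
    apply hl.one_lt.ne'
    apply hp l
    refine ⟨mk b0 b1 b2 b3, ?_⟩
    rw [hp']
    apply Subtype.ext; ext <;> simp <;> ring
  have h1S : (1 : ℤ) ∈ S := by
    rcases Int.natAbs_eq g with h | h <;> rw [hg1] at h
    · rw [h] at hgS; exact hgS
    · rw [h] at hgS; exact neg_mem_iff.1 hgS
  have h1S' : r ∣ a * ((1 : ℤ) : 𝓗) := h1S
  rwa [Int.cast_one, mul_one] at h1S'

/-- Multiplying by r̄ trades left divisibility by a quaternion for divisibility by a central
integer. -/
theorem dvd_iff_nrm_dvd {r y : 𝓗} (hr : r ≠ 0) : r ∣ y ↔ (nrm r : 𝓗) ∣ star r * y := by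
  constructor
  · rintro ⟨z, rfl⟩
    exact ⟨z, by rw [← mul_assoc, star_mul']⟩
  · rintro ⟨z, hz⟩
    refine ⟨z, mul_left_cancel₀ (star_ne_zero.2 hr) ?_⟩
    rw [hz, ← mul_assoc, star_mul']

/-- The greatest common left divisor of `x` and an integer `d` dividing the norm of `x`. -/
theorem exists_gcld {x : 𝓗} {d : ℕ} (hdx : d ∣ nrm x)
    (hx : ∀ k : ℕ, k ∣ d → (k : 𝓗) ∣ x → k = 1) :
    ∃ r, Prim r ∧ nrm r = d ∧ (∀ y, r ∣ y ↔ ∃ u v, y = x * u + d * v) ∧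
      ∀ y, r ∣ y ↔ (d : 𝓗) ∣ star x * y := by
  obtain ⟨r, hr⟩ := exists_generator
    { carrier := {y | ∃ u v, y = x * u + d * v}
      zero_mem' := ⟨0, 0, by simp⟩
      add_mem' := by
        rintro _ _ ⟨u, v, rfl⟩ ⟨u', v', rfl⟩
        exact ⟨u + u', v + v', by rw [mul_add, mul_add]; abel⟩
      neg_mem' := by
        rintro _ ⟨u, v, rfl⟩
        exact ⟨-u, -v, by rw [mul_neg, mul_neg, neg_add]⟩ }
    (by
      rintro _ ⟨u, v, rfl⟩ y
      exact ⟨u * y, v * y, by rw [add_mul, mul_assoc, mul_assoc]⟩)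
  replace hr : ∀ y, r ∣ y ↔ ∃ u v, y = x * u + d * v := fun y => (hr y).symm
  have hrx : r ∣ x := (hr x).2 ⟨1, 0, by simp⟩
  have hrd : r ∣ (d : 𝓗) := (hr _).2 ⟨0, 1, by simp⟩
  have hprim : Prim r := fun k hk =>
    hx k (natCast_dvd_natCast.1 (hk.trans hrd)) (hk.trans hrx)
  obtain ⟨u, v, huv⟩ := (hr r).1 dvd_rfl
  have hsx : ∀ y, (d : 𝓗) ∣ star x * y → (d : 𝓗) ∣ star r * y := by
    intro y hy
    rw [huv, star_add, star_mul, star_mul, star_natCast, add_mul, mul_assoc, ← natCast_comm, mul_assoc]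
    exact dvd_add (natCast_dvd_mul_left _ hy) (dvd_mul_right _ _)
  have hxr : ∀ y, r ∣ y → (d : 𝓗) ∣ star x * y := by
    intro y hy
    obtain ⟨u, v, rfl⟩ := (hr y).1 hy
    rw [mul_add, ← mul_assoc, star_mul']
    refine dvd_add ((Nat.cast_dvd_cast hdx).mul_right _) (natCast_dvd_mul_left _ (dvd_mul_right _ _))
  -- Elements y of r𝓗 satisfy d | x̄y, and r̄ is a combination of x̄ and d; apply this to y = r.
  have h1 : d ∣ nrm r := by
    rw [← natCast_dvd_natCast, ← star_mul']
    exact hsx _ (hxr _ dvd_rfl)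
  have h2 : nrm r ∣ d := by
    apply hprim.star.dvd_of_dvd_mul
    obtain ⟨t, ht⟩ := hrd
    exact ⟨t, by rw [natCast_comm, ht, ← mul_assoc, star_mul']⟩
  have h3 : nrm r = d := Nat.dvd_antisymm h2 h1
  refine ⟨r, hprim, h3, hr, fun y => ⟨hxr y, fun h => ?_⟩⟩
  rw [dvd_iff_nrm_dvd hprim.ne_zero, h3]
  exact hsx y h

/-! ### Indices of one-sided ideals -/

/-- The right ideal `a𝓗`, as an additive subgroup. -/
noncomputable def rightIdeal (a : 𝓗) : AddSubgroup 𝓗 := (AddMonoidHom.mulLeft a).range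

@[simp] theorem mem_rightIdeal {a x : 𝓗} : x ∈ rightIdeal a ↔ a ∣ x :=
  ⟨fun ⟨y, hy⟩ => ⟨y, hy.symm⟩, fun ⟨y, hy⟩ => ⟨y, hy.symm⟩⟩

/-- The left ideal `𝓗a`, as an additive subgroup. -/
noncomputable def leftIdeal (a : 𝓗) : AddSubgroup 𝓗 := (AddMonoidHom.mulRight a).range

instance : Module.Free ℤ 𝓗 := Module.Free.of_equiv coordEquiv.toIntLinearEquiv
instance : Module.Finite ℤ 𝓗 := Module.Finite.equiv coordEquiv.toIntLinearEquiv

theorem index_rightIdeal_natCast (n : ℕ) : (rightIdeal (n : 𝓗)).index = n ^ 4 := by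
  have h := AddSubgroup.index_range_nsmul 𝓗 n
  have hr : Module.finrank ℤ 𝓗 = 4 := by
    rw [← coordEquiv.toIntLinearEquiv.finrank_eq]; simp
  rw [hr] at h
  rw [← h]
  congr 1
  ext x
  simp [eq_comm, Dvd.dvd]

theorem mulLeft_injective {a : 𝓗} (ha : a ≠ 0) :
    Function.Injective (AddMonoidHom.mulLeft a) := fun _ _ h => mul_left_cancel₀ ha h

theorem mulRight_injective {a : 𝓗} (ha : a ≠ 0) :
    Function.Injective (AddMonoidHom.mulRight a) := fun _ _ h => mul_right_cancel₀ ha h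

theorem index_rightIdeal_mul {a : 𝓗} (ha : a ≠ 0) (b : 𝓗) :
    (rightIdeal (a * b)).index = (rightIdeal a).index * (rightIdeal b).index := by
  have : rightIdeal (a * b) = (rightIdeal b).map (AddMonoidHom.mulLeft a) := by
    ext x
    constructor
    · rintro ⟨y, rfl⟩
      exact ⟨b * y, ⟨y, rfl⟩, (mul_assoc a b y).symm⟩
    · rintro ⟨_, ⟨y, rfl⟩, rfl⟩
      exact ⟨y, mul_assoc a b y⟩
  rw [this, AddSubgroup.index_map_of_injective _ (mulLeft_injective ha), mul_comm]
  rfl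

/-- If xa = āx with x nonzero, multiplicativity of the index lets the index of x𝓗 be cancelled.
Combined with aā = N(a) this yields the index N(a)². -/
theorem index_rightIdeal_star {a : 𝓗} (ha : a ≠ 0) :
    (rightIdeal (star a)).index = (rightIdeal a).index := by
  -- Any nonzero pure quaternion orthogonal to the imaginary part of a will do: i if the i and j
  -- components of a vanish, otherwise one built by rotating those two components through a right
  -- angle.
  obtain ⟨x, hx, hxa⟩ : ∃ x : 𝓗, x ≠ 0 ∧ x * a = star a * x := by
    obtain ⟨a0, a1, a2, a3, rfl⟩ := exists_eq_mk a
    by_cases h : 2 * a1 + a3 = 0 ∧ 2 * a2 + a3 = 0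
    · refine ⟨mk 0 1 0 0, fun h => ?_, ?_⟩
      · simpa using congrArg (fun x : 𝓗 => (x : ℍ).imI) h
      · have h1 : (a1 : ℝ) = - a3 / 2 := by
          have : (2 * a1 + a3 : ℝ) = 0 := by exact_mod_cast h.1
          linarith
        have h2 : (a2 : ℝ) = - a3 / 2 := by
          have : (2 * a2 + a3 : ℝ) = 0 := by exact_mod_cast h.2
          linarith
        apply Subtype.ext; ext <;> simp [h1, h2] <;> ring
    · refine ⟨mk 0 (2 * a2 + a3) (-(2 * a1 + a3)) 0, fun h' => h ?_, ?_⟩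
      · have e1 := congrArg (fun x : 𝓗 => (x : ℍ).imI) h'
        have e2 := congrArg (fun x : 𝓗 => (x : ℍ).imJ) h'
        simp only [coe_mk, hurwitzCoord_imI, hurwitzCoord_imJ] at e1 e2
        simp at e1 e2
        have e3 : (2 * a1 + a3 : ℝ) = 0 := by linarith
        have e4 : (2 * a2 + a3 : ℝ) = 0 := by linarith
        exact ⟨by exact_mod_cast e3, by exact_mod_cast e4⟩
      · apply Subtype.ext; ext <;> simp <;> ring
  have h := congrArg (fun x => (rightIdeal x).index) hxa
  simp only [index_rightIdeal_mul hx, index_rightIdeal_mul (star_ne_zero.2 ha)] at h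
  have hx0 : (rightIdeal x).index ≠ 0 := by
    intro h0
    have h1 := index_rightIdeal_mul hx (star x)
    rw [mul_star, index_rightIdeal_natCast, h0, zero_mul] at h1
    exact hx (nrm_eq_zero.1 (pow_eq_zero_iff (by norm_num) |>.1 h1))
  exact Nat.eq_of_mul_eq_mul_left (Nat.pos_of_ne_zero hx0) (by rw [h, mul_comm])

theorem index_rightIdeal {a : 𝓗} (ha : a ≠ 0) : (rightIdeal a).index = nrm a ^ 2 := by
  have h1 := index_rightIdeal_mul ha (star a)
  rw [mul_star, index_rightIdeal_natCast, index_rightIdeal_star ha] at h1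
  have h2 : (nrm a ^ 2) ^ 2 = (rightIdeal a).index ^ 2 := by rw [sq (rightIdeal a).index, ← h1]; ring
  exact (Nat.pow_left_injective (n := 2) (by norm_num) h2).symm

theorem index_leftIdeal {a : 𝓗} (ha : a ≠ 0) : (leftIdeal a).index = nrm a ^ 2 := by
  have : leftIdeal a = (rightIdeal (star a)).map (starAddEquiv : 𝓗 ≃+ 𝓗).toAddMonoidHom := by
    ext x
    constructor
    · rintro ⟨y, rfl⟩
      exact ⟨star a * star y, ⟨star y, rfl⟩, by simp⟩
    · rintro ⟨_, ⟨y, rfl⟩, rfl⟩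
      exact ⟨star y, by simp⟩
  rw [this, AddSubgroup.index_map_of_bijective (starAddEquiv : 𝓗 ≃+ 𝓗).bijective,
    index_rightIdeal (star_ne_zero.2 ha), nrm_star]

/-! ### The groups {x : c divides q̄xp}: index and uniqueness -/

/-- The additive group of all `x` for which `c` divides `star q * x * p`. -/
noncomputable def cslKernel (c : ℕ) (q p : 𝓗) : AddSubgroup 𝓗 :=
  (rightIdeal (c : 𝓗)).comap ((AddMonoidHom.mulRight p).comp (AddMonoidHom.mulLeft (star q)))

@[simp] theorem mem_cslKernel {c : ℕ} {q p x : 𝓗} :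
    x ∈ cslKernel c q p ↔ (c : 𝓗) ∣ star q * x * p := by
  simp [cslKernel]

theorem star_mem_cslKernel {c : ℕ} {q p x : 𝓗} :
    star x ∈ cslKernel c p q ↔ x ∈ cslKernel c q p := by
  rw [mem_cslKernel, mem_cslKernel, ← natCast_dvd_star]
  simp [mul_assoc]

/-- Modulo c, only the part of q shared with c matters. Write N(q) = ud and c = ed with u, e
coprime. If c | q̄y, multiplying by q gives e | y; after dividing by e the condition becomes d |
q̄z, which says that the common left divisor r of q and d divides z. -/
theorem dvd_star_mul_iff_of_gcd {q : 𝓗} (hq : Prim q) {c : ℕ} (hc : c ≠ 0) :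
    ∃ r, Prim r ∧ nrm r = (nrm q).gcd c ∧ r ∣ q ∧
      ∀ y, (c : 𝓗) ∣ star q * y ↔ (c : 𝓗) ∣ star r * y := by
  have hN : nrm q ≠ 0 := by simpa using hq.ne_zero
  obtain ⟨r, hr, hrn, hr1, hr2⟩ := exists_gcld (Nat.gcd_dvd_left (nrm q) c) (fun k _ h => hq k h)
  refine ⟨r, hr, hrn, (hr1 q).2 ⟨1, 0, by simp⟩, fun y => ?_⟩
  obtain ⟨d, u, e, hd, hcop, hu, he⟩ := Nat.exists_coprime' (m := nrm q) (n := c)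
    (Nat.gcd_pos_of_pos_right _ (Nat.pos_of_ne_zero hc))
  have hdg : (nrm q).gcd c = d := by
    rw [hu, he, Nat.gcd_mul_right, hcop, one_mul]
  rw [hdg] at hrn hr2
  have he0 : e ≠ 0 := by rintro rfl; simp at he; exact hc he
  have hy : ∀ s : 𝓗, ∀ w, w.Coprime e → nrm s = w * d → (c : 𝓗) ∣ star s * y → (e : 𝓗) ∣ y := by
    intro s w hw hs h
    have h1 := natCast_dvd_mul_left s h
    rw [← mul_assoc, mul_star, hs, he, mul_comm w d, mul_comm e d, Nat.cast_mul d w, mul_assoc,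
      natCast_mul_dvd_iff hd.ne'] at h1
    exact dvd_of_coprime hw.symm h1
  have key : ∀ s : 𝓗, ∀ z, (c : 𝓗) ∣ star s * (e * z) ↔ (d : 𝓗) ∣ star s * z := by
    intro s z
    rw [← mul_assoc, ← natCast_comm, mul_assoc, he, natCast_mul_dvd_iff he0]
  constructor
  · intro h
    obtain ⟨z, rfl⟩ := hy q u hcop hu h
    rw [key] at h ⊢
    rw [← hrn, ← dvd_iff_nrm_dvd hr.ne_zero]
    exact (hr2 z).2 h
  · intro h
    obtain ⟨z, rfl⟩ := hy r 1 (Nat.coprime_one_left e) (by rw [hrn, one_mul]) h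
    rw [key] at h ⊢
    rw [← hrn, ← dvd_iff_nrm_dvd hr.ne_zero] at h
    exact (hr2 z).1 h

/-- Replacing q is immediate by associativity; conjugation exchanges q and p, which handles p. -/
theorem cslKernel_congr {c : ℕ} {q p q' p' : 𝓗}
    (hq : ∀ y, (c : 𝓗) ∣ star q * y ↔ (c : 𝓗) ∣ star q' * y)
    (hp : ∀ y, (c : 𝓗) ∣ star p * y ↔ (c : 𝓗) ∣ star p' * y) :
    cslKernel c q p = cslKernel c q' p' := by
  have key : ∀ {q q' : 𝓗}, (∀ y, (c : 𝓗) ∣ star q * y ↔ (c : 𝓗) ∣ star q' * y) →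
      ∀ p x, x ∈ cslKernel c q p ↔ x ∈ cslKernel c q' p := by
    intro q q' h p x
    rw [mem_cslKernel, mem_cslKernel, mul_assoc, mul_assoc, h]
  ext x
  rw [key hq, ← star_mem_cslKernel, key hp, star_mem_cslKernel]

/-- Since p generates the unit two-sided ideal, c | (z q̄)xp for all x gives c | z q̄, and
primitivity of q gives c | z. Thus c divides every integer annihilating the quotient of 𝓗 by the
kernel. -/
theorem dvd_of_forall_mem_cslKernel {c : ℕ} {q p : 𝓗} (hq : Prim q) (hp : Prim p)
    (hpo : Odd (nrm p)) {z : ℕ} (h : ∀ x : 𝓗, z • x ∈ cslKernel c q p) : c ∣ z := by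
  apply hq.star.dvd_of_dvd_mul
  refine dvd_of_forall_dvd_mul_mul hp hpo fun x => ?_
  have := h x
  rw [mem_cslKernel] at this
  rwa [nsmul_eq_mul, ← mul_assoc, ← natCast_comm] at this

/-- The exponent of the quotient recovers c. The elements y with y𝓗 inside the kernel are exactly
those with c | q̄y, because p generates the unit ideal; they form the right ideal generated by (c /
N(q)) q. Its integer content and primitive part recover N(q) and q𝓗. -/
theorem cslKernel_inj {c c' : ℕ} {q p q' p' : 𝓗} (hq : Prim q) (hq' : Prim q') (hp : Prim p)
    (hp' : Prim p') (hpo : Odd (nrm p)) (hpo' : Odd (nrm p')) (hc : c ≠ 0) (hqc : nrm q ∣ c)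
    (hqc' : nrm q' ∣ c') (h : cslKernel c q p = cslKernel c' q' p') :
    c = c' ∧ nrm q = nrm q' ∧ q ∣ q' ∧ q' ∣ q := by
  have hcc : ∀ {c c' : ℕ} {q p q' p' : 𝓗}, Prim q → Prim p → Odd (nrm p) →
      cslKernel c q p = cslKernel c' q' p' → c ∣ c' := by
    intro c c' q p q' p' hq hp hpo h
    refine dvd_of_forall_mem_cslKernel hq hp hpo fun x => ?_
    rw [h, mem_cslKernel, nsmul_eq_mul, ← mul_assoc, ← natCast_comm, mul_assoc, mul_assoc]
    exact dvd_mul_right _ _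
  obtain rfl : c = c' := Nat.dvd_antisymm (hcc hq hp hpo h) (hcc hq' hp' hpo' h.symm)
  have hI : ∀ {q p q' p' : 𝓗}, Prim p' → Odd (nrm p') →
      cslKernel c q p = cslKernel c q' p' → ∀ y, (c : 𝓗) ∣ star q * y → (c : 𝓗) ∣ star q' * y := by
    intro q p q' p' hp' hpo' h y hy
    refine dvd_of_forall_dvd_mul_mul hp' hpo' fun x => ?_
    have : y * x ∈ cslKernel c q p := by
      rw [mem_cslKernel, ← mul_assoc, mul_assoc (star q * y)]
      exact hy.mul_right _
    rw [h, mem_cslKernel, ← mul_assoc] at this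
    exact this
  have hgen : ∀ {q : 𝓗}, Prim q → ∀ e, c = nrm q * e → e ≠ 0 →
      ∀ y, (c : 𝓗) ∣ star q * y ↔ (e : 𝓗) * q ∣ y := by
    intro q hq e he he0 y
    have hN : nrm q ≠ 0 := by simpa using hq.ne_zero
    constructor
    · rintro ⟨z, hz⟩
      refine ⟨z, mul_left_cancel₀ (star_ne_zero.2 hq.ne_zero) ?_⟩
      rw [hz, he, ← mul_assoc, ← mul_assoc, ← natCast_comm, mul_assoc (e : 𝓗), star_mul', Nat.cast_mul,
        natCast_comm]
    · rintro ⟨z, rfl⟩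
      refine ⟨z, ?_⟩
      rw [he, ← mul_assoc, ← mul_assoc, ← natCast_comm, mul_assoc (e : 𝓗), star_mul', Nat.cast_mul,
        natCast_comm]
  obtain ⟨e, he⟩ := hqc
  obtain ⟨e', he'⟩ := hqc'
  have he0 : e ≠ 0 := by rintro rfl; exact hc he
  have he0' : e' ≠ 0 := by rintro rfl; exact hc he'
  have h1 : (e : 𝓗) * q ∣ e' * q' :=
    (hgen hq e he he0 _).1 (hI hp hpo h.symm _ ((hgen hq' e' he' he0' _).2 dvd_rfl))
  have h2 : (e' : 𝓗) * q' ∣ e * q :=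
    (hgen hq' e' he' he0' _).1 (hI hp' hpo' h _ ((hgen hq e he he0 _).2 dvd_rfl))
  obtain rfl : e = e' := Nat.dvd_antisymm
    (hq'.dvd_of_dvd_mul ((dvd_mul_right _ _).trans h1))
    (hq.dvd_of_dvd_mul ((dvd_mul_right _ _).trans h2))
  have hcancel : ∀ {q q' : 𝓗}, (e : 𝓗) * q ∣ e * q' → q ∣ q' := by
    rintro q q' ⟨z, hz⟩
    exact ⟨z, mul_left_cancel₀ (by exact_mod_cast he0 : (e : 𝓗) ≠ 0) (by rw [hz, mul_assoc])⟩
  exact ⟨rfl, Nat.eq_of_mul_eq_mul_right (Nat.pos_of_ne_zero he0) (he.symm.trans he'),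
    hcancel h1, hcancel h2⟩

/-- Let s, t be the left divisors of q, p of norm g. The kernel contains s𝓗 + 𝓗t̄, whose index is
shown to divide g, while g divides every annihilator of the quotient, in particular the index. -/
theorem index_cslKernel_of_dvd {q p : 𝓗} (hq : Prim q) (hp : Prim p) (hqo : Odd (nrm q))
    (hpo : Odd (nrm p)) {g : ℕ} (hgq : g ∣ nrm q) (hgp : g ∣ nrm p) :
    (cslKernel g q p).index = g := by
  have hg0 : g ≠ 0 := by
    rintro rfl; exact hq.ne_zero (nrm_eq_zero.1 (zero_dvd_iff.1 hgq))
  obtain ⟨s, hs, hsn, -, hs2⟩ := exists_gcld hgq (fun k _ h => hq k h)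
  obtain ⟨t, ht, htn, -, ht2⟩ := exists_gcld hgp (fun k _ h => hp k h)
  have hle : rightIdeal s ⊔ leftIdeal (star t) ≤ cslKernel g q p := by
    refine sup_le (fun x hx => ?_) ?_
    · rw [mem_rightIdeal, hs2] at hx
      rw [mem_cslKernel]; exact hx.mul_right p
    · rintro _ ⟨y, rfl⟩
      rw [← star_mem_cslKernel, mem_cslKernel]
      refine Dvd.dvd.mul_right ?_ _
      rw [← ht2]
      exact ⟨star y, by simp⟩
  set e := (rightIdeal s).relIndex (leftIdeal (star t)) with he
  have h1 : e * (rightIdeal s ⊔ leftIdeal (star t)).index = g ^ 2 := by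
    rw [← hsn, ← index_rightIdeal hs.ne_zero, he, ← AddSubgroup.relIndex_sup_left]
    exact AddSubgroup.relIndex_mul_index le_sup_left
  -- The index e annihilates 𝓗t̄ modulo s𝓗, so s | e y t̄ for all y; the unit-ideal property of t̄
  -- gives s | e, and primitivity of s gives g | e.
  have hge : g ∣ e := by
    have h2 : ∀ y, s ∣ (e : 𝓗) * y * star t := by
      intro y
      have := AddSubgroup.nsmul_index_mem ((rightIdeal s).addSubgroupOf (leftIdeal (star t)))
        ⟨y * star t, ⟨y, rfl⟩⟩
      rw [AddSubgroup.mem_addSubgroupOf, mem_rightIdeal] at this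
      have h : s ∣ e • (y * star t) := this
      rwa [nsmul_eq_mul, ← mul_assoc] at h
    have h3 := dvd_of_forall_dvd_mul_mul ht.star (by
      rw [nrm_star, htn]; exact hqo.of_dvd_nat hgq) h2
    rw [dvd_iff_nrm_dvd hs.ne_zero, hsn, ← natCast_comm] at h3
    exact hs.star.dvd_of_dvd_mul h3
  obtain ⟨w, hw⟩ := hge
  have hS : (rightIdeal s ⊔ leftIdeal (star t)).index ∣ g := by
    refine ⟨w, Nat.eq_of_mul_eq_mul_left (Nat.pos_of_ne_zero hg0) ?_⟩
    rw [← sq, ← h1, hw]; ring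
  refine Nat.dvd_antisymm ((AddSubgroup.index_dvd_of_le hle).trans hS) ?_
  exact dvd_of_forall_mem_cslKernel hq hp hpo fun x => AddSubgroup.nsmul_index_mem _ x

/-- With φ(x) = q̄xp, the index sought is that of c𝓗 ∩ φ(𝓗) in φ(𝓗). Both c𝓗 and φ(𝓗) have known
index in 𝓗, so going through their sum it suffices to know the index of the intersection in c𝓗,
which is g by the preceding case. -/
theorem index_cslKernel_of_nrm {q p : 𝓗} (hq : Prim q) (hp : Prim p) (hqo : Odd (nrm q))
    (hpo : Odd (nrm p)) {g k l : ℕ} (hqn : nrm q = g * k) (hpn : nrm p = g * l) :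
    (cslKernel (g * k * l) q p).index = g * k ^ 2 * l ^ 2 := by
  set c := g * k * l with hc
  have hq0 : nrm q ≠ 0 := by simpa using hq.ne_zero
  have hp0 : nrm p ≠ 0 := by simpa using hp.ne_zero
  have hg0 : g ≠ 0 := by rintro rfl; simp at hqn; exact hq.ne_zero hqn
  have hk0 : k ≠ 0 := by rintro rfl; simp at hqn; exact hq.ne_zero hqn
  have hl0 : l ≠ 0 := by rintro rfl; simp at hpn; exact hp.ne_zero hpn
  have hc0 : c ≠ 0 := by positivity
  have hcH : (c : 𝓗) ≠ 0 := by exact_mod_cast hc0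
  set φ : 𝓗 →+ 𝓗 := (AddMonoidHom.mulRight p).comp (AddMonoidHom.mulLeft (star q)) with hφ
  have hφx : ∀ x, φ x = star q * x * p := fun x => rfl
  have h1 : (cslKernel c q p).index = (rightIdeal (c : 𝓗)).relIndex φ.range :=
    AddSubgroup.index_comap _ _
  have h2 : (rightIdeal (c : 𝓗)).relIndex φ.range * (rightIdeal (c : 𝓗) ⊔ φ.range).index = c ^ 4 := by
    rw [← index_rightIdeal_natCast, ← AddSubgroup.relIndex_sup_left]
    exact AddSubgroup.relIndex_mul_index le_sup_left
  have h3 : φ.range.relIndex (rightIdeal (c : 𝓗)) * (rightIdeal (c : 𝓗) ⊔ φ.range).index =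
      (g * c) ^ 2 := by
    have : φ.range.index = (g * c) ^ 2 := by
      rw [hφ, AddMonoidHom.range_comp, AddSubgroup.index_map_of_injective _ (mulRight_injective hp.ne_zero)]
      change (rightIdeal (star q)).index * (leftIdeal p).index = _
      rw [index_rightIdeal (star_ne_zero.2 hq.ne_zero), index_leftIdeal hp.ne_zero, nrm_star, hqn,
        hpn, hc]
      ring
    rw [← this, ← AddSubgroup.relIndex_sup_right]
    exact AddSubgroup.relIndex_mul_index le_sup_right
  -- Since N(q)N(p) = gc, the element cx lies in φ(𝓗) exactly when g divides q x p̄: the same kind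
  -- of kernel, for q̄, p̄ and modulus g.
  have h4 : φ.range.relIndex (rightIdeal (c : 𝓗)) = g := by
    have : φ.range.relIndex (rightIdeal (c : 𝓗)) = (cslKernel g (star q) (star p)).index := by
      rw [rightIdeal, ← AddSubgroup.index_comap]
      congr 1
      ext x
      rw [AddSubgroup.mem_comap, mem_cslKernel, star_star, AddMonoidHom.mem_range]
      simp only [hφx, AddMonoidHom.coe_mulLeft]
      have hgc : ((g * c : ℕ) : 𝓗) = nrm q * nrm p := by
        rw [hqn, hpn, hc, ← Nat.cast_mul]; congr 1; ring
      constructor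
      · rintro ⟨y, hy⟩
        refine ⟨y, mul_left_cancel₀ hcH ?_⟩
        have : (nrm q : 𝓗) * y * nrm p = c * (q * x * star p) := by
          rw [← mul_star, ← mul_star p]
          calc q * star q * y * (p * star p) = q * (star q * y * p) * star p := by
                simp only [mul_assoc]
            _ = c * (q * x * star p) := by
                rw [hy, ← mul_assoc q, ← natCast_comm]; simp only [mul_assoc]
        rw [← this, mul_assoc, ← natCast_comm (nrm p), ← mul_assoc, ← hgc, Nat.cast_mul, ← mul_assoc, natCast_comm g, mul_assoc]
      · rintro ⟨y, hy⟩
        refine ⟨y, mul_left_cancel₀ hq.ne_zero (mul_right_cancel₀ (star_ne_zero.2 hp.ne_zero) ?_)⟩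
        calc q * (star q * y * p) * star p = (nrm q : 𝓗) * y * nrm p := by
              rw [← mul_star, ← mul_star p]; simp only [mul_assoc]
          _ = c * (g * y) := by
              rw [mul_assoc, ← natCast_comm (nrm p), ← mul_assoc, ← hgc, Nat.cast_mul, ← mul_assoc, natCast_comm g]
          _ = q * (c * x) * star p := by
              rw [← hy, ← mul_assoc q, ← natCast_comm]; simp only [mul_assoc]
    rw [this]
    exact index_cslKernel_of_dvd hq.star hp.star (by simpa using hqo) (by simpa using hpo)
      (by rw [nrm_star, hqn]; exact dvd_mul_right _ _) (by rw [nrm_star, hpn]; exact dvd_mul_right _ _)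
  rw [h4] at h3
  rw [h1]
  have h5 : (rightIdeal (c : 𝓗) ⊔ φ.range).index = g * c ^ 2 :=
    Nat.eq_of_mul_eq_mul_left (Nat.pos_of_ne_zero hg0) (by rw [h3]; ring)
  rw [h5] at h2
  have : 0 < g * c ^ 2 := by positivity
  refine Nat.eq_of_mul_eq_mul_right this ?_
  rw [h2, hc]; ring

/-- Reduction of a pair of norms `g k²` and `g l²` to a pair of norms `g k` and `g l`. -/
theorem exists_cslKernel_eq {q p : 𝓗} (hq : Prim q) (hp : Prim p) {g k l : ℕ}
    (hkl : k.Coprime l) (hqn : nrm q = g * k ^ 2) (hpn : nrm p = g * l ^ 2) :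
    ∃ q' p', Prim q' ∧ Prim p' ∧ nrm q' = g * k ∧ nrm p' = g * l ∧ q' ∣ q ∧ p' ∣ p ∧
      cslKernel (g * k * l) q p = cslKernel (g * k * l) q' p' := by
  have hg0 : g ≠ 0 := by rintro rfl; simp at hqn; exact hq.ne_zero hqn
  have hk0 : k ≠ 0 := by rintro rfl; simp at hqn; exact hq.ne_zero hqn
  have hl0 : l ≠ 0 := by rintro rfl; simp at hpn; exact hp.ne_zero hpn
  have hc0 : g * k * l ≠ 0 := by positivity
  obtain ⟨q', hq', hqn', hqq, h1⟩ := dvd_star_mul_iff_of_gcd hq hc0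
  obtain ⟨p', hp', hpn', hpp, h2⟩ := dvd_star_mul_iff_of_gcd hp hc0
  refine ⟨q', p', hq', hp', ?_, ?_, hqq, hpp, cslKernel_congr h1 h2⟩
  -- gcd(gk², gkl) = gk because k and l are coprime.
  · rw [hqn', hqn, sq, ← mul_assoc, Nat.gcd_mul_left, hkl, mul_one]
  · rw [hpn', hpn, sq, ← mul_assoc, mul_right_comm g k l, Nat.gcd_mul_left, hkl.symm, mul_one]

/-- The kernel is unchanged on passing to the divisors of norms gk and gl, where the previous index
formula applies. -/
theorem index_cslKernel {q p : 𝓗} (hq : Prim q) (hp : Prim p) (hqo : Odd (nrm q))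
    (hpo : Odd (nrm p)) {g k l : ℕ} (hkl : k.Coprime l) (hqn : nrm q = g * k ^ 2)
    (hpn : nrm p = g * l ^ 2) :
    (cslKernel (g * k * l) q p).index = g * k ^ 2 * l ^ 2 := by
  obtain ⟨q', p', hq', hp', hqn', hpn', hqq, hpp, h⟩ := exists_cslKernel_eq hq hp hkl hqn hpn
  rw [h]
  refine index_cslKernel_of_nrm hq' hp' ?_ ?_ hqn' hpn'
  · exact hqo.of_dvd_nat (map_dvd nrm hqq)
  · exact hpo.of_dvd_nat (map_dvd nrm hpp)

end HurwitzInt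

/-! ### Units and primitive right ideals: counting and multiplicativity -/

theorem Set.ncard_eq_mul_of_fibers {α β : Type*} {s : Set α} {t : Set β} (f : α → β) {k : ℕ}
    (hs : s.Finite) (ht : t.Finite) (hst : Set.MapsTo f s t)
    (h : ∀ b ∈ t, {a | a ∈ s ∧ f a = b}.ncard = k) : s.ncard = t.ncard * k := by
  classical
  rw [Set.ncard_eq_toFinset_card s hs, Set.ncard_eq_toFinset_card t ht,
    Finset.card_eq_sum_card_fiberwise (f := f) (t := ht.toFinset) (by simpa using hst)]
  rw [Finset.sum_const_nat (m := k)]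
  intro b hb
  rw [← h b (by simpa using hb), ← Set.ncard_coe_finset]
  congr 1
  ext a; simp

namespace HurwitzInt

theorem finite_nrm_eq (m : ℕ) : {x : 𝓗 | nrm x = m}.Finite := by
  refine ((Set.finite_Icc (fun _ : Fin 4 => -(4 * m : ℤ)) (fun _ => (4 * m : ℤ))).image
    coordEquiv).subset ?_
  intro x hx
  obtain ⟨v, rfl⟩ := coordEquiv.surjective x
  refine ⟨v, ?_, rfl⟩
  have hN : (nrm (mk (v 0) (v 1) (v 2) (v 3)) : ℤ) = m := by exact_mod_cast hx
  rw [nrm_mk] at hN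
  have key : ∀ t : ℤ, t ^ 2 ≤ 4 * m → |t| ≤ 4 * m := fun t ht => by
    have : |t| ≤ |t| ^ 2 := Int.le_self_sq _
    rw [sq_abs] at this; exact this.trans ht
  -- The bounds come from 4N = (2a+d)² + (2b+d)² + (2c+d)² + d².
  have h3 := abs_le.1 (key (v 3) (by nlinarith [sq_nonneg (2 * v 0 + v 3), sq_nonneg (2 * v 1 + v 3), sq_nonneg (2 * v 2 + v 3)]))
  have h0 := abs_le.1 (key (2 * v 0 + v 3) (by nlinarith [sq_nonneg (v 3), sq_nonneg (2 * v 1 + v 3), sq_nonneg (2 * v 2 + v 3)]))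
  have h1 := abs_le.1 (key (2 * v 1 + v 3) (by nlinarith [sq_nonneg (v 3), sq_nonneg (2 * v 0 + v 3), sq_nonneg (2 * v 2 + v 3)]))
  have h2 := abs_le.1 (key (2 * v 2 + v 3) (by nlinarith [sq_nonneg (v 3), sq_nonneg (2 * v 0 + v 3), sq_nonneg (2 * v 1 + v 3)]))
  refine ⟨fun i => ?_, fun i => ?_⟩ <;> fin_cases i <;> simp <;> omega

/-- There are `24` Hurwitz units. -/
theorem ncard_nrm_eq_one : {x : 𝓗 | nrm x = 1}.ncard = 24 := by
  let S : Finset (ℤ × ℤ × ℤ × ℤ) :=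
    (Finset.Icc (-2) 2 ×ˢ Finset.Icc (-2) 2 ×ˢ Finset.Icc (-2) 2 ×ˢ Finset.Icc (-2) 2).filter
      fun v => v.1 ^ 2 + v.2.1 ^ 2 + v.2.2.1 ^ 2 + v.2.2.2 ^ 2
        + (v.1 + v.2.1 + v.2.2.1) * v.2.2.2 = 1
  have hS : S.card = 24 := by decide +kernel
  let f : ℤ × ℤ × ℤ × ℤ → 𝓗 := fun v => mk v.1 v.2.1 v.2.2.1 v.2.2.2
  have hf : Function.Injective f := by
    rintro ⟨a, b, c, d⟩ ⟨a', b', c', d'⟩ h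
    obtain ⟨rfl, rfl, rfl, rfl⟩ := mk_inj h
    rfl
  have : {x : 𝓗 | nrm x = 1} = f '' S := by
    ext x
    constructor
    · intro hx
      obtain ⟨a, b, c, d, rfl⟩ := exists_eq_mk x
      have hN : (nrm (mk a b c d) : ℤ) = 1 := by exact_mod_cast hx
      rw [nrm_mk] at hN
      refine ⟨(a, b, c, d), ?_, rfl⟩
      have key : ∀ t : ℤ, t ^ 2 ≤ 4 → |t| ≤ 2 := fun t ht =>
        abs_le_of_sq_le_sq (by linarith) (by norm_num)
      have h3 := abs_le.1 (key d (by nlinarith [sq_nonneg (2 * a + d), sq_nonneg (2 * b + d), sq_nonneg (2 * c + d)]))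
      have h0 := abs_le.1 (key (2 * a + d) (by nlinarith [sq_nonneg d, sq_nonneg (2 * b + d), sq_nonneg (2 * c + d)]))
      have h1 := abs_le.1 (key (2 * b + d) (by nlinarith [sq_nonneg d, sq_nonneg (2 * a + d), sq_nonneg (2 * c + d)]))
      have h2 := abs_le.1 (key (2 * c + d) (by nlinarith [sq_nonneg d, sq_nonneg (2 * b + d), sq_nonneg (2 * a + d)]))
      simp only [S, Finset.coe_filter, Finset.mem_product, Finset.mem_Icc, Set.mem_ofPred_eq]
      exact ⟨⟨by omega, by omega, by omega, by omega⟩, hN⟩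
    · rintro ⟨⟨a, b, c, d⟩, hv, rfl⟩
      simp only [S, Finset.coe_filter, Set.mem_ofPred_eq] at hv
      have := nrm_mk a b c d
      rw [hv.2] at this
      exact_mod_cast this
  rw [this, Set.ncard_image_of_injective _ hf, Set.ncard_coe_finset, hS]

theorem rightIdeal_le {q q' : 𝓗} : rightIdeal q ≤ rightIdeal q' ↔ q' ∣ q := by
  constructor
  · intro h; rw [← mem_rightIdeal]; exact h (mem_rightIdeal.2 dvd_rfl)
  · intro h x hx; rw [mem_rightIdeal] at *; exact h.trans hx

theorem rightIdeal_eq_iff {q q' : 𝓗} (hq : q ≠ 0) :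
    rightIdeal q = rightIdeal q' ↔ ∃ u, nrm u = 1 ∧ q' = q * u := by
  constructor
  · intro h
    obtain ⟨u, hu⟩ := rightIdeal_le.1 h.ge
    obtain ⟨v, hv⟩ := rightIdeal_le.1 h.le
    refine ⟨u, ?_, hu⟩
    have : q * 1 = q * (u * v) := by rw [mul_one, ← mul_assoc, ← hu, ← hv]
    have := congrArg nrm (mul_left_cancel₀ hq this)
    rw [map_one, map_mul] at this
    exact Nat.eq_one_of_mul_eq_one_right this.symm
  · rintro ⟨u, hu, rfl⟩
    refine le_antisymm (rightIdeal_le.2 ⟨star u, ?_⟩) (rightIdeal_le.2 ⟨u, rfl⟩)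
    rw [mul_assoc, mul_star, hu, Nat.cast_one, mul_one]

theorem rightIdeal_eq_of_dvd {q q' : 𝓗} (hq' : q' ≠ 0) (h : q ∣ q') (hn : nrm q = nrm q') :
    rightIdeal q = rightIdeal q' := by
  obtain ⟨u, rfl⟩ := h
  have h0 := left_ne_zero_of_mul hq'
  rw [rightIdeal_eq_iff h0]
  refine ⟨u, ?_, rfl⟩
  rw [map_mul] at hn
  have : nrm q ≠ 0 := by simpa using h0
  exact Nat.eq_of_mul_eq_mul_left (Nat.pos_of_ne_zero this) (by rw [← hn, mul_one])

theorem prim_of_rightIdeal_eq {q q' : 𝓗} (hq : Prim q) (h : rightIdeal q = rightIdeal q') :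
    Prim q' := fun k hk => hq k (hk.trans (rightIdeal_le.1 h.le))

theorem nrm_of_rightIdeal_eq {q q' : 𝓗} (hq : q ≠ 0) (h : rightIdeal q = rightIdeal q') :
    nrm q' = nrm q := by
  obtain ⟨u, hu, rfl⟩ := (rightIdeal_eq_iff hq).1 h
  rw [map_mul, hu, mul_one]

/-- The right ideals generated by a primitive Hurwitz integer of odd norm `m`. -/
def primIdeals (m : ℕ) : Set (AddSubgroup 𝓗) :=
  {I | Odd m ∧ ∃ q, Prim q ∧ nrm q = m ∧ I = rightIdeal q}

/-- The number of right ideals generated by a primitive Hurwitz integer of odd norm `m`. -/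
noncomputable def psi (m : ℕ) : ℕ := (primIdeals m).ncard

theorem finite_primIdeals (m : ℕ) : (primIdeals m).Finite := by
  refine ((finite_nrm_eq m).image rightIdeal).subset ?_
  rintro _ ⟨_, q, _, hq, rfl⟩
  exact ⟨q, hq, rfl⟩

theorem psi_of_even {m : ℕ} (h : Even m) : psi m = 0 := by
  rw [psi, Set.ncard_eq_zero (finite_primIdeals m)]
  ext I
  simp only [primIdeals, Set.mem_ofPred_eq, Set.mem_empty_iff_false, iff_false, not_and]
  intro h'
  exact absurd h (Nat.not_even_iff_odd.2 h')

theorem ncard_prim_nrm_eq {m : ℕ} (hm : Odd m) :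
    {q : 𝓗 | Prim q ∧ nrm q = m}.ncard = 24 * psi m := by
  rw [mul_comm, psi]
  refine Set.ncard_eq_mul_of_fibers rightIdeal ((finite_nrm_eq m).subset fun q hq => hq.2)
    (finite_primIdeals m) (fun q hq => ⟨hm, q, hq.1, hq.2, rfl⟩) ?_
  rintro _ ⟨-, q, hq, rfl, rfl⟩
  refine Eq.trans ?_ ((Set.ncard_image_of_injective _ (mulLeft_injective hq.ne_zero)).trans
    ncard_nrm_eq_one)
  congr 1
  ext x
  constructor
  · rintro ⟨⟨hx, hxn⟩, h⟩
    obtain ⟨u, hu, rfl⟩ := (rightIdeal_eq_iff hq.ne_zero).1 h.symm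
    exact ⟨u, hu, rfl⟩
  · rintro ⟨u, hu, rfl⟩
    have h : rightIdeal q = rightIdeal (q * u) := (rightIdeal_eq_iff hq.ne_zero).2 ⟨u, hu, rfl⟩
    exact ⟨⟨prim_of_rightIdeal_eq hq h, nrm_of_rightIdeal_eq hq.ne_zero h⟩, h.symm⟩

theorem mem_sup_rightIdeal {q q' y : 𝓗} :
    y ∈ rightIdeal q ⊔ rightIdeal q' ↔ ∃ u v, y = q * u + q' * v := by
  rw [AddSubgroup.mem_sup]
  constructor
  · rintro ⟨_, ⟨u, rfl⟩, _, ⟨v, rfl⟩, rfl⟩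
    exact ⟨u, v, rfl⟩
  · rintro ⟨u, v, rfl⟩
    exact ⟨_, ⟨u, rfl⟩, _, ⟨v, rfl⟩, rfl⟩

theorem exists_sup_rightIdeal_natCast {q : 𝓗} {d : ℕ} (hd : d ∣ nrm q)
    (hq : ∀ k : ℕ, k ∣ d → (k : 𝓗) ∣ q → k = 1) :
    ∃ r, Prim r ∧ nrm r = d ∧ rightIdeal q ⊔ rightIdeal (d : 𝓗) = rightIdeal r ∧
      ∀ y, r ∣ y ↔ (d : 𝓗) ∣ star q * y := by
  obtain ⟨r, hr, hrn, h1, h2⟩ := exists_gcld hd hq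
  refine ⟨r, hr, hrn, ?_, h2⟩
  ext y
  rw [mem_sup_rightIdeal, mem_rightIdeal, h1]

/-- Both q and d are left multiples of r, so r divides the generator of q𝓗 + d𝓗; both have norm d.
Hence a primitive q has only one right ideal of norm d above it. -/
theorem sup_rightIdeal_natCast_eq {q r : 𝓗} (hq : Prim q) {d : ℕ} (hr : nrm r = d) (hrq : r ∣ q) :
    rightIdeal q ⊔ rightIdeal (d : 𝓗) = rightIdeal r := by
  have hd : d ∣ nrm q := hr ▸ map_dvd nrm hrq
  obtain ⟨s, hs, hsn, h, -⟩ := exists_sup_rightIdeal_natCast hd fun k _ h => hq k h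
  rw [h]
  symm
  refine rightIdeal_eq_of_dvd hs.ne_zero ?_ (hr.trans hsn.symm)
  rw [← rightIdeal_le, ← h]
  refine sup_le (rightIdeal_le.2 hrq) (rightIdeal_le.2 ⟨star r, ?_⟩)
  rw [mul_star, hr]

/-- A factor of prime norm is prime to a given primitive element unless it generates one
particular right ideal. -/
theorem prim_mul_iff {r t : 𝓗} (hr : Prim r) {p : ℕ} (hp : p.Prime) (ht : nrm t = p) :
    Prim (r * t) ↔ ¬ (p : 𝓗) ∣ r * t := by
  constructor
  · intro h hp'
    exact hp.one_lt.ne' (h p hp')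
  · intro h k hk
    have h1 : (k : 𝓗) ∣ p * r := by
      have := hk.mul_right (star t)
      rwa [mul_assoc, mul_star, ht, ← natCast_comm] at this
    rcases (Nat.dvd_prime hp).1 (hr.dvd_of_dvd_mul h1) with h2 | rfl
    · exact h2
    · exact absurd hk h

theorem prim_of_nrm_prime {t : 𝓗} {p : ℕ} (hp : p.Prime) (ht : nrm t = p) : Prim t := by
  intro k hk
  have := map_dvd nrm hk
  rw [nrm_natCast, ht] at this
  rcases (Nat.dvd_prime hp).1 ((dvd_pow_self k two_ne_zero).trans this) with h | rfl
  · exact h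
  · have h2 := Nat.le_of_dvd hp.pos this
    nlinarith [hp.two_le]

/-- Let s be the common left divisor of r̄ and p, of norm p. Then p | rt exactly when s | t, which
for N(t) = p means that t and s generate the same ideal. -/
theorem exists_bad_ideal {r : 𝓗} (hr : Prim r) {p : ℕ} (hp : p.Prime) (hpo : Odd p)
    (hpr : p ∣ nrm r) : ∃ B ∈ primIdeals p, ∀ t, nrm t = p →
      (Prim (r * t) ↔ rightIdeal t ≠ B) := by
  obtain ⟨s, hs, hsn, -, h⟩ := exists_gcld (x := star r) (d := p) (by rwa [nrm_star])
    (fun k _ h => hr.star k h)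
  refine ⟨rightIdeal s, ⟨hpo, s, hs, hsn, rfl⟩, fun t ht => ?_⟩
  rw [prim_mul_iff hr hp ht]
  have ht0 : t ≠ 0 := by
    rintro rfl; rw [map_zero] at ht; exact hp.ne_zero ht.symm
  have h' := h t
  rw [star_star] at h'
  rw [← h', not_iff_not]
  exact ⟨fun hst => (rightIdeal_eq_of_dvd ht0 hst (hsn.trans ht.symm)).symm,
    fun hst => rightIdeal_le.1 hst.le⟩

theorem psi_one : psi 1 = 1 := by
  have : primIdeals 1 = {rightIdeal 1} := by
    ext I
    simp only [primIdeals, Set.mem_ofPred_eq, Set.mem_singleton_iff]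
    constructor
    · rintro ⟨-, q, hq, hqn, rfl⟩
      exact (rightIdeal_eq_of_dvd hq.ne_zero (one_dvd q) (by rw [hqn, map_one])).symm
    · rintro rfl
      refine ⟨odd_one, 1, fun k hk => ?_, map_one _, rfl⟩
      have := map_dvd nrm hk
      rw [nrm_natCast, map_one, Nat.dvd_one] at this
      simpa using this
  rw [psi, this, Set.ncard_singleton]

theorem rightIdeal_mul (r t : 𝓗) :
    rightIdeal (r * t) = (rightIdeal t).map (AddMonoidHom.mulLeft r) := by
  ext x
  constructor
  · rintro ⟨y, rfl⟩
    exact ⟨t * y, ⟨y, rfl⟩, (mul_assoc r t y).symm⟩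
  · rintro ⟨_, ⟨y, rfl⟩, rfl⟩
    exact ⟨y, mul_assoc r t y⟩

/-- A primitive ideal of norm mp lies in exactly one primitive ideal r𝓗 of norm m. Those inside r𝓗
are rt𝓗 with N(t) = p, where t𝓗 avoids the single bad ideal. -/
theorem psi_prime_mul {p m : ℕ} (hp : p.Prime) (hpo : Odd p) (hm : Odd m) (hpm : p ∣ m) :
    psi (m * p) = psi m * (psi p - 1) := by
  refine Set.ncard_eq_mul_of_fibers (fun I => I ⊔ rightIdeal (m : 𝓗)) (finite_primIdeals _)
    (finite_primIdeals _) ?_ ?_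
  · rintro _ ⟨-, q, hq, hqn, rfl⟩
    obtain ⟨r, hr, hrn, h, -⟩ := exists_sup_rightIdeal_natCast (q := q) (d := m)
      (hqn ▸ dvd_mul_right _ _) fun k _ h => hq k h
    exact ⟨hm, r, hr, hrn, h⟩
  · rintro _ ⟨-, r, hr, hrn, rfl⟩
    obtain ⟨B, hB, h⟩ := exists_bad_ideal hr hp hpo (hrn ▸ hpm)
    rw [psi, ← Set.ncard_sdiff_singleton_of_mem hB]
    refine Eq.trans ?_ (Set.ncard_image_of_injective _
      (AddSubgroup.map_injective (mulLeft_injective hr.ne_zero)))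
    congr 1
    ext I
    constructor
    · rintro ⟨⟨-, q, hq, hqn, rfl⟩, hI⟩
      have : r ∣ q := rightIdeal_le.1 (le_sup_left.trans hI.le)
      obtain ⟨t, rfl⟩ := this
      have ht : nrm t = p := by
        rw [map_mul, hrn] at hqn
        exact Nat.eq_of_mul_eq_mul_left hm.pos hqn
      exact ⟨rightIdeal t, ⟨⟨hpo, t, prim_of_nrm_prime hp ht, ht, rfl⟩, (h t ht).1 hq⟩,
        (rightIdeal_mul r t).symm⟩
    · rintro ⟨_, ⟨⟨-, t, ht, htn, rfl⟩, hne⟩, rfl⟩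
      have hq := (h t htn).2 hne
      refine ⟨⟨hm.mul hpo, r * t, hq, by rw [map_mul, hrn, htn], (rightIdeal_mul r t).symm⟩, ?_⟩
      rw [← rightIdeal_mul]
      exact sup_rightIdeal_natCast_eq hq hrn (dvd_mul_right _ _)

/-- An element y of both larger ideals satisfies m | q̄y and n | q̄y, hence mn = N(q) divides q̄y,
so q | y. -/
theorem rightIdeal_eq_inf {q : 𝓗} (hq : Prim q) {m n : ℕ} (hmn : m.Coprime n)
    (hqn : nrm q = m * n) : rightIdeal q =
      (rightIdeal q ⊔ rightIdeal (m : 𝓗)) ⊓ (rightIdeal q ⊔ rightIdeal (n : 𝓗)) := by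
  refine le_antisymm (le_inf le_sup_left le_sup_left) ?_
  obtain ⟨r, -, -, hr, hr'⟩ := exists_sup_rightIdeal_natCast (q := q) (d := m)
    (hqn ▸ dvd_mul_right _ _) fun k _ h => hq k h
  obtain ⟨s, -, -, hs, hs'⟩ := exists_sup_rightIdeal_natCast (q := q) (d := n)
    (hqn ▸ dvd_mul_left _ _) fun k _ h => hq k h
  rw [hr, hs]
  intro y hy
  obtain ⟨h1, h2⟩ := AddSubgroup.mem_inf.1 hy
  rw [mem_rightIdeal] at h1 h2
  rw [hr'] at h1
  rw [hs'] at h2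
  rw [mem_rightIdeal, dvd_iff_nrm_dvd hq.ne_zero, hqn]
  obtain ⟨z, hz⟩ := h1
  rw [hz] at h2 ⊢
  have := dvd_of_coprime hmn.symm h2
  rw [Nat.cast_mul]
  exact mul_dvd_mul_left _ this

/-- Chinese remainder theorem: I is recovered from I + m𝓗 and I + n𝓗 as their intersection, and any
pair occurs, by lifting the two generators to a common x and taking the common left divisor of x and
mn. -/
theorem psi_mul {m n : ℕ} (hmn : m.Coprime n) : psi (m * n) = psi m * psi n := by
  by_cases hm : Odd m
  swap
  · rw [psi_of_even (Nat.not_odd_iff_even.1 hm), psi_of_even ((Nat.not_odd_iff_even.1 hm).mul_right n), zero_mul]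
  by_cases hn : Odd n
  swap
  · rw [psi_of_even (Nat.not_odd_iff_even.1 hn), psi_of_even ((Nat.not_odd_iff_even.1 hn).mul_left m), mul_zero]
  rw [psi, psi, psi, ← Set.ncard_prod]
  have hinj : Set.InjOn (fun I : AddSubgroup 𝓗 => (I ⊔ rightIdeal (m : 𝓗), I ⊔ rightIdeal (n : 𝓗)))
      (primIdeals (m * n)) := by
    rintro _ ⟨-, q, hq, hqn, rfl⟩ _ ⟨-, q', hq', hqn', rfl⟩ h
    simp only [Prod.mk.injEq] at h
    rw [rightIdeal_eq_inf hq hmn hqn, rightIdeal_eq_inf hq' hmn hqn', h.1, h.2]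
  rw [← hinj.ncard_image]
  congr 1
  ext ⟨I, I'⟩
  simp only [Set.mem_image, Set.mem_prod, Prod.mk.injEq]
  constructor
  · rintro ⟨_, ⟨-, q, hq, hqn, rfl⟩, rfl, rfl⟩
    obtain ⟨r, hr, hrn, h, -⟩ := exists_sup_rightIdeal_natCast (q := q) (d := m)
      (hqn ▸ dvd_mul_right _ _) fun k _ h => hq k h
    obtain ⟨s, hs, hsn, h', -⟩ := exists_sup_rightIdeal_natCast (q := q) (d := n)
      (hqn ▸ dvd_mul_left _ _) fun k _ h => hq k h
    exact ⟨⟨hm, r, hr, hrn, h⟩, ⟨hn, s, hs, hsn, h'⟩⟩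
  · rintro ⟨⟨-, q, hq, hqn, rfl⟩, ⟨-, q', hq', hqn', rfl⟩⟩
    obtain ⟨x, ⟨y, hy⟩, ⟨y', hy'⟩⟩ : ∃ x : 𝓗, (m : 𝓗) ∣ x - q ∧ (n : 𝓗) ∣ x - q' := by
      have hb := Nat.gcd_eq_gcd_ab m n
      rw [hmn] at hb
      have hb' : (1 : 𝓗) = m * (m.gcdA n : ℤ) + n * (m.gcdB n : ℤ) := by
        exact_mod_cast congrArg (Int.cast : ℤ → 𝓗) hb
      set A : 𝓗 := m * (m.gcdA n : ℤ) with hA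
      set B : 𝓗 := n * (m.gcdB n : ℤ) with hB
      refine ⟨B * q + A * q', ?_, ?_⟩
      · have : B * q + A * q' - q = A * (q' - q) := by
          conv_lhs => arg 2; rw [← one_mul q, hb']
          rw [add_mul, mul_sub]; abel
        rw [this, hA, mul_assoc]; exact dvd_mul_right _ _
      · have : B * q + A * q' - q' = B * (q - q') := by
          conv_lhs => arg 2; rw [← one_mul q', hb']
          rw [add_mul, mul_sub]; abel
        rw [this, hB, mul_assoc]; exact dvd_mul_right _ _
    have hdvd : ∀ {q y : 𝓗} {m : ℕ}, nrm q = m → x - q = m * y → m ∣ nrm x ∧ q ∣ x := by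
      intro q y m hqm h
      have hx : x = q + m * y := by rw [← h]; abel
      constructor
      · have h1 : star x = star q + m * star y := by
          rw [hx, star_add, star_mul, star_natCast, natCast_comm]
        rw [← natCast_dvd_natCast (n := nrm x), ← star_mul', h1, add_mul, mul_assoc]
        refine dvd_add ?_ (dvd_mul_right _ _)
        rw [hx, mul_add, star_mul', hqm]
        exact dvd_add dvd_rfl (natCast_dvd_mul_left _ (dvd_mul_right _ _))
      · rw [hx]
        refine dvd_add dvd_rfl ⟨star q * y, ?_⟩
        rw [← mul_assoc, mul_star, hqm]
    obtain ⟨h1, h1'⟩ := hdvd hqn hy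
    obtain ⟨h2, h2'⟩ := hdvd hqn' hy'
    have hx : ∀ {q y : 𝓗} {m : ℕ}, Prim q → x - q = m * y → ∀ k : ℕ, k ∣ m → (k : 𝓗) ∣ x → k = 1 := by
      intro q y m hq h k hk hkx
      refine hq k ?_
      have : q = x - m * y := by rw [← h]; abel
      rw [this]
      exact dvd_sub hkx (((Nat.cast_dvd_cast hk).trans (dvd_mul_right _ _)))
    -- The lift x need not be primitive, but no prime dividing mn divides it, since it is congruent
    -- to a primitive element modulo m and modulo n; that is all the common divisor needs.
    obtain ⟨r, hr, hrn, hr1, -⟩ := exists_gcld (x := x) (hmn.mul_dvd_of_dvd_of_dvd h1 h2) (by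
      intro k hk hkx
      by_contra hne
      obtain ⟨l, hl, hlk⟩ := Nat.exists_prime_and_dvd hne
      have hlx : (l : 𝓗) ∣ x := (Nat.cast_dvd_cast hlk).trans hkx
      rcases (Nat.Prime.dvd_mul hl).1 (hlk.trans hk) with h | h
      · exact hl.one_lt.ne' (hx hq hy l h hlx)
      · exact hl.one_lt.ne' (hx hq' hy' l h hlx))
    obtain ⟨u, v, huv⟩ := (hr1 r).1 dvd_rfl
    refine ⟨rightIdeal r, ⟨hm.mul hn, r, hr, hrn, rfl⟩, sup_rightIdeal_natCast_eq hr hqn ?_,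
      sup_rightIdeal_natCast_eq hr hqn' ?_⟩
    · rw [huv, Nat.cast_mul, mul_assoc, ← hqn, ← mul_star, mul_assoc]
      exact dvd_add (h1'.mul_right _) (dvd_mul_right _ _)
    · rw [huv, mul_comm m n, Nat.cast_mul, mul_assoc, ← hqn', ← mul_star, mul_assoc]
      exact dvd_add (h2'.mul_right _) (dvd_mul_right _ _)

end HurwitzInt

/-! ### Ideals of prime norm: isotropic vectors modulo p -/

/-- The number of zeros of a hyperbolic quadratic form in four variables over a finite field. -/
theorem card_mul_eq_mul (F : Type*) [Field F] [Fintype F] [DecidableEq F] :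
    (Finset.univ.filter fun v : F × F × F × F => v.1 * v.2.1 = v.2.2.1 * v.2.2.2).card =
      (Fintype.card F - 1) * Fintype.card F ^ 2 + Fintype.card F * (2 * Fintype.card F - 1) := by
  have hinner : ∀ a c d : F, (∑ b : F, if a * b = c * d then 1 else 0) =
      if a = 0 then (if c * d = 0 then Fintype.card F else 0) else 1 := by
    intro a c d
    by_cases ha : a = 0
    · subst ha
      by_cases h : c * d = 0
      · simp [h]
      · simp [h, eq_comm]
    · have : ∀ b : F, a * b = c * d ↔ b = c * d / a := fun b => by
        rw [eq_div_iff ha, mul_comm]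
      simp [this, ha]
  have hcd : (∑ c : F, ∑ d : F, if c * d = 0 then Fintype.card F else 0) =
      Fintype.card F * (2 * Fintype.card F - 1) := by
    have h1 : ∀ c : F, (∑ d : F, if c * d = 0 then Fintype.card F else 0) =
        if c = 0 then Fintype.card F * Fintype.card F else Fintype.card F := by
      intro c
      by_cases hc : c = 0
      · simp [hc]
      · simp [hc]
    simp_rw [h1]
    rw [Finset.sum_ite, Finset.sum_const, Finset.sum_const, Finset.filter_eq' Finset.univ (0 : F),
      Finset.filter_ne' Finset.univ (0 : F)]
    simp only [Finset.mem_univ, if_true, Finset.card_singleton, Finset.card_erase_of_mem,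
      Finset.card_univ, smul_eq_mul, one_mul]
    rw [mul_comm (Fintype.card F - 1), ← mul_add]
    have := Fintype.card_pos (α := F)
    congr 1; omega
  rw [Finset.card_filter]
  simp_rw [← Finset.univ_product_univ, Finset.sum_product]
  have h2 : ∀ a : F, (∑ b : F, ∑ c : F, ∑ d : F, if a * b = c * d then 1 else 0) =
      if a = 0 then Fintype.card F * (2 * Fintype.card F - 1) else Fintype.card F ^ 2 := by
    intro a
    rw [Finset.sum_comm]
    have : ∀ c : F, (∑ b : F, ∑ d : F, if a * b = c * d then 1 else 0) =
        ∑ d : F, if a = 0 then (if c * d = 0 then Fintype.card F else 0) else 1 := by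
      intro c
      rw [Finset.sum_comm]
      exact Finset.sum_congr rfl fun d _ => hinner a c d
    simp_rw [this]
    by_cases ha : a = 0
    · simp only [ha, if_true]; exact hcd
    · simp [ha, sq]
  simp_rw [h2]
  rw [Finset.sum_ite, Finset.sum_const, Finset.sum_const, Finset.filter_eq' Finset.univ (0 : F),
      Finset.filter_ne' Finset.univ (0 : F)]
  simp only [Finset.mem_univ, if_true, Finset.card_singleton, Finset.card_erase_of_mem,
      Finset.card_univ, smul_eq_mul, one_mul]
  rw [add_comm]

namespace HurwitzInt

/-- The norm form of the Hurwitz order in the basis `1, i, j, (1+i+j+k)/2`. -/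
def normForm {R : Type*} [CommRing R] (v : Fin 4 → R) : R :=
  v 0 ^ 2 + v 1 ^ 2 + v 2 ^ 2 + v 3 ^ 2 + (v 0 + v 1 + v 2) * v 3

/-- Four times the norm form is x² + y² + z² + w² in x = 2v₀+v₃, y = 2v₁+v₃, z = 2v₂+v₃, w = v₃.
With α² + β² = -1 this equals z² - (αx-βy)² - (αy+βx)² + w², a hyperbolic form. -/
theorem card_normForm_eq_zero (p : ℕ) [Fact p.Prime] (hp : Odd p) :
    (Finset.univ.filter fun v : Fin 4 → ZMod p => normForm v = 0).card =
      (p ^ 2 - 1) * (p + 1) + 1 := by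
  have hp2 : p ≠ 2 := by rintro rfl; exact absurd hp (by decide)
  have h2 : (2 : ZMod p) ≠ 0 := by
    have : Fact (2 < p) := ⟨lt_of_le_of_ne (Fact.out : p.Prime).two_le hp2.symm⟩
    exact ZMod.neg_one_ne_one |> fun h h' => h (by linear_combination -h')
  obtain ⟨α, β, hαβ⟩ := ZMod.sq_add_sq p (-1)
  let f : (Fin 4 → ZMod p) → ZMod p × ZMod p × ZMod p × ZMod p := fun v =>
    let x := 2 * v 0 + v 3
    let y := 2 * v 1 + v 3
    let z := 2 * v 2 + v 3
    let w := v 3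
    (z - (α * x - β * y), z + (α * x - β * y), (α * y + β * x) - w, (α * y + β * x) + w)
  have hf : Function.Injective f := by
    intro v w h
    simp only [f, Prod.mk.injEq] at h
    obtain ⟨e0, e1, e2, e3⟩ := h
    have k3 : v 3 = w 3 := mul_left_cancel₀ h2 (by linear_combination e3 - e2)
    have kz : 2 * v 2 + v 3 = 2 * w 2 + w 3 := mul_left_cancel₀ h2 (by linear_combination e0 + e1)
    have ky' : α * (2 * v 1 + v 3) + β * (2 * v 0 + v 3) =
        α * (2 * w 1 + w 3) + β * (2 * w 0 + w 3) :=
      mul_left_cancel₀ h2 (by linear_combination e2 + e3)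
    have kx' : α * (2 * v 0 + v 3) - β * (2 * v 1 + v 3) =
        α * (2 * w 0 + w 3) - β * (2 * w 1 + w 3) :=
      mul_left_cancel₀ h2 (by linear_combination e1 - e0)
    have kx : 2 * v 0 + v 3 = 2 * w 0 + w 3 := by
      linear_combination (2 * v 0 + v 3 - 2 * w 0 - w 3) * hαβ - α * kx' - β * ky'
    have ky : 2 * v 1 + v 3 = 2 * w 1 + w 3 := by
      linear_combination (2 * v 1 + v 3 - 2 * w 1 - w 3) * hαβ + β * kx' - α * ky'
    rw [k3, add_left_inj] at kx ky kz
    funext i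
    fin_cases i
    · exact mul_left_cancel₀ h2 kx
    · exact mul_left_cancel₀ h2 ky
    · exact mul_left_cancel₀ h2 kz
    · exact k3
  have hbij : Function.Bijective f := by
    rw [Fintype.bijective_iff_injective_and_card]
    exact ⟨hf, by simp [ZMod.card]; ring⟩
  have hcard := card_mul_eq_mul (ZMod p)
  rw [ZMod.card] at hcard
  have h4 : (4 : ZMod p) ≠ 0 := by
    rw [show (4 : ZMod p) = 2 * 2 by norm_num]; exact mul_ne_zero h2 h2
  have hiff : ∀ v, normForm v = 0 ↔ (f v).1 * (f v).2.1 = (f v).2.2.1 * (f v).2.2.2 := by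
    intro v
    have key : (f v).1 * (f v).2.1 - (f v).2.2.1 * (f v).2.2.2 = 4 * normForm v := by
      simp only [f, normForm]
      linear_combination (-(2 * v 0 + v 3) ^ 2 - (2 * v 1 + v 3) ^ 2) * hαβ
    rw [← sub_eq_zero (a := (f v).1 * (f v).2.1), key, mul_eq_zero, or_iff_right h4]
  have h : (Finset.univ.filter fun v : Fin 4 → ZMod p => normForm v = 0).card =
      (Finset.univ.filter fun v : ZMod p × ZMod p × ZMod p × ZMod p =>
        v.1 * v.2.1 = v.2.2.1 * v.2.2.2).card := by
    refine Finset.card_bij (fun v _ => f v) (fun v hv => ?_) (fun v _ w _ h => hf h) fun w hw => ?_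
    · simpa [hiff] using hv
    · obtain ⟨v, rfl⟩ := hbij.surjective w
      exact ⟨v, by simpa [hiff] using hw, rfl⟩
  rw [h, hcard]
  obtain ⟨k, hk⟩ : ∃ k, p = k + 1 := ⟨p - 1, by have := hp.pos; omega⟩
  rw [hk]
  have e1 : 2 * (k + 1) - 1 = 2 * k + 1 := by omega
  have e2 : (k + 1) ^ 2 - 1 = k ^ 2 + 2 * k := by
    rw [show (k + 1) ^ 2 = k ^ 2 + 2 * k + 1 by ring, Nat.add_sub_cancel]
  rw [e1, e2, Nat.add_sub_cancel]
  ring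

/-- Reduction of the coordinates of a Hurwitz integer modulo `p`. -/
noncomputable def coordMod (p : ℕ) : 𝓗 →+ (Fin 4 → ZMod p) :=
  (AddMonoidHom.compLeft (Int.castAddHom (ZMod p)) (Fin 4)).comp coordEquiv.symm.toAddMonoidHom

theorem coordMod_coordEquiv (p : ℕ) (v : Fin 4 → ℤ) (i : Fin 4) :
    coordMod p (coordEquiv v) i = (v i : ZMod p) := by
  simp [coordMod]

theorem coordMod_surjective (p : ℕ) : Function.Surjective (coordMod p) := by
  intro w
  choose v hv using fun i => ZMod.intCast_surjective (w i)
  exact ⟨coordEquiv v, funext fun i => by rw [coordMod_coordEquiv, hv]⟩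

theorem coordMod_eq_zero_iff {p : ℕ} {x : 𝓗} : coordMod p x = 0 ↔ (p : 𝓗) ∣ x := by
  obtain ⟨v, rfl⟩ := coordEquiv.surjective x
  constructor
  · intro h
    have : ∀ i, (p : ℤ) ∣ v i := fun i => by
      rw [← ZMod.intCast_zmod_eq_zero_iff_dvd, ← coordMod_coordEquiv, h]; rfl
    choose w hw using this
    refine ⟨coordEquiv w, ?_⟩
    rw [← nsmul_eq_mul, ← map_nsmul]
    congr 1
    funext i
    simp [hw i]
  · rintro ⟨y, hy⟩
    rw [hy, ← nsmul_eq_mul, map_nsmul]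
    funext i
    simp

theorem normForm_coordMod (p : ℕ) (x : 𝓗) : normForm (coordMod p x) = (nrm x : ZMod p) := by
  obtain ⟨v, rfl⟩ := coordEquiv.surjective x
  have h : (nrm (mk (v 0) (v 1) (v 2) (v 3)) : ℤ) = _ := nrm_mk _ _ _ _
  have h' := congrArg (Int.cast : ℤ → ZMod p) h
  push_cast at h'
  change _ = (nrm (mk (v 0) (v 1) (v 2) (v 3)) : ZMod p)
  rw [h', normForm]
  simp only [coordMod_coordEquiv]

/-- As r divides p = r r̄, the ideal contains p𝓗, so its image keeps the index p² in a space of p⁴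
elements. -/
theorem ncard_map_coordMod {p : ℕ} (hp : p.Prime) {r : 𝓗} (hr : nrm r = p) :
    ((rightIdeal r).map (coordMod p) : Set (Fin 4 → ZMod p)).ncard = p ^ 2 := by
  have : Fact p.Prime := ⟨hp⟩
  have hr0 : r ≠ 0 := by rintro rfl; rw [map_zero] at hr; exact hp.ne_zero hr.symm
  have hker : (coordMod p).ker ≤ rightIdeal r := by
    intro x hx
    rw [AddMonoidHom.mem_ker, coordMod_eq_zero_iff, ← hr, ← mul_star] at hx
    exact mem_rightIdeal.2 ((dvd_mul_right _ _).trans hx)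
  have hidx : ((rightIdeal r).map (coordMod p)).index = p ^ 2 := by
    rw [AddSubgroup.index_map_eq _ (coordMod_surjective p) hker, index_rightIdeal hr0, hr]
  have := AddSubgroup.card_mul_index ((rightIdeal r).map (coordMod p))
  rw [hidx, Nat.card_fun, Nat.card_zmod, Nat.card_fin] at this
  rw [← Nat.card_coe_set_eq]
  refine Nat.eq_of_mul_eq_mul_right (pow_pos hp.pos 2) ?_
  rw [← pow_add]
  exact this

/-- Each nonzero isotropic vector v modulo p determines the ideal of norm p generated by p and a
lift of v. The vectors belonging to r𝓗 are the nonzero elements of its image, p² - 1 in number, out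
of (p² - 1)(p + 1) in total. -/
theorem psi_prime {p : ℕ} (hp : p.Prime) (hpo : Odd p) : psi p = p + 1 := by
  classical
  have : Fact p.Prime := ⟨hp⟩
  let Z : Set (Fin 4 → ZMod p) := {v | normForm v = 0 ∧ v ≠ 0}
  have hZ : Z.ncard = (p ^ 2 - 1) * (p + 1) := by
    have h1 : Z = ((Finset.univ.filter fun v : Fin 4 → ZMod p => normForm v = 0).erase 0 :
        Finset (Fin 4 → ZMod p)) := by
      ext v; simp [Z]
    rw [h1, Set.ncard_coe_finset, Finset.card_erase_of_mem (Finset.mem_filter.2 ⟨Finset.mem_univ _, by simp [normForm]⟩),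
      card_normForm_eq_zero p hpo, Nat.add_sub_cancel]
  let s := Function.surjInv (coordMod_surjective p)
  have hs : ∀ v, coordMod p (s v) = v := Function.surjInv_eq _
  have hgen : ∀ v ∈ Z, ∃ r, Prim r ∧ nrm r = p ∧ rightIdeal (s v) ⊔ rightIdeal (p : 𝓗) = rightIdeal r := by
    rintro v ⟨hv, hv0⟩
    have h1 : p ∣ nrm (s v) := by
      rw [← ZMod.natCast_eq_zero_iff, ← normForm_coordMod, hs, hv]
    have h2 : ¬ (p : 𝓗) ∣ s v := by rw [← coordMod_eq_zero_iff, hs]; exact hv0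
    obtain ⟨r, hr, hrn, h, -⟩ := exists_sup_rightIdeal_natCast h1 (fun k hk hkx => by
      rcases (Nat.dvd_prime hp).1 hk with h | rfl
      · exact h
      · exact absurd hkx h2)
    exact ⟨r, hr, hrn, h⟩
  have hcount : Z.ncard = psi p * (p ^ 2 - 1) := by
    refine Set.ncard_eq_mul_of_fibers (fun v => rightIdeal (s v) ⊔ rightIdeal (p : 𝓗))
      (Set.toFinite _) (finite_primIdeals p) ?_ ?_
    · intro v hv
      obtain ⟨r, hr, hrn, h⟩ := hgen v hv
      exact ⟨hpo, r, hr, hrn, h⟩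
    · rintro _ ⟨-, r, hr, hrn, rfl⟩
      rw [← ncard_map_coordMod hp hrn, ← Set.ncard_sdiff_singleton_of_mem
        (((rightIdeal r).map (coordMod p)).zero_mem : (0 : Fin 4 → ZMod p) ∈ _)]
      congr 1
      ext v
      constructor
      · rintro ⟨⟨-, hv0⟩, h⟩
        have : s v ∈ rightIdeal r := by
          rw [← h]; exact le_sup_left (a := rightIdeal (s v)) (mem_rightIdeal.2 dvd_rfl)
        exact ⟨⟨s v, this, hs v⟩, hv0⟩
      · rintro ⟨⟨x, hx, rfl⟩, hv0⟩
        have hxs : (p : 𝓗) ∣ s (coordMod p x) - x := by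
          rw [← coordMod_eq_zero_iff, map_sub, hs, sub_self]
        have hrp : r ∣ (p : 𝓗) := ⟨star r, by rw [mul_star, hrn]⟩
        have hrs : r ∣ s (coordMod p x) := by
          have := dvd_add (hrp.trans hxs) (mem_rightIdeal.1 hx)
          rwa [sub_add_cancel] at this
        have hZ : coordMod p x ∈ Z := by
          refine ⟨?_, hv0⟩
          rw [normForm_coordMod, ZMod.natCast_eq_zero_iff, ← hrn]
          exact map_dvd nrm (mem_rightIdeal.1 hx)
        refine ⟨hZ, ?_⟩
        obtain ⟨r', hr', hrn', h⟩ := hgen _ hZ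
        rw [h]
        symm
        refine rightIdeal_eq_of_dvd hr'.ne_zero ?_ (hrn.trans hrn'.symm)
        rw [← rightIdeal_le, ← h]
        exact sup_le (rightIdeal_le.2 hrs) (rightIdeal_le.2 hrp)
  have hpos : 0 < p ^ 2 - 1 := by
    have := Nat.pow_le_pow_left hp.two_le 2
    omega
  refine Nat.eq_of_mul_eq_mul_right hpos ?_
  rw [← hcount, hZ, mul_comm]

theorem psi_prime_pow {p : ℕ} (hp : p.Prime) (hpo : Odd p) (r : ℕ) :
    psi (p ^ (r + 1)) = p ^ r * (p + 1) := by
  induction r with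
  | zero => simp [psi_prime hp hpo]
  | succ r ih =>
    rw [pow_succ, psi_prime_mul hp hpo hpo.pow (dvd_pow_self p (Nat.succ_ne_zero r)), ih,
      psi_prime hp hpo, Nat.add_sub_cancel]
    ring

/-- Primitive Hurwitz integers of odd norm can be extended on the right to primitive ones. -/
theorem exists_prim_mul {e : ℕ} (he : Odd e) {r : 𝓗} (hr : Prim r) :
    ∃ t, Prim (r * t) ∧ nrm t = e := by
  induction e using Nat.recOnMul generalizing r with
  | zero => exact absurd he (by decide)
  | one => exact ⟨1, by rwa [mul_one], map_one _⟩
  | prime p hp =>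
    have hpsi := psi_prime hp he
    by_cases hpr : p ∣ nrm r
    · obtain ⟨B, hB, h⟩ := exists_bad_ideal hr hp he hpr
      obtain ⟨I, ⟨-, t, ht, htn, rfl⟩, hne⟩ := Set.exists_ne_of_one_lt_ncard
        (show 1 < (primIdeals p).ncard by rw [← psi, hpsi]; have := hp.pos; omega) B
      exact ⟨t, (h t htn).2 hne, htn⟩
    · obtain ⟨I, -, t, ht, htn, rfl⟩ := Set.nonempty_of_ncard_ne_zero
        (show (primIdeals p).ncard ≠ 0 by rw [← psi, hpsi]; omega)
      refine ⟨t, (prim_mul_iff hr hp htn).2 fun h => ?_, htn⟩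
      have h1 := natCast_dvd_mul_left (star r) h
      rw [← mul_assoc, star_mul'] at h1
      exact hpr (ht.dvd_of_dvd_mul h1)
  | mul a b iha ihb =>
    obtain ⟨t, ht, htn⟩ := iha (Nat.odd_mul.1 he).1 hr
    obtain ⟨u, hu, hun⟩ := ihb (Nat.odd_mul.1 he).2 ht
    exact ⟨t * u, by rwa [← mul_assoc], by rw [map_mul, htn, hun]⟩

/-- Every primitive r of norm d extends to a primitive rt of norm m, so I ↦ I + d𝓗 is onto. This is
what bounds the CSL count by the rotation count. -/
theorem psi_le_of_dvd {d m : ℕ} (h : d ∣ m) (hodd : Odd d → Odd m) : psi d ≤ psi m := by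
  have : primIdeals d ⊆ (fun I => I ⊔ rightIdeal (d : 𝓗)) '' primIdeals m := by
    rintro _ ⟨hd, r, hr, hrn, rfl⟩
    obtain ⟨e, rfl⟩ := h
    obtain ⟨t, ht, htn⟩ := exists_prim_mul (Nat.odd_mul.1 (hodd hd)).2 hr
    exact ⟨_, ⟨hodd hd, r * t, ht, by rw [map_mul, hrn, htn], rfl⟩,
      sup_rightIdeal_natCast_eq ht hrn (dvd_mul_right _ _)⟩
  exact (Set.ncard_le_ncard this ((finite_primIdeals m).image _)).trans
    (Set.ncard_image_le (finite_primIdeals m))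

end HurwitzInt

/-! ### Isometries of the quaternions -/

/-- The determinant of a linear endomorphism of the quaternions from its coordinate matrix. -/
theorem Quaternion.det_eq_det_matrix (f : ℍ →ₗ[ℝ] ℍ) (M : Matrix (Fin 4) (Fin 4) ℝ)
    (h : ∀ x : ℍ, f x = ⟨(M.mulVec ![x.re, x.imI, x.imJ, x.imK]) 0,
      (M.mulVec ![x.re, x.imI, x.imJ, x.imK]) 1, (M.mulVec ![x.re, x.imI, x.imJ, x.imK]) 2,
      (M.mulVec ![x.re, x.imI, x.imJ, x.imK]) 3⟩) :
    LinearMap.det f = M.det := by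
  let e : ℍ ≃ₗ[ℝ] (Fin 4 → ℝ) := QuaternionAlgebra.linearEquivTuple (-1 : ℝ) (0 : ℝ) (-1 : ℝ)
  rw [← LinearMap.det_toLin', ← LinearMap.det_conj f e]
  congr 1
  refine LinearMap.ext fun v => ?_
  have hv : ![v 0, v 1, v 2, v 3] = v := by ext i; fin_cases i <;> rfl
  have hf := h (e.symm v)
  change f _ = ⟨(M.mulVec ![v 0, v 1, v 2, v 3]) 0, (M.mulVec ![v 0, v 1, v 2, v 3]) 1,
    (M.mulVec ![v 0, v 1, v 2, v 3]) 2, (M.mulVec ![v 0, v 1, v 2, v 3]) 3⟩ at hf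
  rw [hv] at hf
  rw [LinearMap.comp_apply, LinearMap.comp_apply, LinearEquiv.coe_coe, LinearEquiv.coe_coe, hf,
    Matrix.toLin'_apply]
  ext i
  fin_cases i <;> rfl

theorem Quaternion.det_mulLeft (a : ℍ) : LinearMap.det (LinearMap.mulLeft ℝ a) = normSq a ^ 2 := by
  rw [det_eq_det_matrix _ !![a.re, -a.imI, -a.imJ, -a.imK; a.imI, a.re, -a.imK, a.imJ;
    a.imJ, a.imK, a.re, -a.imI; a.imK, -a.imJ, a.imI, a.re]]
  · rw [Matrix.det_succ_row_zero]
    simp [Fin.sum_univ_succ, Matrix.det_fin_three, normSq_def', Fin.succAbove]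
    ring
  · intro x
    ext <;> simp [Matrix.mulVec, dotProduct, Fin.sum_univ_four] <;> ring

theorem Quaternion.det_mulRight (a : ℍ) : LinearMap.det (LinearMap.mulRight ℝ a) = normSq a ^ 2 := by
  rw [det_eq_det_matrix _ !![a.re, -a.imI, -a.imJ, -a.imK; a.imI, a.re, a.imK, -a.imJ;
    a.imJ, -a.imK, a.re, a.imI; a.imK, a.imJ, -a.imI, a.re]]
  · rw [Matrix.det_succ_row_zero]
    simp [Fin.sum_univ_succ, Matrix.det_fin_three, normSq_def', Fin.succAbove]
    ring
  · intro x
    ext <;> simp [Matrix.mulVec, dotProduct, Fin.sum_univ_four] <;> ring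

/-- Quaternion conjugation as a real linear map. -/
noncomputable def Quaternion.starLinear : ℍ →ₗ[ℝ] ℍ where
  toFun := star
  map_add' := star_add
  map_smul' r x := by ext <;> simp

theorem Quaternion.det_star : LinearMap.det Quaternion.starLinear = -1 := by
  rw [det_eq_det_matrix _ !![1, 0, 0, 0; 0, -1, 0, 0; 0, 0, -1, 0; 0, 0, 0, -1]]
  · rw [Matrix.det_succ_row_zero]
    simp [Fin.sum_univ_succ, Matrix.det_fin_three, Fin.succAbove]
  · intro x
    ext <;> simp [starLinear, Matrix.mulVec, dotProduct, Fin.sum_univ_four]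

/-- Every linear isometry of the quaternions is `x ↦ a * x * b` or `x ↦ a * star x * b`. -/
theorem Quaternion.exists_isometry_eq (T : ℍ ≃ₗᵢ[ℝ] ℍ) : ∃ a b : ℍ, ‖a‖ = 1 ∧ ‖b‖ = 1 ∧
    ((∀ x, T x = a * x * b) ∨ (∀ x, T x = a * star x * b)) := by
  have : FiniteDimensional ℝ ℍ := inferInstance
  -- Cartan–Dieudonné: induct on the list of reflections; each nontrivial one exchanges the two
  -- forms.
  obtain ⟨l, -, hl⟩ := T.reflections_generate_dim
  induction l generalizing T with
  | nil => exact ⟨1, 1, norm_one, norm_one, Or.inl fun x => by simp [hl]⟩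
  | cons v l ih =>
    obtain ⟨a, b, ha, hb, hab⟩ := ih _ rfl
    have hT : ∀ x, T x = (ℝ ∙ v)ᗮ.reflection ((l.map fun v => (ℝ ∙ v)ᗮ.reflection).prod x) := by
      intro x; rw [hl]; rfl
    by_cases hv : v = 0
    · have : ∀ x, (ℝ ∙ v)ᗮ.reflection x = x := by
        intro x; rw [Submodule.reflection_orthogonal_apply, hv]; simp
      simp only [this] at hT
      exact ⟨a, b, ha, hb, hab.imp (fun h x => by rw [hT, h]) (fun h x => by rw [hT, h])⟩
    · have hv' : ‖v‖ ≠ 0 := norm_ne_zero_iff.2 hv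
      set u : ℍ := (‖v‖⁻¹ : ℝ) • v with hu
      have hun : ‖u‖ = 1 := by rw [hu, norm_smul, norm_inv, norm_norm, inv_mul_cancel₀ hv']
      -- For a unit u, 2⟨u, x⟩ = u x̄ + x ū; multiplying by u on the right turns x - 2⟨u, x⟩u into
      -- -u x̄ u.
      have hrefl : ∀ x, (ℝ ∙ v)ᗮ.reflection x = -(u * star x * u) := by
        intro x
        have hspan : (ℝ ∙ v) = ℝ ∙ u := by
          rw [hu, Submodule.span_singleton_smul_eq (IsUnit.mk0 _ (inv_ne_zero hv'))]
        rw [Submodule.reflection_orthogonal_apply]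
        simp only [hspan]
        rw [Submodule.reflection_singleton_apply, hun]
        have h1 : u * star u = 1 := by rw [self_mul_star, normSq_eq_norm_mul_self, hun]; simp
        have h2 : u * star x + x * star u = ((2 * inner ℝ u x : ℝ) : ℍ) := by
          rw [inner_def]; ext <;> simp <;> ring
        have h3 : star u * u = 1 := by rw [star_mul_self, normSq_eq_norm_mul_self, hun]; simp
        have h4 : u * star x * u = ((2 * inner ℝ u x : ℝ) : ℍ) * u - x := by
          rw [← h2, add_mul, mul_assoc x, h3, mul_one, add_sub_cancel_right]
        rw [h4, coe_mul_eq_smul]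
        simp [two_mul, add_smul, two_smul]
      rcases hab with h | h
      · refine ⟨-(u * star b), star a * u, ?_, ?_, Or.inr fun x => ?_⟩
        · rw [norm_neg, norm_mul, norm_star, hun, hb, one_mul]
        · rw [norm_mul, norm_star, hun, ha, one_mul]
        · rw [hT, h, hrefl]; simp only [star_mul, mul_assoc, neg_mul]
      · refine ⟨-(u * star b), star a * u, ?_, ?_, Or.inl fun x => ?_⟩
        · rw [norm_neg, norm_mul, norm_star, hun, hb, one_mul]
        · rw [norm_mul, norm_star, hun, ha, one_mul]
        · rw [hT, h, hrefl]; simp only [star_mul, mul_assoc, neg_mul, star_star]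

/-! ### Transport of the lattice problem to the Hurwitz order -/

/-- The identification of the quaternions with Euclidean four-space. -/
noncomputable def quatIso : ℍ ≃ₗᵢ[ℝ] E4 := Quaternion.linearIsometryEquivTuple

theorem quatIso_apply (x : ℍ) : quatIso x = !₂[x.re, x.imI, x.imJ, x.imK] := rfl

namespace HurwitzInt

/-- The embedding of the Hurwitz integers into Euclidean four-space. -/
noncomputable def emb : 𝓗 →+ E4 :=
  (quatIso.toLinearEquiv.toAddEquiv : ℍ →+ E4).comp hurwitzOrder.subtype.toAddMonoidHom

theorem emb_apply (x : 𝓗) : emb x = quatIso x := rfl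

theorem emb_injective : Function.Injective emb := fun _ _ h =>
  Subtype.ext (quatIso.injective h)

theorem latticeD4Star_eq_range : latticeD4Star = emb.range := by
  rw [latticeD4Star_eq_closure]
  refine le_antisymm ?_ ?_
  · rw [AddSubgroup.closure_le]
    rintro y (rfl | rfl | rfl | rfl)
    · exact ⟨mk 1 0 0 0, by rw [emb_apply, quatIso_apply]; simp⟩
    · exact ⟨mk 0 1 0 0, by rw [emb_apply, quatIso_apply]; simp⟩
    · exact ⟨mk 0 0 1 0, by rw [emb_apply, quatIso_apply]; simp⟩
    · exact ⟨mk 0 0 0 1, by rw [emb_apply, quatIso_apply]; simp⟩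
  · rintro _ ⟨x, rfl⟩
    obtain ⟨a, b, c, d, rfl⟩ := exists_eq_mk x
    have : emb (mk a b c d) = a • (!₂[1, 0, 0, 0] : E4) + b • (!₂[0, 1, 0, 0] : E4)
        + c • (!₂[0, 0, 1, 0] : E4) + d • (!₂[1/2, 1/2, 1/2, 1/2] : E4) := by
      rw [emb_apply, quatIso_apply]
      ext i
      fin_cases i <;> simp <;> ring
    rw [this]
    refine add_mem (add_mem (add_mem ?_ ?_) ?_) ?_ <;>
      exact zsmul_mem (AddSubgroup.subset_closure (by simp)) _

/-- The Hurwitz integers that an isometry of the quaternions pulls back to Hurwitz integers. -/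
noncomputable def integralPart (T : ℍ ≃ₗᵢ[ℝ] ℍ) : AddSubgroup 𝓗 :=
  (hurwitzOrder.toAddSubgroup.comap (T.symm.toLinearEquiv.toAddEquiv : ℍ →+ ℍ)).comap
    hurwitzOrder.subtype.toAddMonoidHom

theorem mem_integralPart {T : ℍ ≃ₗᵢ[ℝ] ℍ} {x : 𝓗} :
    x ∈ integralPart T ↔ T.symm (x : ℍ) ∈ hurwitzOrder := Iff.rfl

/-- Transport of an isometry of Euclidean four-space to the quaternions. -/
noncomputable def quatConj (R : E4 ≃ₗᵢ[ℝ] E4) : ℍ ≃ₗᵢ[ℝ] ℍ :=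
  (quatIso.trans R).trans quatIso.symm

theorem quatConj_apply (R : E4 ≃ₗᵢ[ℝ] E4) (x : ℍ) : quatConj R x = quatIso.symm (R (quatIso x)) := rfl

theorem quatConj_injective : Function.Injective quatConj := by
  intro R S h
  ext1 x
  have := congrArg (fun T => quatIso (T (quatIso.symm x))) h
  simpa [quatConj_apply] using this

theorem quatConj_surjective : Function.Surjective quatConj := fun T =>
  ⟨(quatIso.symm.trans T).trans quatIso, by ext1 x; simp [quatConj_apply]⟩

theorem csl_eq_map (R : E4 ≃ₗᵢ[ℝ] E4) :
    csl latticeD4Star R = (integralPart (quatConj R)).map emb := by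
  rw [latticeD4Star_eq_range]
  ext y
  constructor
  · rintro ⟨⟨x, rfl⟩, ⟨_, ⟨z, rfl⟩, hz⟩⟩
    refine ⟨x, ?_, rfl⟩
    change (quatConj R).symm (x : ℍ) ∈ hurwitzOrder
    have : quatConj R (z : ℍ) = x := by
      rw [quatConj_apply, LinearIsometryEquiv.symm_apply_eq]; exact hz
    rw [← this, LinearIsometryEquiv.symm_apply_apply]
    exact z.2
  · rintro ⟨x, hx, rfl⟩
    refine ⟨⟨x, rfl⟩, ?_⟩
    refine ⟨_, ⟨⟨(quatConj R).symm (x : ℍ), hx⟩, rfl⟩, ?_⟩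
    change R (quatIso ((quatConj R).symm (x : ℍ))) = quatIso x
    have h := (quatConj R).apply_symm_apply (x : ℍ)
    rw [quatConj_apply, LinearIsometryEquiv.symm_apply_eq] at h
    exact h

theorem coincidenceIndex_eq (R : E4 ≃ₗᵢ[ℝ] E4) :
    coincidenceIndex latticeD4Star R = (integralPart (quatConj R)).index := by
  rw [coincidenceIndex, csl_eq_map, latticeD4Star_eq_range, AddMonoidHom.range_eq_map,
    AddSubgroup.relIndex_map_map_of_injective _ _ emb_injective, AddSubgroup.relIndex_top_right]

theorem det_quatConj (R : E4 ≃ₗᵢ[ℝ] E4) :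
    LinearMap.det ((quatConj R).toLinearEquiv : ℍ →ₗ[ℝ] ℍ) =
      LinearMap.det (R.toLinearEquiv : E4 →ₗ[ℝ] E4) := by
  rw [← LinearMap.det_conj (R.toLinearEquiv : E4 →ₗ[ℝ] E4) quatIso.symm.toLinearEquiv]
  rfl

end HurwitzInt

theorem Quaternion.det_of_forall_eq_mul {T : ℍ ≃ₗᵢ[ℝ] ℍ} {a b : ℍ} (h : ∀ x, T x = a * x * b) :
    LinearMap.det (T.toLinearEquiv : ℍ →ₗ[ℝ] ℍ) = (normSq a * normSq b) ^ 2 := by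
  have : (T.toLinearEquiv : ℍ →ₗ[ℝ] ℍ) = LinearMap.mulRight ℝ b ∘ₗ LinearMap.mulLeft ℝ a :=
    LinearMap.ext fun x => h x
  rw [this, LinearMap.det_comp, det_mulLeft, det_mulRight]; ring

theorem Quaternion.det_of_forall_eq_mul_star {T : ℍ ≃ₗᵢ[ℝ] ℍ} {a b : ℍ}
    (h : ∀ x, T x = a * star x * b) :
    LinearMap.det (T.toLinearEquiv : ℍ →ₗ[ℝ] ℍ) = -(normSq a * normSq b) ^ 2 := by
  have : (T.toLinearEquiv : ℍ →ₗ[ℝ] ℍ) = LinearMap.mulRight ℝ b ∘ₗ LinearMap.mulLeft ℝ a ∘ₗ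
      starLinear :=
    LinearMap.ext fun x => h x
  rw [this, LinearMap.det_comp, LinearMap.det_comp, det_mulLeft, det_mulRight, det_star]; ring

/-- The isometry `x ↦ a * x * b / (‖a‖ * ‖b‖)`; the identity if `a` or `b` is zero. -/
noncomputable def Quaternion.sandwich (a b : ℍ) : ℍ ≃ₗᵢ[ℝ] ℍ := by
  classical
  exact if h : a ≠ 0 ∧ b ≠ 0 then
    LinearIsometry.toLinearIsometryEquiv
      { toLinearMap := (‖a‖ * ‖b‖)⁻¹ • (LinearMap.mulRight ℝ b ∘ₗ LinearMap.mulLeft ℝ a)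
        norm_map' := fun x => by
          have ha := norm_ne_zero_iff.2 h.1
          have hb := norm_ne_zero_iff.2 h.2
          simp [norm_smul]
          field_simp } rfl
  else LinearIsometryEquiv.refl ℝ ℍ

theorem Quaternion.sandwich_apply {a b : ℍ} (ha : a ≠ 0) (hb : b ≠ 0) (x : ℍ) :
    sandwich a b x = (‖a‖ * ‖b‖)⁻¹ • (a * x * b) := by
  rw [sandwich, dif_pos ⟨ha, hb⟩]; rfl

theorem Quaternion.sandwich_symm_apply {a b : ℍ} (ha : a ≠ 0) (hb : b ≠ 0) (x : ℍ) :
    (sandwich a b).symm x = (‖a‖ * ‖b‖)⁻¹ • (star a * x * star b) := by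
  rw [LinearIsometryEquiv.symm_apply_eq, sandwich_apply ha hb]
  have ha' := norm_ne_zero_iff.2 ha
  have hb' := norm_ne_zero_iff.2 hb
  rw [mul_smul_comm, smul_mul_assoc, smul_smul]
  have : a * (star a * x * star b) * b = (a * star a) * x * (star b * b) := by simp only [mul_assoc]
  rw [this, self_mul_star, star_mul_self, normSq_eq_norm_mul_self, normSq_eq_norm_mul_self,
    coe_mul_eq_smul, mul_coe_eq_smul, smul_smul, smul_smul]
  have : (‖a‖ * ‖b‖)⁻¹ * (‖a‖ * ‖b‖)⁻¹ * (‖b‖ * ‖b‖) * (‖a‖ * ‖a‖) = 1 := by field_simp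
  rw [this, one_smul]

/-! ### Parametrising coincidence rotations by primitive pairs -/

namespace HurwitzInt

/-- `1` or `1 + i`. -/
noncomputable def twist (ε : Bool) : 𝓗 := bif ε then mk 1 1 0 0 else 1

theorem nrm_twist (ε : Bool) : nrm (twist ε) = bif ε then 2 else 1 := by
  cases ε
  · exact map_one _
  · have := nrm_mk 1 1 0 0
    change nrm (mk 1 1 0 0) = 2
    zify; rw [this]; norm_num

theorem twist_ne_zero (ε : Bool) : twist ε ≠ 0 := by
  intro h
  have := nrm_twist ε
  rw [h, map_zero] at this
  cases ε <;> simp at this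

/-- A Hurwitz integer of even norm is divisible by `1 + i` on the right. -/
theorem exists_eq_mul_twist {x : 𝓗} (h : Even (nrm x)) : ∃ y, x = y * twist true := by
  obtain ⟨a, b, c, d, rfl⟩ := exists_eq_mk x
  have h1 : Even (nrm (mk a b c d) : ℤ) := by exact_mod_cast h
  rw [nrm_mk] at h1
  have h2 : Even d ∧ Even (a + b + c) := by
    simp only [Int.even_add, Int.even_mul, Int.even_pow] at h1 ⊢
    tauto
  obtain ⟨⟨e, rfl⟩, ⟨f, hf⟩⟩ := h2
  obtain rfl : c = f + f - a - b := by omega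
  refine ⟨mk (a + b - f) (a + b - f - a - e + a - a) (-e) (f + f - a - b + (e + e)) , ?_⟩
  apply Subtype.ext
  change _ = hurwitzCoord _ _ _ _ * hurwitzCoord 1 1 0 0
  ext <;> simp <;> ring

/-- The Hurwitz integers of even norm form the two-sided ideal generated by 1+i, so 1+i normalises
𝓗. -/
theorem exists_twist_mul (ε : Bool) (y : 𝓗) : ∃ z, twist ε * y = z * twist ε := by
  cases ε
  · exact ⟨y, by simp [twist]⟩
  · refine exists_eq_mul_twist ?_
    rw [map_mul, nrm_twist]; simp

theorem exists_mul_twist (ε : Bool) (y : 𝓗) : ∃ z, y * twist ε = twist ε * z := by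
  cases ε
  · exact ⟨y, by simp [twist]⟩
  · obtain ⟨z, hz⟩ := exists_eq_mul_twist (x := star (y * twist true)) (by
      rw [nrm_star, map_mul, nrm_twist]; simp)
    refine ⟨mk 0 (-1) 0 0 * star z, ?_⟩
    have h1 : y * twist true = star (twist true) * star z := by
      rw [← star_mul, ← hz, star_star]
    rw [h1, ← mul_assoc]
    congr 1
    apply Subtype.ext
    change star (hurwitzCoord 1 1 0 0) = hurwitzCoord 1 1 0 0 * hurwitzCoord 0 (-1) 0 0
    ext <;> simp

theorem norm_sq (x : 𝓗) : ‖(x : ℍ)‖ ^ 2 = nrm x := by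
  rw [coe_nrm, normSq_eq_norm_mul_self, sq]

/-- The coincidence rotation of the quaternions attached to a pair of Hurwitz integers. -/
noncomputable def rotOf (q p : 𝓗) (ε : Bool) : ℍ ≃ₗᵢ[ℝ] ℍ :=
  sandwich ((q * twist ε : 𝓗) : ℍ) (star ((p * twist ε : 𝓗) : ℍ))

theorem norm_mul_norm_eq {q p : 𝓗} (ε : Bool) {c : ℕ} (hc : nrm q * nrm p = c ^ 2) :
    ‖((q * twist ε : 𝓗) : ℍ)‖ * ‖star ((p * twist ε : 𝓗) : ℍ)‖ = nrm (twist ε) * c := by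
  rw [norm_star]
  refine (sq_eq_sq₀ (by positivity) (by positivity)).1 ?_
  rw [mul_pow, norm_sq, norm_sq, map_mul, map_mul, mul_pow]
  have : (nrm q * nrm p : ℝ) = c ^ 2 := by exact_mod_cast hc
  push_cast
  rw [← this]; ring

theorem coe_ne_zero {x : 𝓗} (h : x ≠ 0) : (x : ℍ) ≠ 0 := by simpa using h

theorem rotOf_apply {q p : 𝓗} (hq : q ≠ 0) (hp : p ≠ 0) (ε : Bool) (x : ℍ) :
    rotOf q p ε x = (‖((q * twist ε : 𝓗) : ℍ)‖ * ‖star ((p * twist ε : 𝓗) : ℍ)‖)⁻¹ •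
      (((q * twist ε : 𝓗) : ℍ) * x * star ((p * twist ε : 𝓗) : ℍ)) :=
  sandwich_apply (coe_ne_zero (mul_ne_zero hq (twist_ne_zero ε)))
    (star_ne_zero.2 (coe_ne_zero (mul_ne_zero hp (twist_ne_zero ε)))) x

/-- The inverse rotation divides the conjugate of q(1+i)^ε, times x, times p(1+i)^ε by N((1+i)^ε)c.
Conjugation by 1+i preserves 𝓗, so the outer factors can be removed and only c | q̄xp remains. -/
theorem integralPart_rotOf {q p : 𝓗} (hq : q ≠ 0) (hp : p ≠ 0) (ε : Bool) {c : ℕ}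
    (hc : nrm q * nrm p = c ^ 2) : integralPart (rotOf q p ε) = cslKernel c q p := by
  have hc0 : c ≠ 0 := by
    rintro rfl
    have : nrm q * nrm p = 0 := by rw [hc]; norm_num
    rcases mul_eq_zero.1 this with h | h
    · exact hq (nrm_eq_zero.1 h)
    · exact hp (nrm_eq_zero.1 h)
  have hN : nrm (twist ε) ≠ 0 := by simpa using twist_ne_zero ε
  have hcN : ((nrm (twist ε) * c : ℝ)) ≠ 0 := by positivity
  ext x
  rw [mem_integralPart, mem_cslKernel, rotOf,
    sandwich_symm_apply (coe_ne_zero (mul_ne_zero hq (twist_ne_zero ε)))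
      (star_ne_zero.2 (coe_ne_zero (mul_ne_zero hp (twist_ne_zero ε)))), norm_mul_norm_eq ε hc,
    star_star]
  have hscal : ∀ y : 𝓗, (nrm (twist ε) * c : ℝ)⁻¹ •
      (star ((q * twist ε : 𝓗) : ℍ) * (x : ℍ) * ((p * twist ε : 𝓗) : ℍ)) = (y : ℍ) ↔
      star (q * twist ε) * x * (p * twist ε) = (nrm (twist ε) * c : ℕ) * y := by
    intro y
    rw [inv_smul_eq_iff₀ hcN, ← coe_inj]
    have : (((nrm (twist ε) * c : ℕ) * y : 𝓗) : ℍ) = (nrm (twist ε) * c : ℝ) • (y : ℍ) := by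
      rw [← coe_mul_eq_smul]; push_cast; rfl
    rw [this]; rfl
  have hmem : ∀ z : ℍ, z ∈ hurwitzOrder ↔ ∃ y : 𝓗, z = y := fun z =>
    ⟨fun h => ⟨⟨z, h⟩, rfl⟩, fun ⟨y, hy⟩ => hy ▸ y.2⟩
  rw [hmem]
  simp only [hscal]
  rw [star_mul]
  have hassoc : star (twist ε) * star q * x * (p * twist ε) =
      star (twist ε) * (star q * x * p) * twist ε := by simp only [mul_assoc]
  rw [hassoc]
  constructor
  · rintro ⟨y, hy⟩
    obtain ⟨z, hz⟩ := exists_twist_mul ε y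
    refine ⟨z, ?_⟩
    have hN' : (nrm (twist ε) : 𝓗) ≠ 0 := by exact_mod_cast hN
    refine mul_left_cancel₀ hN' (mul_right_cancel₀ hN' ?_)
    calc (nrm (twist ε) : 𝓗) * (star q * x * p) * nrm (twist ε)
        = twist ε * (star (twist ε) * (star q * x * p) * twist ε) * star (twist ε) := by
          rw [← mul_star]; simp only [mul_assoc]
      _ = (nrm (twist ε) * c : ℕ) * (twist ε * y * star (twist ε)) := by
          rw [hy, ← mul_assoc, ← natCast_comm]; simp only [mul_assoc]
      _ = nrm (twist ε) * (c * z) * nrm (twist ε) := by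
          rw [hz, mul_assoc z, mul_star]; push_cast; simp only [mul_assoc]
  · rintro ⟨z, hz⟩
    obtain ⟨y, hy⟩ := exists_mul_twist ε z
    refine ⟨y, ?_⟩
    rw [hz, mul_assoc, mul_assoc, hy, ← mul_assoc, ← natCast_comm, mul_assoc, ← mul_assoc _ _ y, star_mul',
      ← mul_assoc, ← Nat.cast_mul, mul_comm c]

/-- Every nonzero Hurwitz integer is, up to an integer factor, a primitive Hurwitz integer of odd
norm times `1` or `1 + i`. -/
theorem exists_eq_natCast_mul_prim_mul_twist (x : 𝓗) (hx : x ≠ 0) :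
    ∃ (n : ℕ) (q : 𝓗) (ε : Bool), n ≠ 0 ∧ Prim q ∧ Odd (nrm q) ∧ x = n * (q * twist ε) := by
  induction h : nrm x using Nat.strong_induction_on generalizing x with
  | _ N ih =>
    subst h
    have hx' : 0 < nrm x := Nat.pos_of_ne_zero (by simpa using hx)
    by_cases hp : Prim x
    · rcases Nat.even_or_odd (nrm x) with he | ho
      · obtain ⟨y, rfl⟩ := exists_eq_mul_twist he
        have hy0 : y ≠ 0 := left_ne_zero_of_mul hx
        have hy1 : 0 < nrm y := Nat.pos_of_ne_zero (by simpa using hy0)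
        obtain ⟨n, q, ε, hn, hq, hqo, hy⟩ := ih (nrm y) (by
          rw [map_mul, nrm_twist, cond_true]; omega) y hy0 rfl
        cases ε
        · exact ⟨n, q, true, hn, hq, hqo, by rw [hy]; simp [twist, mul_assoc]⟩
        -- If a factor 1+i is already present, (1+i)² = 2i: the 2 joins the integer factor and the
        -- unit i is absorbed into q.
        · have hu : nrm (mk 0 1 0 0) = 1 := by
            have := nrm_mk 0 1 0 0
            zify; rw [this]; norm_num
          have h2 : rightIdeal q = rightIdeal (q * mk 0 1 0 0) :=
            (rightIdeal_eq_iff hq.ne_zero).2 ⟨_, hu, rfl⟩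
          refine ⟨n * 2, q * mk 0 1 0 0, false, by omega, prim_of_rightIdeal_eq hq h2, ?_, ?_⟩
          · rwa [nrm_of_rightIdeal_eq hq.ne_zero h2]
          · have h3 : twist true * twist true = 2 * mk 0 1 0 0 := by
              apply Subtype.ext
              change hurwitzCoord 1 1 0 0 * hurwitzCoord 1 1 0 0 = 2 * hurwitzCoord 0 1 0 0
              rw [two_mul]
              ext <;> simp
            have h4 : (2 : 𝓗) = ((2 : ℕ) : 𝓗) := rfl
            rw [hy, mul_assoc, mul_assoc, h3, h4, ← mul_assoc q, ← natCast_comm, Nat.cast_mul]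
            simp [twist, mul_assoc]
      · exact ⟨1, x, false, one_ne_zero, hp, ho, by simp [twist]⟩
    · rw [Prim] at hp
      push Not at hp
      obtain ⟨k, ⟨y, rfl⟩, hk⟩ := hp
      have hk0 : k ≠ 0 := by rintro rfl; simp at hx
      have hy0 : y ≠ 0 := right_ne_zero_of_mul hx
      have hy1 : 0 < nrm y := Nat.pos_of_ne_zero (by simpa using hy0)
      obtain ⟨n, q, ε, hn, hq, hqo, hy⟩ := ih (nrm y) (by
        rw [map_mul, nrm_natCast]
        have : 2 ≤ k := by omega
        nlinarith [Nat.pow_le_pow_left this 2]) y hy0 rfl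
      exact ⟨k * n, q, ε, by positivity, hq, hqo, by rw [hy, Nat.cast_mul, mul_assoc]⟩

/-- If `x ↦ a * x * b` maps the Hurwitz integers to rational multiples of Hurwitz integers with a
common denominator, then `a` is a real multiple of a Hurwitz integer. -/
theorem exists_smul_mem_left {a b : ℍ} (hb : b ≠ 0) {k : ℕ} (hk : k ≠ 0)
    (h : ∀ x : 𝓗, (k : ℍ) * (a * x * b) ∈ hurwitzOrder) :
    ∃ (r : ℝ) (y : 𝓗), r ≠ 0 ∧ a = r • (y : ℍ) := by
  have key : ∀ (r : ℝ) (y : 𝓗), r ≠ 0 → (y : ℍ) = r • a → ∃ (r : ℝ) (y : 𝓗), r ≠ 0 ∧ a = r • (y : ℍ) := by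
    intro r y hr hy
    exact ⟨r⁻¹, y, inv_ne_zero hr, by rw [hy, smul_smul, inv_mul_cancel₀ hr, one_smul]⟩
  have hsum : ∀ y : 𝓗, (b * y).re ≠ 0 → ∃ (r : ℝ) (y : 𝓗), r ≠ 0 ∧ a = r • (y : ℍ) := by
    intro y hy
    let e : Fin 4 → 𝓗 := ![1, mk 0 1 0 0, mk 0 0 1 0, mk (-1) (-1) (-1) 2]
    let w : 𝓗 := ∑ i, (⟨_, h (e i)⟩ : 𝓗) * y * star (e i)
    refine key (k * (4 * (b * y).re)) w (by positivity) ?_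
    -- Summing (a e b) y ē over e = 1, i, j, k gives 4 Re(by) a, a real multiple of a; some y makes
    -- Re(by) nonzero because b ≠ 0.
    have hsum4 : ∀ z : ℍ, (∑ i, (e i : ℍ) * z * star (e i : ℍ)) = ((4 * z.re : ℝ) : ℍ) := by
      intro z
      rw [Fin.sum_univ_four]
      ext <;> simp [e] <;> ring
    have : (w : ℍ) = k * a * ∑ i, (e i : ℍ) * (b * y) * star (e i : ℍ) := by
      rw [Finset.mul_sum]
      simp only [w]
      push_cast
      refine Finset.sum_congr rfl fun i _ => ?_
      rw [coe_star]; simp only [mul_assoc]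
    have hk' : (k : ℍ) * a = (k : ℝ) • a := by rw [← coe_mul_eq_smul]; rfl
    rw [this, hsum4, mul_coe_eq_smul, hk', smul_smul, mul_comm (k : ℝ)]
  by_contra hcon
  have h' : ∀ y : 𝓗, (b * y).re = 0 := fun y => by
    by_contra hy; exact hcon (hsum y hy)
  apply hb
  have e0 := h' 1
  have e1 := h' (mk 0 1 0 0)
  have e2 := h' (mk 0 0 1 0)
  have e3 := h' (mk (-1) (-1) (-1) 2)
  simp at e0 e1 e2 e3
  ext <;> simp [e0, e1, e2, e3]

theorem exists_smul_mem_right {a b : ℍ} (ha : a ≠ 0) {k : ℕ} (hk : k ≠ 0)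
    (h : ∀ x : 𝓗, (k : ℍ) * (a * x * b) ∈ hurwitzOrder) :
    ∃ (r : ℝ) (y : 𝓗), r ≠ 0 ∧ star b = r • (y : ℍ) := by
  refine exists_smul_mem_left (star_ne_zero.2 ha) hk fun x => ?_
  have h1 := (star (⟨_, h (star x)⟩ : 𝓗)).2
  rw [coe_star] at h1
  simp only [star_mul, coe_star, star_star] at h1
  have h2 : star (k : ℍ) = k := _root_.star_natCast k
  rw [h2] at h1
  rw [Nat.cast_comm, mul_assoc, mul_assoc]
  rw [mul_assoc, mul_assoc] at h1
  exact h1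

end HurwitzInt

theorem Quaternion.eq_coe_re_of_forall_commute {u : ℍ} (h : ∀ x : ℍ, u * x = x * u) :
    u = (u.re : ℍ) := by
  have h1 := h (hurwitzCoord 0 1 0 0)
  have h2 := h (hurwitzCoord 0 0 1 0)
  have e1 := congrArg (fun x : ℍ => x.imK) h1
  have e2 := congrArg (fun x : ℍ => x.imJ) h1
  have e3 := congrArg (fun x : ℍ => x.imK) h2
  simp at e1 e2 e3
  apply Quaternion.ext <;> simp <;> linarith

namespace HurwitzInt

/-- An odd number times 2 is not a square, so the exponents of 1+i in the two factors agree. -/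
theorem twist_eq_of_isSquare {m n : ℕ} (hm : Odd m) (hn : Odd n) {ε ε' : Bool} {z : ℕ}
    (h : (m * nrm (twist ε)) * (n * nrm (twist ε')) = z ^ 2) : ε = ε' := by
  have key : ∀ k : ℕ, Odd k → k * 2 ≠ z ^ 2 := by
    intro k hk h
    have : Even (z ^ 2) := by rw [← h]; simp
    obtain ⟨w, rfl⟩ := (Nat.even_pow' two_ne_zero).1 this
    have : k = 2 * w ^ 2 := by nlinarith
    exact Nat.not_even_iff_odd.2 hk (by rw [this]; simp)
  have hmn := hm.mul hn
  rw [nrm_twist, nrm_twist] at h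
  cases ε <;> cases ε' <;> simp only [cond_true, cond_false] at h ⊢
  · exact absurd (by rw [← h]; ring) (key _ hmn)
  · exact absurd (by rw [← h]; ring) (key _ hmn)

theorem exists_int_smul_eq {x y : 𝓗} {r : ℝ} (h : (x : ℍ) = r • (y : ℍ)) :
    ∃ z : ℤ, r * nrm y = z ∧ (nrm y : 𝓗) * x = z * y := by
  have h1 : ((x * star y : 𝓗) : ℍ) = ((r * nrm y : ℝ) : ℍ) := by
    rw [Subring.coe_mul, coe_star, h, smul_mul_assoc, self_mul_star, ← coe_nrm, ← coe_mul_eq_smul,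
      ← Quaternion.coe_mul]
  obtain ⟨z, hz⟩ := exists_int_eq_of_im_eq_zero h1
  refine ⟨z, hz, coe_inj.1 ?_⟩
  have h2 : ((z : ℝ) : ℍ) = (z : ℍ) := rfl
  have h3 : ((nrm y : ℝ) : ℍ) = (nrm y : ℍ) := rfl
  push_cast
  rw [h, ← h2, ← hz, ← h3, coe_mul_eq_smul, coe_mul_eq_smul, smul_smul, mul_comm]

/-- Clearing the real factor with the norm gives an integer relation Nx = zy. Comparing norms forces
equal twists; after these cancel, primitivity on both sides forces N = |z|, leaving a sign, which is
that of r. -/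
theorem eq_or_eq_neg_of_smul {q q' : 𝓗} (hq : Prim q) (hq' : Prim q') (hqo : Odd (nrm q))
    (hqo' : Odd (nrm q')) {ε ε' : Bool} {r : ℝ}
    (h : ((q * twist ε : 𝓗) : ℍ) = r • ((q' * twist ε' : 𝓗) : ℍ)) :
    ε = ε' ∧ ((0 < r ∧ q = q') ∨ (r < 0 ∧ q = -q')) := by
  obtain ⟨z, hz, h1⟩ := exists_int_smul_eq h
  set N := nrm (q' * twist ε') with hN
  have hN0 : N ≠ 0 := by
    rw [hN, Ne, nrm_eq_zero]; exact mul_ne_zero hq'.ne_zero (twist_ne_zero _)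
  have hNpos : (0 : ℝ) < N := by positivity
  have hz0 : z ≠ 0 := by
    rintro rfl
    rw [Int.cast_zero, zero_mul] at h1
    rcases mul_eq_zero.1 h1 with h | h
    · exact hN0 (by exact_mod_cast h)
    · exact mul_ne_zero hq.ne_zero (twist_ne_zero _) h
  have hzabs : ∃ σ : 𝓗, (z : 𝓗) = z.natAbs * σ ∧ ((0 < z ∧ σ = 1) ∨ (z < 0 ∧ σ = -1)) := by
    rcases lt_or_gt_of_ne hz0 with h | h
    · refine ⟨-1, ?_, Or.inr ⟨h, rfl⟩⟩
      have : z = -(z.natAbs : ℤ) := by omega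
      conv_lhs => rw [this]
      push_cast; simp
    · refine ⟨1, ?_, Or.inl ⟨h, rfl⟩⟩
      have : z = (z.natAbs : ℤ) := by omega
      conv_lhs => rw [this]
      push_cast; simp
  obtain ⟨σ, hσ, hsign⟩ := hzabs
  have hσ1 : nrm σ = 1 := by
    rcases hsign with ⟨-, rfl⟩ | ⟨-, rfl⟩
    · exact map_one _
    · rw [nrm_eq_one_iff]; exact isUnit_one.neg
  have hεε : ε = ε' := by
    have h2 := congrArg nrm h1
    rw [hσ] at h2
    simp only [map_mul, nrm_natCast, hσ1] at h2
    refine twist_eq_of_isSquare hqo hqo' (z := z.natAbs) ?_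
    refine Nat.eq_of_mul_eq_mul_left (Nat.pos_of_ne_zero hN0) ?_
    have hN' : N = nrm q' * nrm (twist ε') := by rw [hN, map_mul]
    rw [← hN'] at h2 ⊢
    nlinarith
  subst hεε
  have h3 : (N : 𝓗) * q = z.natAbs * (σ * q') := by
    refine mul_right_cancel₀ (twist_ne_zero ε) ?_
    rw [mul_assoc, h1, hσ]; simp only [mul_assoc]
  have hσq : Prim (σ * q') := by
    rcases hsign with ⟨-, rfl⟩ | ⟨-, rfl⟩
    · rwa [one_mul]
    · rw [neg_one_mul]; exact fun k hk => hq' k ((dvd_neg (a := (k : 𝓗))).1 hk)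
  have h4 : N = z.natAbs := Nat.dvd_antisymm
    (hσq.dvd_of_dvd_mul ⟨q, h3.symm⟩) (hq.dvd_of_dvd_mul ⟨_, h3⟩)
  have h5 : q = σ * q' := by
    rw [h4] at h3
    exact mul_left_cancel₀ (by exact_mod_cast h4 ▸ hN0) h3
  refine ⟨rfl, ?_⟩
  rcases hsign with ⟨hz', rfl⟩ | ⟨hz', rfl⟩
  · left
    refine ⟨?_, by rw [h5, one_mul]⟩
    have : 0 < r * N := by rw [hz]; exact_mod_cast hz'
    exact pos_of_mul_pos_left this hNpos.le
  · right
    refine ⟨?_, by rw [h5, neg_one_mul]⟩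
    have : r * N < 0 := by rw [hz]; exact_mod_cast hz'
    by_contra hr
    exact absurd this (not_lt.2 (mul_nonneg (not_lt.1 hr) hNpos.le))

/-- Equality of the two maps rewrites as ux = xv for all x, with u = Q'⁻¹Q. Setting x = 1 gives u =
v, so u is central and therefore real: Q is a real multiple of Q' and P of P', by factors of the
same sign. -/
theorem rotOf_eq_iff {q p q' p' : 𝓗} (hq : Prim q) (hp : Prim p) (hq' : Prim q') (hp' : Prim p')
    (hqo : Odd (nrm q)) (hpo : Odd (nrm p)) (hqo' : Odd (nrm q')) (hpo' : Odd (nrm p'))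
    {ε ε' : Bool} : rotOf q p ε = rotOf q' p' ε' ↔
      ε = ε' ∧ ((q = q' ∧ p = p') ∨ (q = -q' ∧ p = -p')) := by
  constructor
  · intro h
    set Q : ℍ := ((q * twist ε : 𝓗) : ℍ) with hQ
    set P : ℍ := ((p * twist ε : 𝓗) : ℍ) with hP
    set Q' : ℍ := ((q' * twist ε' : 𝓗) : ℍ) with hQ'
    set P' : ℍ := ((p' * twist ε' : 𝓗) : ℍ) with hP'
    have hQ0 : Q ≠ 0 := coe_ne_zero (mul_ne_zero hq.ne_zero (twist_ne_zero _))
    have hP0 : P ≠ 0 := coe_ne_zero (mul_ne_zero hp.ne_zero (twist_ne_zero _))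
    have hQ0' : Q' ≠ 0 := coe_ne_zero (mul_ne_zero hq'.ne_zero (twist_ne_zero _))
    have hP0' : P' ≠ 0 := coe_ne_zero (mul_ne_zero hp'.ne_zero (twist_ne_zero _))
    have hsP : star P ≠ 0 := star_ne_zero.2 hP0
    set s := (‖Q‖ * ‖star P‖)⁻¹ with hs
    set s' := (‖Q'‖ * ‖star P'‖)⁻¹ with hs'
    have hspos : 0 < s := by
      have := norm_pos_iff.2 hQ0
      have := norm_pos_iff.2 hsP
      positivity
    have hspos' : 0 < s' := by
      have := norm_pos_iff.2 hQ0'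
      have := norm_pos_iff.2 (star_ne_zero.2 hP0')
      positivity
    have hall : ∀ x, s • (Q * x * star P) = s' • (Q' * x * star P') := by
      intro x
      have := congrArg (fun T : ℍ ≃ₗᵢ[ℝ] ℍ => T x) h
      simp only [rotOf_apply hq.ne_zero hp.ne_zero, rotOf_apply hq'.ne_zero hp'.ne_zero] at this
      exact this
    set u := Q'⁻¹ * Q with hu
    set v := (s⁻¹ * s') • (star P' * (star P)⁻¹) with hv
    have huv : ∀ x, u * x = x * v := by
      intro x
      have h1 := congrArg (fun t => s⁻¹ • (Q'⁻¹ * t * (star P)⁻¹)) (hall x)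
      simp only [mul_smul_comm, smul_mul_assoc, smul_smul, inv_mul_cancel₀ hspos.ne', one_smul] at h1
      rw [hv, mul_smul_comm]
      rw [show Q'⁻¹ * (Q * x * star P) * (star P)⁻¹ = Q'⁻¹ * Q * x by
        rw [← mul_assoc, mul_assoc _ (star P), mul_inv_cancel₀ hsP, mul_one, mul_assoc],
        show Q'⁻¹ * (Q' * x * star P') * (star P)⁻¹ = x * (star P' * (star P)⁻¹) by
        rw [mul_assoc Q', inv_mul_cancel_left₀ hQ0', mul_assoc]] at h1
      exact h1
    have huv1 : u = v := by simpa using huv 1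
    rw [← huv1] at huv
    have hur := eq_coe_re_of_forall_commute huv
    set r := u.re with hr
    have hQr : Q = r • Q' := by
      rw [← mul_coe_eq_smul, ← hur, hu, mul_inv_cancel_left₀ hQ0']
    have hr0 : r ≠ 0 := by rintro h0; rw [h0, zero_smul] at hQr; exact hQ0 hQr
    have hPr : P = (s⁻¹ * s' / r) • P' := by
      have h1 : (r : ℍ) = (s⁻¹ * s') • (star P' * (star P)⁻¹) := by rw [← hur, huv1]
      have h2 := congrArg (fun t => t * star P) h1
      simp only [smul_mul_assoc, inv_mul_cancel_right₀ hsP] at h2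
      rw [coe_mul_eq_smul] at h2
      have h3 := congrArg star h2
      have hstar : ∀ (r : ℝ) (x : ℍ), star (r • star x) = r • x := fun r x => by ext <;> simp
      rw [hstar, hstar] at h3
      rw [div_eq_inv_mul, mul_smul, ← h3, smul_smul, inv_mul_cancel₀ hr0, one_smul]
    obtain ⟨he, h1⟩ := eq_or_eq_neg_of_smul hq hq' hqo hqo' hQr
    obtain ⟨-, h2⟩ := eq_or_eq_neg_of_smul hp hp' hpo hpo' hPr
    refine ⟨he, ?_⟩
    rcases h1 with ⟨hr1, h1⟩ | ⟨hr1, h1⟩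
    · rcases h2 with ⟨-, h2⟩ | ⟨hr2, -⟩
      · exact Or.inl ⟨h1, h2⟩
      · exact absurd hr2 (not_lt.2 (by positivity))
    · rcases h2 with ⟨hr2, -⟩ | ⟨-, h2⟩
      · exact absurd hr2 (not_lt.2 (div_nonpos_of_nonneg_of_nonpos (by positivity) hr1.le))
      · exact Or.inr ⟨h1, h2⟩
  · rintro ⟨rfl, ⟨rfl, rfl⟩ | ⟨rfl, rfl⟩⟩
    · rfl
    · ext1 x
      have hq0 := hq'.ne_zero
      have hp0 := hp'.ne_zero
      rw [rotOf_apply (neg_ne_zero.2 hq0) (neg_ne_zero.2 hp0), rotOf_apply hq0 hp0]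
      simp

/-- Coincidence isometries `x ↦ a * x * b` come from pairs of primitive Hurwitz integers. -/
theorem exists_eq_rotOf {T : ℍ ≃ₗᵢ[ℝ] ℍ} {a b : ℍ} (ha : ‖a‖ = 1) (hb : ‖b‖ = 1)
    (hT : ∀ x, T x = a * x * b) (hidx : (integralPart T).index ≠ 0) :
    ∃ (q p : 𝓗) (ε : Bool) (c : ℕ), Prim q ∧ Prim p ∧ Odd (nrm q) ∧ Odd (nrm p) ∧
      nrm q * nrm p = c ^ 2 ∧ T = rotOf q p ε := by
  set k := (integralPart T).index with hk
  have ha0 : a ≠ 0 := by rintro rfl; simp at ha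
  have hb0 : b ≠ 0 := by rintro rfl; simp at hb
  have hTs : ∀ x, T.symm x = star a * x * star b := by
    intro x
    rw [LinearIsometryEquiv.symm_apply_eq, hT]
    have : a * (star a * x * star b) * b = (a * star a) * x * (star b * b) := by
      simp only [mul_assoc]
    rw [this, self_mul_star, star_mul_self, normSq_eq_norm_mul_self, normSq_eq_norm_mul_self, ha, hb]
    simp
  have hint : ∀ x : 𝓗, (k : ℍ) * (star a * x * star b) ∈ hurwitzOrder := by
    intro x
    have h1 := AddSubgroup.nsmul_index_mem (integralPart T) x
    rw [← hk, mem_integralPart, hTs] at h1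
    have h2 : ((k • x : 𝓗) : ℍ) = k * (x : ℍ) := by rw [nsmul_eq_mul]; rfl
    rw [h2, ← mul_assoc, ← Nat.cast_comm, mul_assoc (k : ℍ), mul_assoc (k : ℍ)] at h1
    exact h1
  obtain ⟨r1, y1, hr1, h1⟩ := exists_smul_mem_left (star_ne_zero.2 hb0) hidx hint
  obtain ⟨r2, y2, hr2, h2⟩ := exists_smul_mem_right (star_ne_zero.2 ha0) hidx hint
  have hstar : ∀ (r : ℝ) (x : ℍ), star (r • x) = r • star x := fun r x => by ext <;> simp
  have h1' : a = r1 • ((star y1 : 𝓗) : ℍ) := by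
    rw [← star_star a, h1, hstar, coe_star]
  have h2' : star b = r2 • ((star y2 : 𝓗) : ℍ) := by
    rw [← star_star b, h2, hstar, coe_star]
  have hform : ∀ {w : ℍ} {r : ℝ} {x : 𝓗}, w ≠ 0 → r ≠ 0 → w = r • (x : ℍ) →
      ∃ (q : 𝓗) (ε : Bool) (α : ℝ), α ≠ 0 ∧ Prim q ∧ Odd (nrm q) ∧
        w = α • ((q * twist ε : 𝓗) : ℍ) := by
    intro w r x hw hr h
    have hx : x ≠ 0 := by rintro rfl; exact hw (by rw [h]; simp)
    obtain ⟨n, q, ε, hn, hq, hqo, hxq⟩ := exists_eq_natCast_mul_prim_mul_twist x hx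
    refine ⟨q, ε, r * n, by positivity, hq, hqo, ?_⟩
    rw [h, hxq, mul_smul]
    congr 1
    rw [← coe_mul_eq_smul]; rfl
  obtain ⟨q, ε, α, hα, hq, hqo, hQ⟩ := hform ha0 hr1 h1'
  obtain ⟨p, ε', β, hβ, hp, hpo, hP⟩ := hform (star_ne_zero.2 hb0) hr2 h2'
  have hb' : b = β • star ((p * twist ε' : 𝓗) : ℍ) := by rw [← hstar, ← hP, star_star]
  set Q := q * twist ε with hQdef
  set P := p * twist ε' with hPdef
  have hQ0 : Q ≠ 0 := mul_ne_zero hq.ne_zero (twist_ne_zero _)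
  have hP0 : P ≠ 0 := mul_ne_zero hp.ne_zero (twist_ne_zero _)
  have hnorm : |α * β| * (‖(Q : ℍ)‖ * ‖star (P : ℍ)‖) = 1 := by
    have e1 : |α| * ‖(Q : ℍ)‖ = 1 := by rw [← ha, hQ, norm_smul, Real.norm_eq_abs]
    have e2 : |β| * ‖star (P : ℍ)‖ = 1 := by rw [← hb, hb', norm_smul, Real.norm_eq_abs]
    rw [abs_mul]; calc _ = (|α| * ‖(Q : ℍ)‖) * (|β| * ‖star (P : ℍ)‖) := by ring
      _ = 1 := by rw [e1, e2, one_mul]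
  -- The Hurwitz integer k ā b̄, obtained from x = 1, is a real multiple of Q̄P. Projecting onto Q̄P
  -- gives an integer z with z² = k² N(Q)N(P), so N(Q)N(P) is a square.
  have hM : ∃ m : ℕ, nrm Q * nrm P = m ^ 2 := by
    have hk1 : (⟨_, hint 1⟩ : 𝓗) = (k : ℝ) • (((α * β) • ((star Q * P : 𝓗) : ℍ)) : ℍ) := by
      change (k : ℍ) * (star a * ((1 : 𝓗) : ℍ) * star b) = _
      rw [← coe_mul_eq_smul]
      congr 1
      rw [hP, hQ, hstar]
      push_cast
      rw [mul_one, mul_smul_comm, smul_mul_assoc, smul_smul, mul_comm β α]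
      rfl
    rw [smul_smul] at hk1
    obtain ⟨z, hz, -⟩ := exists_int_smul_eq hk1
    have hsq : (α * β) ^ 2 * (nrm Q * nrm P) = 1 := by
      rw [← norm_sq, ← norm_sq, ← sq_abs, ← mul_pow, ← mul_pow, ← Quaternion.norm_star (P : ℍ), hnorm, one_pow]
    rw [map_mul, nrm_star] at hz
    have hz2 : z ^ 2 = (k ^ 2 * (nrm Q * nrm P) : ℕ) := by
      have : (z : ℝ) ^ 2 = k ^ 2 * (nrm Q * nrm P) := by
        rw [← hz]; push_cast
        linear_combination (k : ℝ) ^ 2 * (nrm Q * nrm P) * hsq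
      exact_mod_cast this
    have hz3 : z.natAbs ^ 2 = k ^ 2 * (nrm Q * nrm P) := by
      zify; rw [sq_abs, hz2]; push_cast; ring
    have hkz : k ∣ z.natAbs := (Nat.pow_dvd_pow_iff two_ne_zero).1 ⟨_, hz3⟩
    obtain ⟨m, hm⟩ := hkz
    refine ⟨m, ?_⟩
    rw [hm, mul_pow] at hz3
    exact (Nat.eq_of_mul_eq_mul_left (by positivity) hz3).symm
  obtain ⟨m, hm⟩ := hM
  have hεε : ε = ε' := by
    refine twist_eq_of_isSquare hqo hpo (z := m) ?_
    rw [← map_mul, ← map_mul]; exact hm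
  subst hεε
  obtain ⟨c, hc⟩ : ∃ c, nrm q * nrm p = c ^ 2 := by
    rw [hQdef, hPdef, map_mul, map_mul] at hm
    have hd : nrm (twist ε) ∣ m := (Nat.pow_dvd_pow_iff two_ne_zero).1 ⟨nrm q * nrm p, by rw [← hm]; ring⟩
    obtain ⟨c, rfl⟩ := hd
    have hN : nrm (twist ε) ≠ 0 := by simpa using twist_ne_zero ε
    refine ⟨c, Nat.eq_of_mul_eq_mul_left (show 0 < nrm (twist ε) ^ 2 by positivity) ?_⟩
    rw [mul_pow] at hm; rw [← hm]; ring
  have hnorm' : |α * β| = (‖(Q : ℍ)‖ * ‖star (P : ℍ)‖)⁻¹ := eq_inv_of_mul_eq_one_left hnorm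
  have hTx : ∀ x, T x = (α * β) • ((Q : ℍ) * x * star (P : ℍ)) := by
    intro x
    rw [hT, hb', mul_smul_comm, mul_comm α β, mul_smul]
    congr 1
    rw [hQ]; simp only [smul_mul_assoc]
  rcases le_or_gt 0 (α * β) with hpos | hneg
  · refine ⟨q, p, ε, c, hq, hp, hqo, hpo, hc, ?_⟩
    ext1 x
    rw [hTx, rotOf_apply hq.ne_zero hp.ne_zero, ← abs_of_nonneg hpos, hnorm']
  -- The normalised rotation has a positive scalar, so a negative αβ is absorbed by replacing q with
  -- -q.
  · have hN : nrm (-q) = nrm q := by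
      rw [← neg_one_mul, map_mul, nrm_eq_one_iff.2 isUnit_one.neg, one_mul]
    refine ⟨-q, p, ε, c, fun k hk => hq k ((dvd_neg (a := (k : 𝓗))).1 hk), hp, by rwa [hN], hpo,
      by rwa [hN], ?_⟩
    ext1 x
    rw [hTx, rotOf_apply (neg_ne_zero.2 hq.ne_zero) hp.ne_zero]
    have e1 : ((-q * twist ε : 𝓗) : ℍ) = -(Q : ℍ) := by rw [neg_mul]; rfl
    rw [e1, norm_neg, ← hPdef, ← hnorm', abs_of_neg hneg, neg_mul, neg_mul, smul_neg, neg_smul, neg_neg]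

end HurwitzInt

/-! ### Counting coincidence rotations -/

/-- The pairs `(k, l)` of coprime numbers with `k² l² ∣ n`. -/
def coprimeSquarePairs (n : ℕ) : Finset (ℕ × ℕ) :=
  (n.divisors ×ˢ n.divisors).filter fun x => x.1.Coprime x.2 ∧ x.1 ^ 2 * x.2 ^ 2 ∣ n

theorem mem_coprimeSquarePairs {n k l : ℕ} : (k, l) ∈ coprimeSquarePairs n ↔
    n ≠ 0 ∧ k.Coprime l ∧ ∃ g, n = g * k ^ 2 * l ^ 2 := by
  simp only [coprimeSquarePairs, Finset.mem_filter, Finset.mem_product, Nat.mem_divisors]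
  constructor
  · rintro ⟨⟨⟨-, hn⟩, -⟩, hc, g, hg⟩
    exact ⟨hn, hc, g, by rw [hg]; ring⟩
  · rintro ⟨hn, hc, g, rfl⟩
    exact ⟨⟨⟨⟨g * k * l ^ 2, by ring⟩, hn⟩, ⟨g * k ^ 2 * l, by ring⟩, hn⟩, hc, g, by ring⟩

/-- Take g = gcd(m, n); the cofactors are coprime with square product, so each is a square. -/
theorem exists_of_mul_eq_sq {m n c : ℕ} (hm : m ≠ 0) (h : m * n = c ^ 2) :
    ∃ g k l : ℕ, k.Coprime l ∧ m = g * k ^ 2 ∧ n = g * l ^ 2 ∧ c = g * k * l := by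
  obtain ⟨g, m', n', hg, hcop, rfl, rfl⟩ := Nat.exists_coprime' (m := m) (n := n)
    (Nat.gcd_pos_of_pos_left n (Nat.pos_of_ne_zero hm))
  have hgc : g ∣ c := (Nat.pow_dvd_pow_iff two_ne_zero).1 ⟨m' * n', by rw [← h]; ring⟩
  obtain ⟨d, rfl⟩ := hgc
  have hd : m' * n' = d ^ 2 := by
    refine Nat.eq_of_mul_eq_mul_left (show 0 < g ^ 2 by positivity) ?_
    rw [← mul_pow, ← h]; ring
  obtain ⟨k, rfl⟩ := exists_eq_pow_of_mul_eq_pow (Nat.isUnit_iff.2 hcop) hd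
  obtain ⟨l, rfl⟩ := exists_eq_pow_of_mul_eq_pow (Nat.isUnit_iff.2 hcop.symm) (by rw [mul_comm]; exact hd)
  refine ⟨g, k, l, ?_, by ring, by ring, ?_⟩
  · exact (Nat.coprime_pow_left_iff two_pos _ _).1 ((Nat.coprime_pow_right_iff two_pos _ _).1 hcop)
  · have : d = k * l := by
      rw [← mul_pow] at hd; exact (Nat.pow_left_injective (n := 2) (by norm_num) hd).symm
    rw [this, mul_assoc]

namespace HurwitzInt

/-- The primitive Hurwitz integers of odd norm `m`. -/
def primOfNrm (m : ℕ) : Set 𝓗 := {q | Odd (nrm q) ∧ Prim q ∧ nrm q = m}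

theorem finite_primOfNrm (m : ℕ) : (primOfNrm m).Finite :=
  (finite_nrm_eq m).subset fun _ hq => hq.2.2

theorem ncard_primOfNrm (m : ℕ) : (primOfNrm m).ncard = 24 * psi m := by
  by_cases hm : Odd m
  · rw [← ncard_prim_nrm_eq hm]
    congr 1
    ext q
    exact ⟨fun h => h.2, fun h => ⟨h.2 ▸ hm, h⟩⟩
  · have : primOfNrm m = ∅ := by
      ext q
      simp only [Set.mem_empty_iff_false, iff_false]
      rintro ⟨h, -, rfl⟩
      exact hm h
    rw [this, psi_of_even (Nat.not_odd_iff_even.1 hm), Set.ncard_empty, mul_zero]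

/-- The parameters of the coincidence rotations of index `n`. -/
def rotParams (n : ℕ) : Set (𝓗 × 𝓗 × Bool) :=
  {t | ∃ g k l : ℕ, k.Coprime l ∧ n = g * k ^ 2 * l ^ 2 ∧ t.1 ∈ primOfNrm (g * k ^ 2) ∧
    t.2.1 ∈ primOfNrm (g * l ^ 2)}

/-- The rotation of the quaternions with the given parameters. -/
noncomputable def rotOfParams (t : 𝓗 × 𝓗 × Bool) : ℍ ≃ₗᵢ[ℝ] ℍ := rotOf t.1 t.2.1 t.2.2

theorem ne_zero_of_primOfNrm {q : 𝓗} {m : ℕ} (h : q ∈ primOfNrm m) : m ≠ 0 := by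
  rintro rfl
  exact h.2.1.ne_zero (nrm_eq_zero.1 h.2.2)

theorem index_integralPart_rotOf {q p : 𝓗} {g k l : ℕ} (hkl : k.Coprime l)
    (hq : q ∈ primOfNrm (g * k ^ 2)) (hp : p ∈ primOfNrm (g * l ^ 2)) (ε : Bool) :
    integralPart (rotOf q p ε) = cslKernel (g * k * l) q p ∧
      (integralPart (rotOf q p ε)).index = g * k ^ 2 * l ^ 2 := by
  have h : integralPart (rotOf q p ε) = cslKernel (g * k * l) q p :=
    integralPart_rotOf hq.2.1.ne_zero hp.2.1.ne_zero ε (by rw [hq.2.2, hp.2.2]; ring)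
  refine ⟨h, ?_⟩
  rw [h, index_cslKernel hq.2.1 hp.2.1 hq.1 hp.1 hkl hq.2.2 hp.2.2]

theorem exists_params {T : ℍ ≃ₗᵢ[ℝ] ℍ} {a b : ℍ} (ha : ‖a‖ = 1) (hb : ‖b‖ = 1)
    (hT : ∀ x, T x = a * x * b) (hidx : (integralPart T).index ≠ 0) :
    ∃ (q p : 𝓗) (ε : Bool) (g k l : ℕ), k.Coprime l ∧ q ∈ primOfNrm (g * k ^ 2) ∧
      p ∈ primOfNrm (g * l ^ 2) ∧ T = rotOf q p ε := by
  obtain ⟨q, p, ε, c, hq, hp, hqo, hpo, hc, hTr⟩ := exists_eq_rotOf ha hb hT hidx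
  obtain ⟨g, k, l, hkl, h1, h2, -⟩ := exists_of_mul_eq_sq (by simpa using hq.ne_zero) hc
  exact ⟨q, p, ε, g, k, l, hkl, ⟨hqo, hq, h1⟩, ⟨hpo, hp, h2⟩, hTr⟩

theorem mem_coincidenceRotationsOfIndex {R : E4 ≃ₗᵢ[ℝ] E4} {n : ℕ} :
    R ∈ coincidenceRotationsOfIndex latticeD4Star n ↔
      quatConj R ∈ rotOfParams '' rotParams n := by
  simp only [coincidenceRotationsOfIndex, coincidenceRotations, coincidenceIsometries,
    Set.mem_ofPred_eq, coincidenceIndex_eq, ← det_quatConj]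
  constructor
  · rintro ⟨⟨hidx, hdet⟩, hn⟩
    obtain ⟨a, b, ha, hb, h | h⟩ := exists_isometry_eq (quatConj R)
    · obtain ⟨q, p, ε, g, k, l, hkl, hq, hp, hT⟩ := exists_params ha hb h hidx
      refine ⟨(q, p, ε), ⟨g, k, l, hkl, ?_, hq, hp⟩, hT.symm⟩
      rw [← hn, hT, (index_integralPart_rotOf hkl hq hp ε).2]
    -- The form x ↦ a x̄ b has determinant -1.
    · rw [det_of_forall_eq_mul_star h, normSq_eq_norm_mul_self, normSq_eq_norm_mul_self, ha, hb] at hdet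
      norm_num at hdet
  · rintro ⟨⟨q, p, ε⟩, ⟨g, k, l, hkl, rfl, hq, hp⟩, hT⟩
    simp only [rotOfParams] at hT
    rw [← hT, (index_integralPart_rotOf hkl hq hp ε).2]
    refine ⟨⟨?_, ?_⟩, rfl⟩
    · have h1 := ne_zero_of_primOfNrm hq
      have h2 := ne_zero_of_primOfNrm hp
      exact mul_ne_zero h1 (right_ne_zero_of_mul h2)
    · set Q : ℍ := ((q * twist ε : 𝓗) : ℍ) with hQ
      set P : ℍ := star ((p * twist ε : 𝓗) : ℍ) with hP
      have hQ0 : ‖Q‖ ≠ 0 := norm_ne_zero_iff.2 (coe_ne_zero (mul_ne_zero hq.2.1.ne_zero (twist_ne_zero ε)))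
      have hP0 : ‖P‖ ≠ 0 := norm_ne_zero_iff.2
        (star_ne_zero.2 (coe_ne_zero (mul_ne_zero hp.2.1.ne_zero (twist_ne_zero ε))))
      rw [det_of_forall_eq_mul (a := (‖Q‖ * ‖P‖)⁻¹ • Q) (b := P) (fun x => by
        rw [rotOf_apply hq.2.1.ne_zero hp.2.1.ne_zero, smul_mul_assoc, smul_mul_assoc]),
        normSq_eq_norm_mul_self, normSq_eq_norm_mul_self, norm_smul, norm_inv, norm_mul, norm_norm,
        norm_norm]
      field_simp

theorem rotParams_eq (n : ℕ) : rotParams n = ⋃ x ∈ (coprimeSquarePairs n : Set (ℕ × ℕ)),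
    primOfNrm (n / x.2 ^ 2) ×ˢ primOfNrm (n / x.1 ^ 2) ×ˢ (Set.univ : Set Bool) := by
  ext ⟨q, p, ε⟩
  simp only [rotParams, Set.mem_ofPred_eq, Set.mem_iUnion, Set.mem_prod, Set.mem_univ, and_true,
    Finset.mem_coe, exists_prop, Prod.exists]
  constructor
  · rintro ⟨g, k, l, hkl, rfl, hq, hp⟩
    have h1 := ne_zero_of_primOfNrm hq
    have h2 := ne_zero_of_primOfNrm hp
    have hk := right_ne_zero_of_mul h1
    have hl := right_ne_zero_of_mul h2
    refine ⟨k, l, mem_coprimeSquarePairs.2 ⟨mul_ne_zero h1 hl, hkl, g, rfl⟩, ?_, ?_⟩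
    · rwa [Nat.mul_div_cancel _ (Nat.pos_of_ne_zero hl)]
    · rwa [mul_right_comm, Nat.mul_div_cancel _ (Nat.pos_of_ne_zero hk)]
  · rintro ⟨k, l, hx, hq, hp⟩
    obtain ⟨hn, hkl, g, rfl⟩ := mem_coprimeSquarePairs.1 hx
    have hl := right_ne_zero_of_mul hn
    have hk := right_ne_zero_of_mul (left_ne_zero_of_mul hn)
    rw [Nat.mul_div_cancel _ (Nat.pos_of_ne_zero hl)] at hq
    rw [mul_right_comm, Nat.mul_div_cancel _ (Nat.pos_of_ne_zero hk)] at hp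
    exact ⟨g, k, l, hkl, rfl, hq, hp⟩

theorem finite_rotParams (n : ℕ) : (rotParams n).Finite := by
  rw [rotParams_eq]
  exact (Finset.finite_toSet _).biUnion fun x _ =>
    (finite_primOfNrm _).prod ((finite_primOfNrm _).prod Set.finite_univ)

/-- The weighted count of coincidence rotations in terms of the number of primitive ideals. -/
noncomputable def rotCount (n : ℕ) : ℕ :=
  ∑ x ∈ coprimeSquarePairs n, psi (n / x.2 ^ 2) * psi (n / x.1 ^ 2)

/-- The count of coincidence site lattices in terms of the number of primitive ideals. -/
noncomputable def cslCount (n : ℕ) : ℕ :=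
  ∑ x ∈ coprimeSquarePairs n, psi (n / (x.1 * x.2 ^ 2)) * psi (n / (x.1 ^ 2 * x.2))

/-- Each pair (k, l) contributes 24ψ · 24ψ · 2 triples. Different pairs give disjoint sets, since
for fixed n the norms n/l² and n/k² determine l and k. -/
theorem ncard_rotParams (n : ℕ) : (rotParams n).ncard = 2 * (576 * rotCount n) := by
  rw [rotParams_eq, Set.Finite.ncard_biUnion (Finset.finite_toSet _), finsum_mem_coe_finset, rotCount,
    Finset.mul_sum, Finset.mul_sum]
  · refine Finset.sum_congr rfl fun x _ => ?_
    rw [Set.ncard_prod, Set.ncard_prod, ncard_primOfNrm, ncard_primOfNrm, Set.ncard_univ,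
      Nat.card_eq_fintype_card, Fintype.card_bool]
    ring
  · exact fun x _ => (finite_primOfNrm _).prod ((finite_primOfNrm _).prod Set.finite_univ)
  · rintro ⟨k, l⟩ hx ⟨k', l'⟩ hx' hne
    refine Set.disjoint_left.2 ?_
    rintro ⟨q, p, ε⟩ ⟨hq, hp, -⟩ ⟨hq', hp', -⟩
    apply hne
    obtain ⟨hn, hkl, g, hg⟩ := mem_coprimeSquarePairs.1 hx
    obtain ⟨-, -, g', hg'⟩ := mem_coprimeSquarePairs.1 hx'
    have e1 : n / l ^ 2 = n / l' ^ 2 := hq.2.2.symm.trans hq'.2.2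
    have e2 : n / k ^ 2 = n / k' ^ 2 := hp.2.2.symm.trans hp'.2.2
    have key : ∀ {a b : ℕ}, a ^ 2 ∣ n → b ^ 2 ∣ n → n / a ^ 2 = n / b ^ 2 → a = b := by
      intro a b ha hb h
      have h1 := Nat.div_mul_cancel ha
      have h2 := Nat.div_mul_cancel hb
      rw [← h] at h2
      have h3 : n / a ^ 2 ≠ 0 := fun h0 => hn (by rw [← h1, h0, zero_mul])
      exact Nat.pow_left_injective (n := 2) (by norm_num)
        (Nat.eq_of_mul_eq_mul_left (Nat.pos_of_ne_zero h3) (h1.trans h2.symm))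
    rw [Prod.mk.injEq]
    exact ⟨key ⟨g * l ^ 2, by rw [hg]; ring⟩ ⟨g' * l' ^ 2, by rw [hg']; ring⟩ e2,
      key ⟨g * k ^ 2, by rw [hg]; ring⟩ ⟨g' * k' ^ 2, by rw [hg']; ring⟩ e1⟩

theorem Prim.neg {q : 𝓗} (h : Prim q) : Prim (-q) := fun k hk => h k ((dvd_neg (a := (k : 𝓗))).1 hk)

theorem nrm_neg (q : 𝓗) : nrm (-q) = nrm q := by
  rw [← neg_one_mul, map_mul, nrm_eq_one_iff.2 isUnit_one.neg, one_mul]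

theorem neg_mem_primOfNrm {q : 𝓗} {m : ℕ} (h : q ∈ primOfNrm m) : -q ∈ primOfNrm m :=
  ⟨by rw [nrm_neg]; exact h.1, h.2.1.neg, by rw [nrm_neg]; exact h.2.2⟩

/-- The map to rotations is exactly two-to-one, identifying (q, p, ε) with (-q, -p, ε); this cancels
the factor 2 from ε. -/
theorem ncard_image_rotParams (n : ℕ) :
    (rotOfParams '' rotParams n).ncard = 576 * rotCount n := by
  have h := Set.ncard_eq_mul_of_fibers rotOfParams (k := 2) (finite_rotParams n)
    ((finite_rotParams n).image _) (Set.mapsTo_image _ _) (by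
      rintro _ ⟨⟨q, p, ε⟩, ⟨g, k, l, hkl, hn, hq, hp⟩, rfl⟩
      have hne : ((q, p, ε) : 𝓗 × 𝓗 × Bool) ≠ (-q, -p, ε) := by
        intro h
        have h1 : q = -q := congrArg Prod.fst h
        have h2 : (2 : ℕ) * q = 0 := by push_cast; rw [two_mul]; nth_rw 1 [h1]; simp
        rcases mul_eq_zero.1 h2 with h3 | h3
        · exact absurd (Nat.cast_eq_zero.1 h3) two_ne_zero
        · exact hq.2.1.ne_zero h3
      rw [← Set.ncard_pair hne]
      congr 1
      ext ⟨q', p', ε'⟩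
      constructor
      · rintro ⟨⟨g', k', l', -, -, hq', hp'⟩, h⟩
        obtain ⟨h1, ⟨h2, h3⟩ | ⟨h2, h3⟩⟩ := (rotOf_eq_iff hq'.2.1 hp'.2.1 hq.2.1 hp.2.1 hq'.1 hp'.1
          hq.1 hp.1).1 h
        · exact Set.mem_insert_iff.2 (Or.inl (Prod.ext h2 (Prod.ext h3 h1)))
        · exact Set.mem_insert_iff.2 (Or.inr (Prod.ext h2 (Prod.ext h3 h1)))
      · rintro (h | h)
        · rw [h]; exact ⟨⟨g, k, l, hkl, hn, hq, hp⟩, rfl⟩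
        · rw [Set.mem_singleton_iff.1 h]
          have hq' := neg_mem_primOfNrm hq
          have hp' := neg_mem_primOfNrm hp
          exact ⟨⟨g, k, l, hkl, hn, hq', hp'⟩,
            (rotOf_eq_iff hq'.2.1 hp'.2.1 hq.2.1 hp.2.1 hq'.1 hp'.1 hq.1 hp.1).2
              ⟨rfl, Or.inr ⟨rfl, rfl⟩⟩⟩)
  rw [ncard_rotParams] at h
  omega

theorem coincidenceRotationsOfIndex_eq (n : ℕ) :
    coincidenceRotationsOfIndex latticeD4Star n = quatConj ⁻¹' (rotOfParams '' rotParams n) :=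
  Set.ext fun _ => mem_coincidenceRotationsOfIndex

theorem finite_coincidenceRotationsOfIndex (n : ℕ) :
    (coincidenceRotationsOfIndex latticeD4Star n).Finite := by
  rw [coincidenceRotationsOfIndex_eq]
  exact ((finite_rotParams n).image _).preimage quatConj_injective.injOn

theorem ncard_coincidenceRotationsOfIndex (n : ℕ) :
    (coincidenceRotationsOfIndex latticeD4Star n).ncard = 576 * rotCount n := by
  rw [← ncard_image_rotParams, coincidenceRotationsOfIndex_eq,
    ← Set.ncard_image_of_injective _ quatConj_injective,
    Set.image_preimage_eq _ quatConj_surjective]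

/-! ### Counting coincidence site lattices -/

theorem dvd_star_mul_iff_of_rightIdeal_eq {q q' : 𝓗} (hq : q ≠ 0)
    (h : rightIdeal q = rightIdeal q') (c : ℕ) (y : 𝓗) :
    (c : 𝓗) ∣ star q * y ↔ (c : 𝓗) ∣ star q' * y := by
  obtain ⟨u, hu, rfl⟩ := (rightIdeal_eq_iff hq).1 h
  rw [star_mul, mul_assoc]
  refine ⟨natCast_dvd_mul_left _, fun h => ?_⟩
  have := natCast_dvd_mul_left u h
  rwa [← mul_assoc, mul_star, hu, Nat.cast_one, one_mul] at this

/-- The additive groups of the coincidence site lattices with given reduced norms. -/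
def cslKernels (g k l : ℕ) : Set (AddSubgroup 𝓗) :=
  (fun t : 𝓗 × 𝓗 => cslKernel (g * k * l) t.1 t.2) ''
    (primOfNrm (g * k) ×ˢ primOfNrm (g * l))

/-- From norms gk², gl² one passes to the reduced divisors. Conversely, primitive elements of norms
gk, gl extend on the right to primitive ones of norms gk², gl², whose reductions generate the
original ideals. -/
theorem mem_cslKernels_iff {g k l : ℕ} (hkl : k.Coprime l) {K : AddSubgroup 𝓗} :
    K ∈ cslKernels g k l ↔ ∃ q p, q ∈ primOfNrm (g * k ^ 2) ∧ p ∈ primOfNrm (g * l ^ 2) ∧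
      K = cslKernel (g * k * l) q p := by
  constructor
  · rintro ⟨⟨q', p'⟩, ⟨hq', hp'⟩, rfl⟩
    simp only at hq' hp'
    have hk : Odd k := (Nat.odd_mul.1 (hq'.2.2 ▸ hq'.1)).2
    have hl : Odd l := (Nat.odd_mul.1 (hp'.2.2 ▸ hp'.1)).2
    obtain ⟨t, ht, htn⟩ := exists_prim_mul hk hq'.2.1
    obtain ⟨s, hs, hsn⟩ := exists_prim_mul hl hp'.2.1
    have hqn : nrm (q' * t) = g * k ^ 2 := by rw [map_mul, hq'.2.2, htn]; ring
    have hpn : nrm (p' * s) = g * l ^ 2 := by rw [map_mul, hp'.2.2, hsn]; ring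
    have hqo : Odd (nrm (q' * t)) := by rw [map_mul, htn]; exact hq'.1.mul hk
    have hpo : Odd (nrm (p' * s)) := by rw [map_mul, hsn]; exact hp'.1.mul hl
    refine ⟨q' * t, p' * s, ⟨hqo, ht, hqn⟩, ⟨hpo, hs, hpn⟩, ?_⟩
    obtain ⟨q'', p'', hq'', hp'', hqn', hpn', h1, h2, h3⟩ := exists_cslKernel_eq ht hs hkl hqn hpn
    rw [h3]
    refine cslKernel_congr (dvd_star_mul_iff_of_rightIdeal_eq hq'.2.1.ne_zero ?_ _)
      (dvd_star_mul_iff_of_rightIdeal_eq hp'.2.1.ne_zero ?_ _)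
    · rw [← sup_rightIdeal_natCast_eq ht hq'.2.2 (dvd_mul_right _ _),
        ← sup_rightIdeal_natCast_eq ht hqn' h1]
    · rw [← sup_rightIdeal_natCast_eq hs hp'.2.2 (dvd_mul_right _ _),
        ← sup_rightIdeal_natCast_eq hs hpn' h2]
  · rintro ⟨q, p, hq, hp, rfl⟩
    obtain ⟨q', p', hq', hp', hqn, hpn, h1, h2, h3⟩ :=
      exists_cslKernel_eq hq.2.1 hp.2.1 hkl hq.2.2 hp.2.2
    exact ⟨(q', p'), ⟨⟨hq.1.of_dvd_nat (map_dvd nrm h1), hq', hqn⟩,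
      ⟨hp.1.of_dvd_nat (map_dvd nrm h2), hp', hpn⟩⟩, h3.symm⟩

theorem finite_cslKernels (g k l : ℕ) : (cslKernels g k l).Finite :=
  ((finite_primOfNrm _).prod (finite_primOfNrm _)).image _

/-- `cslKernel_inj` recovers c, the norm and the ideal of the left factor; applied after conjugation
it does the same for the right factor. The norms gk, gl and c = gkl then give k and l. -/
theorem cslKernel_eq_cslKernel {g k l g' k' l' : ℕ} {q p q' p' : 𝓗} (hq : q ∈ primOfNrm (g * k))
    (hp : p ∈ primOfNrm (g * l)) (hq' : q' ∈ primOfNrm (g' * k')) (hp' : p' ∈ primOfNrm (g' * l'))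
    (h : cslKernel (g * k * l) q p = cslKernel (g' * k' * l') q' p') :
    k = k' ∧ l = l' ∧ rightIdeal q = rightIdeal q' ∧ rightIdeal p = rightIdeal p' := by
  have hgk := ne_zero_of_primOfNrm hq
  have hgl := ne_zero_of_primOfNrm hp
  have hl := right_ne_zero_of_mul hgl
  obtain ⟨hc, hn1, h1, h1'⟩ := cslKernel_inj hq.2.1 hq'.2.1 hp.2.1 hp'.2.1 hp.1 hp'.1
    (mul_ne_zero hgk hl) (by rw [hq.2.2]; exact dvd_mul_right _ _)
    (by rw [hq'.2.2]; exact dvd_mul_right _ _) h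
  have hstar : cslKernel (g * k * l) p q = cslKernel (g' * k' * l') p' q' := by
    ext x
    rw [← star_mem_cslKernel, h, star_mem_cslKernel]
  obtain ⟨-, hn2, h2, h2'⟩ := cslKernel_inj hp.2.1 hp'.2.1 hq.2.1 hq'.2.1 hq.1 hq'.1
    (mul_ne_zero hgk hl) (by rw [hp.2.2, mul_right_comm]; exact dvd_mul_right _ _)
    (by rw [hp'.2.2, mul_right_comm]; exact dvd_mul_right _ _) hstar
  rw [hq.2.2, hq'.2.2] at hn1
  rw [hp.2.2, hp'.2.2] at hn2
  refine ⟨?_, ?_, le_antisymm (rightIdeal_le.2 h1') (rightIdeal_le.2 h1),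
    le_antisymm (rightIdeal_le.2 h2') (rightIdeal_le.2 h2)⟩
  · rw [mul_right_comm, mul_right_comm g', ← hn2] at hc
    exact Nat.eq_of_mul_eq_mul_left (Nat.pos_of_ne_zero hgl) hc
  · rw [← hn1] at hc
    exact Nat.eq_of_mul_eq_mul_left (Nat.pos_of_ne_zero hgk) hc

/-- By uniqueness each fibre consists of the pairs (qu, pv) with units u, v, so 24² cancels. -/
theorem ncard_cslKernels (g k l : ℕ) : (cslKernels g k l).ncard = psi (g * k) * psi (g * l) := by
  have h := Set.ncard_eq_mul_of_fibers (fun t : 𝓗 × 𝓗 => cslKernel (g * k * l) t.1 t.2)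
    (k := 24 * 24) ((finite_primOfNrm (g * k)).prod (finite_primOfNrm (g * l)))
    (finite_cslKernels g k l) (Set.mapsTo_image _ _) (by
      rintro _ ⟨⟨q, p⟩, ⟨hq, hp⟩, rfl⟩
      simp only at hq hp
      rw [← ncard_nrm_eq_one, ← Set.ncard_prod]
      refine Eq.trans ?_ (Set.ncard_image_of_injective (f := Prod.map (q * ·) (p * ·)) _
        ((mulLeft_injective hq.2.1.ne_zero).prodMap (mulLeft_injective hp.2.1.ne_zero)))
      congr 1
      ext ⟨q', p'⟩
      constructor
      · rintro ⟨⟨hq', hp'⟩, h⟩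
        obtain ⟨-, -, h1, h2⟩ := cslKernel_eq_cslKernel hq' hp' hq hp h
        obtain ⟨u, hu, rfl⟩ := (rightIdeal_eq_iff hq.2.1.ne_zero).1 h1.symm
        obtain ⟨v, hv, rfl⟩ := (rightIdeal_eq_iff hp.2.1.ne_zero).1 h2.symm
        exact ⟨(u, v), ⟨hu, hv⟩, rfl⟩
      · rintro ⟨⟨u, v⟩, ⟨hu, hv⟩, h⟩
        simp only [Prod.map_apply, Prod.mk.injEq] at h
        obtain ⟨rfl, rfl⟩ := h
        have h1 : rightIdeal q = rightIdeal (q * u) := (rightIdeal_eq_iff hq.2.1.ne_zero).2 ⟨u, hu, rfl⟩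
        have h2 : rightIdeal p = rightIdeal (p * v) := (rightIdeal_eq_iff hp.2.1.ne_zero).2 ⟨v, hv, rfl⟩
        have e1 := nrm_of_rightIdeal_eq hq.2.1.ne_zero h1
        have e2 := nrm_of_rightIdeal_eq hp.2.1.ne_zero h2
        refine ⟨⟨⟨by rw [e1]; exact hq.1, prim_of_rightIdeal_eq hq.2.1 h1, by rw [e1]; exact hq.2.2⟩,
          ⟨by rw [e2]; exact hp.1, prim_of_rightIdeal_eq hp.2.1 h2, by rw [e2]; exact hp.2.2⟩⟩, ?_⟩
        exact (cslKernel_congr (dvd_star_mul_iff_of_rightIdeal_eq hq.2.1.ne_zero h1 _)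
          (dvd_star_mul_iff_of_rightIdeal_eq hp.2.1.ne_zero h2 _)).symm)
  rw [Set.ncard_prod, ncard_primOfNrm, ncard_primOfNrm] at h
  nlinarith

theorem cslsOfIndex_eq (n : ℕ) : cslsOfIndex latticeD4Star n = AddSubgroup.map emb ''
    ⋃ x ∈ (coprimeSquarePairs n : Set (ℕ × ℕ)), cslKernels (n / (x.1 ^ 2 * x.2 ^ 2)) x.1 x.2 := by
  have hg : ∀ {g k l : ℕ}, g * k ^ 2 * l ^ 2 ≠ 0 → g * k ^ 2 * l ^ 2 / (k ^ 2 * l ^ 2) = g := by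
    intro g k l h
    rw [mul_assoc] at h ⊢
    exact Nat.mul_div_cancel _ (Nat.pos_of_ne_zero (right_ne_zero_of_mul h))
  ext L
  simp only [cslsOfIndex, coincidenceIsometries, Set.mem_ofPred_eq, coincidenceIndex_eq, csl_eq_map]
  constructor
  · rintro ⟨R, hidx, rfl, hn⟩
    refine ⟨_, ?_, rfl⟩
    have key : ∀ T : ℍ ≃ₗᵢ[ℝ] ℍ, ∀ a b : ℍ, ‖a‖ = 1 → ‖b‖ = 1 → (∀ x, T x = a * x * b) →
        integralPart T = integralPart (quatConj R) → integralPart (quatConj R) ∈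
        ⋃ x ∈ (coprimeSquarePairs n : Set (ℕ × ℕ)), cslKernels (n / (x.1 ^ 2 * x.2 ^ 2)) x.1 x.2 := by
      intro T a b ha hb hT hTR
      rw [← hTR] at hn hidx ⊢
      obtain ⟨q, p, ε, g, k, l, hkl, hq, hp, rfl⟩ := exists_params ha hb hT hidx
      obtain ⟨h1, h2⟩ := index_integralPart_rotOf hkl hq hp ε
      have hn' : g * k ^ 2 * l ^ 2 = n := h2.symm.trans hn
      have hn0 : n ≠ 0 := by rw [← hn]; exact hidx
      subst hn'
      simp only [Set.mem_iUnion, exists_prop, Finset.mem_coe, Prod.exists]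
      refine ⟨k, l, mem_coprimeSquarePairs.2 ⟨hn0, hkl, g, rfl⟩, ?_⟩
      rw [hg hn0, mem_cslKernels_iff hkl]
      exact ⟨q, p, hq, hp, h1⟩
    obtain ⟨a, b, ha, hb, h | h⟩ := exists_isometry_eq (quatConj R)
    · exact key _ a b ha hb h rfl
    -- Precomposing with conjugation, which preserves 𝓗, turns the orientation-reversing map into a
    -- rotation with the same CSL.
    · let S : ℍ ≃ₗᵢ[ℝ] ℍ :=
        { starLinear with
          invFun := star
          left_inv := fun x => star_star x
          right_inv := fun x => star_star x
          norm_map' := fun x => Quaternion.norm_star x }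
      have hS : ∀ x, S x = star x := fun x => rfl
      have hSs : ∀ x, S.symm x = star x := fun x => rfl
      refine key (S.trans (quatConj R)) a b ha hb (fun x => ?_) ?_
      · rw [LinearIsometryEquiv.trans_apply, h, hS, star_star]
      · have hst : ∀ y : ℍ, y ∈ hurwitzOrder → star y ∈ hurwitzOrder := fun y hy =>
          (star (⟨y, hy⟩ : 𝓗)).2
        ext x
        rw [mem_integralPart, mem_integralPart, LinearIsometryEquiv.symm_trans,
          LinearIsometryEquiv.trans_apply, hSs]
        exact ⟨fun h => by have := hst _ h; rwa [star_star] at this, hst _⟩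
  · rintro ⟨K, hK, rfl⟩
    simp only [Set.mem_iUnion, exists_prop, Finset.mem_coe, Prod.exists] at hK
    obtain ⟨k, l, hx, hK⟩ := hK
    obtain ⟨hn, hkl, g, rfl⟩ := mem_coprimeSquarePairs.1 hx
    rw [hg hn, mem_cslKernels_iff hkl] at hK
    obtain ⟨q, p, hq, hp, rfl⟩ := hK
    obtain ⟨h1, h2⟩ := index_integralPart_rotOf hkl hq hp false
    obtain ⟨R, hR⟩ := quatConj_surjective (rotOf q p false)
    refine ⟨R, ?_, ?_, ?_⟩
    · rw [hR, h2]; exact hn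
    · rw [hR, h1]
    · rw [hR, h2]

theorem finite_cslsOfIndex (n : ℕ) : (cslsOfIndex latticeD4Star n).Finite := by
  rw [cslsOfIndex_eq]
  exact ((Finset.finite_toSet _).biUnion fun x _ => finite_cslKernels _ _ _).image _

theorem ncard_cslsOfIndex (n : ℕ) : (cslsOfIndex latticeD4Star n).ncard = cslCount n := by
  rw [cslsOfIndex_eq, Set.ncard_image_of_injective _ (AddSubgroup.map_injective emb_injective),
    Set.Finite.ncard_biUnion (Finset.finite_toSet _), finsum_mem_coe_finset, cslCount]
  · refine Finset.sum_congr rfl fun ⟨k, l⟩ hx => ?_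
    obtain ⟨hn, hkl, g, rfl⟩ := mem_coprimeSquarePairs.1 hx
    have hl : 0 < l := Nat.pos_of_ne_zero fun h => hn (by rw [h]; ring)
    have hk : 0 < k := Nat.pos_of_ne_zero fun h => hn (by rw [h]; ring)
    rw [ncard_cslKernels]
    simp only
    congr 2
    · rw [Nat.eq_div_of_mul_eq_left (by positivity) (show g * (k ^ 2 * l ^ 2) = g * k ^ 2 * l ^ 2 by ring) |>.symm]
      exact (Nat.eq_div_of_mul_eq_left (by positivity) (by ring))
    · rw [Nat.eq_div_of_mul_eq_left (by positivity) (show g * (k ^ 2 * l ^ 2) = g * k ^ 2 * l ^ 2 by ring) |>.symm]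
      exact (Nat.eq_div_of_mul_eq_left (by positivity) (by ring))
  · exact fun x _ => finite_cslKernels _ _ _
  · rintro ⟨k, l⟩ - ⟨k', l'⟩ - hne
    refine Set.disjoint_left.2 ?_
    rintro _ ⟨⟨q, p⟩, ⟨hq, hp⟩, rfl⟩ ⟨⟨q', p'⟩, ⟨hq', hp'⟩, h⟩
    apply hne
    obtain ⟨h1, h2, -, -⟩ := cslKernel_eq_cslKernel hq' hp' hq hp h
    exact Prod.ext h1.symm h2.symm

end HurwitzInt

/-! ### Multiplicativity of the counts and reduction to prime powers -/

theorem mem_coprimeSquarePairs' {n : ℕ} {x : ℕ × ℕ} : x ∈ coprimeSquarePairs n ↔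
    n ≠ 0 ∧ x.1.Coprime x.2 ∧ x.1 ^ 2 * x.2 ^ 2 ∣ n := by
  rw [← Prod.mk.eta (p := x), mem_coprimeSquarePairs, Prod.mk.eta]
  exact and_congr_right fun _ => and_congr_right fun _ =>
    ⟨fun ⟨g, h⟩ => ⟨g, by rw [h]; ring⟩, fun ⟨g, h⟩ => ⟨g, by rw [h]; ring⟩⟩

theorem dvd_of_mem_coprimeSquarePairs {n : ℕ} {x : ℕ × ℕ} (hx : x ∈ coprimeSquarePairs n) :
    x.1 ∣ n ∧ x.2 ∣ n := by
  have h := Finset.mem_product.1 (Finset.mem_filter.1 hx).1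
  exact ⟨Nat.dvd_of_mem_divisors h.1, Nat.dvd_of_mem_divisors h.2⟩

theorem gcd_mem_coprimeSquarePairs {a b : ℕ} (hab : a.Coprime b) {x : ℕ × ℕ}
    (hx : x ∈ coprimeSquarePairs (a * b)) : (x.1.gcd a, x.2.gcd a) ∈ coprimeSquarePairs a := by
  obtain ⟨hn, hc, hd⟩ := mem_coprimeSquarePairs'.1 hx
  refine mem_coprimeSquarePairs'.2 ⟨left_ne_zero_of_mul hn, ?_, ?_⟩
  · exact (hc.coprime_dvd_left (Nat.gcd_dvd_left _ _)).coprime_dvd_right (Nat.gcd_dvd_left _ _)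
  · refine Nat.Coprime.dvd_of_dvd_mul_right (n := b) ?_ ((mul_dvd_mul
      (pow_dvd_pow_of_dvd (Nat.gcd_dvd_left _ _) _) (pow_dvd_pow_of_dvd (Nat.gcd_dvd_left _ _) _)).trans hd)
    exact ((hab.coprime_dvd_left (Nat.gcd_dvd_right _ _)).pow_left 2).mul_left
      ((hab.coprime_dvd_left (Nat.gcd_dvd_right _ _)).pow_left 2)

/-- Coprime square pairs for ab are products of pairs for a and for b; the factors are recovered by
gcds with a and b. -/
theorem sum_coprimeSquarePairs_mul {a b : ℕ} (hab : a.Coprime b) (w w₁ w₂ : ℕ × ℕ → ℕ)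
    (hw : ∀ x ∈ coprimeSquarePairs a, ∀ y ∈ coprimeSquarePairs b,
      w (x.1 * y.1, x.2 * y.2) = w₁ x * w₂ y) :
    ∑ x ∈ coprimeSquarePairs (a * b), w x =
      (∑ x ∈ coprimeSquarePairs a, w₁ x) * ∑ y ∈ coprimeSquarePairs b, w₂ y := by
  rw [Finset.sum_mul_sum, ← Finset.sum_product']
  symm
  refine Finset.sum_nbij' (fun z => (z.1.1 * z.2.1, z.1.2 * z.2.2))
    (fun x => ((x.1.gcd a, x.2.gcd a), (x.1.gcd b, x.2.gcd b))) ?_ ?_ ?_ ?_ ?_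
  · rintro ⟨x, y⟩ hz
    obtain ⟨hx, hy⟩ := Finset.mem_product.1 hz
    have hx' := dvd_of_mem_coprimeSquarePairs hx
    have hy' := dvd_of_mem_coprimeSquarePairs hy
    obtain ⟨ha, hcx, hdx⟩ := mem_coprimeSquarePairs'.1 hx
    obtain ⟨hb, hcy, hdy⟩ := mem_coprimeSquarePairs'.1 hy
    refine mem_coprimeSquarePairs'.2 ⟨mul_ne_zero ha hb, ?_, ?_⟩
    · exact (hcx.mul_right ((hab.coprime_dvd_left hx'.1).coprime_dvd_right hy'.2)).mul_left
        (((hab.coprime_dvd_left hx'.2).coprime_dvd_right hy'.1).symm.mul_right hcy)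
    · rw [show (x.1 * y.1) ^ 2 * (x.2 * y.2) ^ 2 = (x.1 ^ 2 * x.2 ^ 2) * (y.1 ^ 2 * y.2 ^ 2) by ring]
      exact mul_dvd_mul hdx hdy
  · intro x hx
    refine Finset.mem_product.2 ⟨gcd_mem_coprimeSquarePairs hab hx, ?_⟩
    rw [mul_comm] at hx
    exact gcd_mem_coprimeSquarePairs hab.symm hx
  · rintro ⟨x, y⟩ hz
    obtain ⟨hx, hy⟩ := Finset.mem_product.1 hz
    have hx' := dvd_of_mem_coprimeSquarePairs hx
    have hy' := dvd_of_mem_coprimeSquarePairs hy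
    have key : ∀ {k l : ℕ}, k ∣ a → l ∣ b → (k * l).gcd a = k ∧ (k * l).gcd b = l := by
      intro k l hk hl
      constructor
      · rw [Nat.Coprime.gcd_mul_right_cancel _ (hab.symm.coprime_dvd_left hl), Nat.gcd_eq_left hk]
      · rw [mul_comm, Nat.Coprime.gcd_mul_right_cancel _ (hab.coprime_dvd_left hk), Nat.gcd_eq_left hl]
    obtain ⟨h1, h2⟩ := key hx'.1 hy'.1
    obtain ⟨h3, h4⟩ := key hx'.2 hy'.2
    simp only [h1, h2, h3, h4]
  · intro x hx
    have hx' := dvd_of_mem_coprimeSquarePairs hx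
    have h1 := hab.gcd_mul x.1
    have h2 := hab.gcd_mul x.2
    rw [Nat.gcd_eq_left hx'.1] at h1
    rw [Nat.gcd_eq_left hx'.2] at h2
    simp only [← h1, ← h2]
  · rintro ⟨x, y⟩ hz
    obtain ⟨hx, hy⟩ := Finset.mem_product.1 hz
    exact (hw x hx y hy).symm

theorem sum_coprimeSquarePairs_prime_pow {p : ℕ} (hp : p.Prime) (r : ℕ) (w : ℕ × ℕ → ℕ) :
    ∑ x ∈ coprimeSquarePairs (p ^ r), w x =
      w (1, 1) + ∑ i ∈ Finset.range (r / 2), (w (p ^ (i + 1), 1) + w (1, p ^ (i + 1))) := by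
  have hinj := Nat.pow_right_injective hp.two_le
  -- Coprimality forces one entry to be 1. The pair (1, 1) belongs to the first family only, hence
  -- the shifted exponent in the second.
  have hset : coprimeSquarePairs (p ^ r) = (Finset.range (r / 2 + 1)).image (fun i => (p ^ i, 1)) ∪
      (Finset.range (r / 2)).image (fun i => (1, p ^ (i + 1))) := by
    ext ⟨k, l⟩
    simp only [mem_coprimeSquarePairs', Finset.mem_union, Finset.mem_image, Finset.mem_range,
      Prod.mk.injEq]
    constructor
    · rintro ⟨-, hc, hd⟩
      obtain ⟨i, -, rfl⟩ := (Nat.dvd_prime_pow hp).1 ((dvd_pow_self k two_ne_zero).trans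
        ((dvd_mul_right _ _).trans hd))
      obtain ⟨j, -, rfl⟩ := (Nat.dvd_prime_pow hp).1 ((dvd_pow_self l two_ne_zero).trans
        ((dvd_mul_left _ _).trans hd))
      rw [← pow_mul, ← pow_mul, ← pow_add, Nat.pow_dvd_pow_iff_le_right hp.one_lt] at hd
      rcases Nat.eq_zero_or_pos j with rfl | hj
      · exact Or.inl ⟨i, by omega, rfl, by simp⟩
      rcases Nat.eq_zero_or_pos i with rfl | hi
      · exact Or.inr ⟨j - 1, by omega, by simp, by rw [Nat.sub_add_cancel hj]⟩
      · exact absurd (Nat.eq_one_of_dvd_coprimes hc (dvd_pow_self p hi.ne') (dvd_pow_self p hj.ne'))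
          hp.ne_one
    · rintro (⟨i, hi, rfl, rfl⟩ | ⟨i, hi, rfl, rfl⟩)
      · refine ⟨(pow_pos hp.pos _).ne', Nat.coprime_one_right _, ?_⟩
        rw [one_pow, mul_one, ← pow_mul]
        exact pow_dvd_pow _ (by omega)
      · refine ⟨(pow_pos hp.pos _).ne', Nat.coprime_one_left _, ?_⟩
        rw [one_pow, one_mul, ← pow_mul]
        exact pow_dvd_pow _ (by omega)
  rw [hset, Finset.sum_union, Finset.sum_image, Finset.sum_image, Finset.sum_range_succ',
    Finset.sum_add_distrib, pow_zero]
  · ring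
  · intro i _ j _ h
    exact Nat.succ_injective (hinj (congrArg Prod.snd h))
  · intro i _ j _ h
    exact hinj (congrArg Prod.fst h)
  · rw [Finset.disjoint_left]
    intro x hx hy
    obtain ⟨i, -, rfl⟩ := Finset.mem_image.1 hx
    obtain ⟨j, -, h⟩ := Finset.mem_image.1 hy
    have h1 : p ^ (j + 1) = 1 := congrArg Prod.snd h
    exact absurd h1 (Nat.one_lt_pow (Nat.succ_ne_zero j) hp.one_lt).ne'

namespace HurwitzInt

theorem psi_div_mul_div {a b c d : ℕ} (hab : a.Coprime b) (hc : c ∣ a) (hd : d ∣ b) :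
    psi (a * b / (c * d)) = psi (a / c) * psi (b / d) := by
  rw [← Nat.div_mul_div_comm hc hd]
  exact psi_mul ((hab.coprime_dvd_left (Nat.div_dvd_of_dvd hc)).coprime_dvd_right
    (Nat.div_dvd_of_dvd hd))

theorem coprimeSquarePairs_one : coprimeSquarePairs 1 = {(1, 1)} := by decide

theorem rotCount_one : rotCount 1 = 1 := by
  simp [rotCount, coprimeSquarePairs_one, psi_one]

theorem cslCount_one : cslCount 1 = 1 := by
  simp [cslCount, coprimeSquarePairs_one, psi_one]

theorem rotCount_mul {a b : ℕ} (hab : a.Coprime b) :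
    rotCount (a * b) = rotCount a * rotCount b := by
  refine sum_coprimeSquarePairs_mul hab _ _ _ fun x hx y hy => ?_
  have hx := (mem_coprimeSquarePairs'.1 hx).2.2
  have hy := (mem_coprimeSquarePairs'.1 hy).2.2
  simp only [mul_pow]
  rw [psi_div_mul_div hab ((dvd_mul_left _ _).trans hx) ((dvd_mul_left _ _).trans hy),
    psi_div_mul_div hab ((dvd_mul_right _ _).trans hx) ((dvd_mul_right _ _).trans hy)]
  ring

theorem cslCount_mul {a b : ℕ} (hab : a.Coprime b) :
    cslCount (a * b) = cslCount a * cslCount b := by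
  refine sum_coprimeSquarePairs_mul hab _ _ _ fun x hx y hy => ?_
  have hx := (mem_coprimeSquarePairs'.1 hx).2.2
  have hy := (mem_coprimeSquarePairs'.1 hy).2.2
  have h1 : ∀ x : ℕ × ℕ, x.1 * x.2 ^ 2 ∣ x.1 ^ 2 * x.2 ^ 2 := fun x => ⟨x.1, by ring⟩
  have h2 : ∀ x : ℕ × ℕ, x.1 ^ 2 * x.2 ∣ x.1 ^ 2 * x.2 ^ 2 := fun x => ⟨x.2, by ring⟩
  simp only
  rw [show x.1 * y.1 * (x.2 * y.2) ^ 2 = x.1 * x.2 ^ 2 * (y.1 * y.2 ^ 2) by ring,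
    show (x.1 * y.1) ^ 2 * (x.2 * y.2) = x.1 ^ 2 * x.2 * (y.1 ^ 2 * y.2) by ring,
    psi_div_mul_div hab ((h1 x).trans hx) ((h1 y).trans hy),
    psi_div_mul_div hab ((h2 x).trans hx) ((h2 y).trans hy)]
  ring

/-- Termwise, ψ(gk) ≤ ψ(gk²) and ψ(gl) ≤ ψ(gl²). Vanishing at even n and convergence then carry over
from rotations to CSLs. -/
theorem cslCount_le_rotCount (n : ℕ) : cslCount n ≤ rotCount n := by
  refine Finset.sum_le_sum fun ⟨k, l⟩ hx => ?_
  obtain ⟨hn, -, g, rfl⟩ := mem_coprimeSquarePairs.1 hx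
  have hk : k ≠ 0 := by rintro rfl; simp at hn
  have hl : l ≠ 0 := by rintro rfl; simp at hn
  have e1 : g * k ^ 2 * l ^ 2 / (k * l ^ 2) = g * k :=
    Nat.div_eq_of_eq_mul_left (by positivity) (by ring)
  have e2 : g * k ^ 2 * l ^ 2 / (k ^ 2 * l) = g * l :=
    Nat.div_eq_of_eq_mul_left (by positivity) (by ring)
  have e3 : g * k ^ 2 * l ^ 2 / l ^ 2 = g * k ^ 2 :=
    Nat.div_eq_of_eq_mul_left (by positivity) (by ring)
  have e4 : g * k ^ 2 * l ^ 2 / k ^ 2 = g * l ^ 2 :=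
    Nat.div_eq_of_eq_mul_left (by positivity) (by ring)
  simp only [e1, e2, e3, e4]
  have key : ∀ m : ℕ, psi (g * m) ≤ psi (g * m ^ 2) := fun m =>
    psi_le_of_dvd ⟨m, by ring⟩ fun h => (Nat.odd_mul.1 h).1.mul ((Nat.odd_mul.1 h).2.pow)
  exact Nat.mul_le_mul (key k) (key l)

theorem rotCount_two_pow {r : ℕ} (hr : 1 ≤ r) : rotCount (2 ^ r) = 0 := by
  have h : psi (2 ^ r) = 0 := psi_of_even ((even_two).pow_of_ne_zero (by omega))
  rw [rotCount, sum_coprimeSquarePairs_prime_pow Nat.prime_two]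
  simp [h]

theorem cslCount_two_pow {r : ℕ} (hr : 1 ≤ r) : cslCount (2 ^ r) = 0 :=
  Nat.le_zero.1 ((cslCount_le_rotCount _).trans (rotCount_two_pow hr).le)

theorem rotCount_prime_pow {p : ℕ} (hp : p.Prime) (r : ℕ) :
    rotCount (p ^ r) = psi (p ^ r) *
      (psi (p ^ r) + 2 * ∑ i ∈ Finset.range (r / 2), psi (p ^ (r - 2 * (i + 1)))) := by
  rw [rotCount, sum_coprimeSquarePairs_prime_pow hp, mul_add, Finset.mul_sum, Finset.mul_sum]
  congr 1
  · simp
  · refine Finset.sum_congr rfl fun i hi => ?_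
    have := Finset.mem_range.1 hi
    simp only [one_pow, Nat.div_one, ← pow_mul]
    rw [Nat.pow_div (by omega) hp.pos, mul_comm (i + 1) 2]
    ring

theorem cslCount_prime_pow {p : ℕ} (hp : p.Prime) (r : ℕ) :
    cslCount (p ^ r) = psi (p ^ r) ^ 2 +
      2 * ∑ i ∈ Finset.range (r / 2), psi (p ^ (r - (i + 1))) * psi (p ^ (r - 2 * (i + 1))) := by
  rw [cslCount, sum_coprimeSquarePairs_prime_pow hp, Finset.mul_sum]
  congr 1
  · simp [sq]
  · refine Finset.sum_congr rfl fun i hi => ?_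
    have := Finset.mem_range.1 hi
    simp only [one_pow, one_mul, mul_one, ← pow_mul]
    rw [Nat.pow_div (by omega) hp.pos, Nat.pow_div (by omega) hp.pos, mul_comm (i + 1) 2]
    ring

/-! ### Closed forms at odd prime powers -/

section ClosedForms

variable {K : Type*} [Field K] [CharZero K] {p : ℕ}

theorem natCast_sub_one_ne_zero (hp : p.Prime) : (p : K) - 1 ≠ 0 :=
  sub_ne_zero.2 (by exact_mod_cast hp.ne_one)

theorem natCast_cube_sub_one_ne_zero (hp : p.Prime) : (p : K) ^ 3 - 1 ≠ 0 :=
  sub_ne_zero.2 (by exact_mod_cast (Nat.one_lt_pow three_ne_zero hp.one_lt).ne')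

theorem rotCount_prime_pow_succ (hp : p.Prime) (hpo : Odd p) (r : ℕ) :
    (rotCount (p ^ (r + 1)) : K) = ((p : K) + 1) / ((p : K) - 1) * (p : K) ^ r *
      ((p : K) ^ (r + 2) + (p : K) ^ r - 2) := by
  have h1 := natCast_sub_one_ne_zero (K := K) hp
  have key : ∀ r : ℕ, ((p : K) - 1) * (psi (p ^ (r + 1)) +
      2 * ∑ i ∈ Finset.range ((r + 1) / 2), (psi (p ^ (r + 1 - 2 * (i + 1))) : K)) =
      (p : K) ^ (r + 2) + (p : K) ^ r - 2 := by
    intro r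
    induction r using Nat.twoStepInduction with
    | zero => rw [psi_prime_pow hp hpo]; norm_num; ring
    | one => rw [psi_prime_pow hp hpo]; norm_num [psi_one]; ring
    | more r ih _ =>
      -- Raising r by 2 prepends one term and leaves the rest of the sum unchanged, whence the
      -- induction in steps of two.
      rw [show (r + 2 + 1) / 2 = (r + 1) / 2 + 1 by omega, Finset.sum_range_succ',
        Finset.sum_congr rfl fun i _ => by
          rw [show r + 2 + 1 - 2 * (i + 1 + 1) = r + 1 - 2 * (i + 1) by omega],
        show r + 2 + 1 - 2 * (0 + 1) = r + 1 by omega]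
      rw [psi_prime_pow hp hpo] at ih ⊢
      rw [psi_prime_pow hp hpo]
      push_cast at ih ⊢
      linear_combination ih
  rw [rotCount_prime_pow hp]
  have h := key r
  rw [psi_prime_pow hp hpo] at h ⊢
  push_cast at h ⊢
  field_simp
  linear_combination (p : K) ^ r * h

/-- The first term splits off. In every other term the first argument gains a factor p and was
already a positive power of p, so ψ is multiplied by p, while the second argument is unchanged. -/
theorem sum_psi_mul_psi_succ (hp : p.Prime) (hpo : Odd p) (r : ℕ) :
    ∑ i ∈ Finset.range ((r + 2) / 2), psi (p ^ (r + 2 - (i + 1))) * psi (p ^ (r + 2 - 2 * (i + 1))) =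
      psi (p ^ (r + 1)) * psi (p ^ r) + p * ∑ i ∈ Finset.range (r / 2),
        psi (p ^ (r - (i + 1))) * psi (p ^ (r - 2 * (i + 1))) := by
  rw [show (r + 2) / 2 = r / 2 + 1 by omega, Finset.sum_range_succ', add_comm, Finset.mul_sum]
  congr 1
  refine Finset.sum_congr rfl fun i hi => ?_
  have := Finset.mem_range.1 hi
  obtain ⟨c, hc⟩ : ∃ c, r - (i + 1) = c + 1 := ⟨r - (i + 2), by omega⟩
  rw [show r + 2 - 2 * (i + 1 + 1) = r - 2 * (i + 1) by omega,
    show r + 2 - (i + 1 + 1) = c + 1 + 1 by omega, hc, psi_prime_pow hp hpo, psi_prime_pow hp hpo]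
  ring

theorem cslCount_prime_pow_odd (hp : p.Prime) (hpo : Odd p) (m : ℕ) :
    (cslCount (p ^ (2 * m + 1)) : K) = ((p : K) + 1) ^ 2 / ((p : K) ^ 3 - 1) *
      ((p : K) ^ (4 * m + 3) + (p : K) ^ (4 * m) - 2 * (p : K) ^ m) := by
  have h1 := natCast_cube_sub_one_ne_zero (K := K) hp
  have key : ((p : K) ^ 3 - 1) * ((∑ i ∈ Finset.range ((2 * m + 1) / 2),
      psi (p ^ (2 * m + 1 - (i + 1))) * psi (p ^ (2 * m + 1 - 2 * (i + 1))) : ℕ) : K) =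
      ((p : K) + 1) ^ 2 * ((p : K) ^ (4 * m) - (p : K) ^ m) := by
    induction m with
    | zero => simp
    | succ m ih =>
      rw [show 2 * (m + 1) + 1 = 2 * m + 1 + 2 by ring, sum_psi_mul_psi_succ hp hpo,
        psi_prime_pow hp hpo, psi_prime_pow hp hpo]
      push_cast at ih ⊢
      linear_combination (p : K) * ih
  rw [cslCount_prime_pow hp, psi_prime_pow hp hpo]
  push_cast at key ⊢
  field_simp
  linear_combination 2 * key

theorem cslCount_prime_pow_even (hp : p.Prime) (hpo : Odd p) (m : ℕ) :
    (cslCount (p ^ (2 * m + 2)) : K) = ((p : K) + 1) ^ 2 / ((p : K) ^ 3 - 1) *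
      ((p : K) ^ (4 * m + 5) + (p : K) ^ (4 * m + 2) -
        2 * (p : K) ^ m * ((1 + (p : K) ^ 2) / (1 + (p : K)))) := by
  have h1 := natCast_cube_sub_one_ne_zero (K := K) hp
  have h2 : 1 + (p : K) ≠ 0 := by rw [add_comm]; exact Nat.cast_add_one_ne_zero p
  have key : ((p : K) ^ 3 - 1) * ((∑ i ∈ Finset.range ((2 * m + 2) / 2),
      psi (p ^ (2 * m + 2 - (i + 1))) * psi (p ^ (2 * m + 2 - 2 * (i + 1))) : ℕ) : K) =
      ((p : K) + 1) ^ 2 * (p : K) ^ (4 * m + 2) - (p : K) ^ m * (1 + (p : K) ^ 2) * (1 + p) := by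
    induction m with
    | zero =>
      rw [sum_psi_mul_psi_succ hp hpo, psi_prime_pow hp hpo]
      simp [psi_one]
      ring
    | succ m ih =>
      rw [show 2 * (m + 1) + 2 = 2 * m + 2 + 2 by ring, sum_psi_mul_psi_succ hp hpo,
        psi_prime_pow hp hpo, show 2 * m + 2 = 2 * m + 1 + 1 by ring, psi_prime_pow hp hpo]
      push_cast at ih ⊢
      linear_combination (p : K) * ih
  rw [cslCount_prime_pow hp, show 2 * m + 2 = 2 * m + 1 + 1 by ring, psi_prime_pow hp hpo]
  push_cast at key ⊢
  field_simp
  linear_combination 2 * (1 + (p : K)) * key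

end ClosedForms

end HurwitzInt

/-! ### Convergence, Euler factors and initial coefficients -/

/-- The Euler product of the Dirichlet series of a multiplicative function that vanishes at the
even prime powers. -/
theorem hasProd_LSeries_of_mul {F : ℕ → ℕ} (h0 : F 0 = 0) (h1 : F 1 = 1)
    (hmul : ∀ {a b : ℕ}, a.Coprime b → F (a * b) = F a * F b)
    (h2 : ∀ r : ℕ, 1 ≤ r → F (2 ^ r) = 0) {s : ℂ} (hs : LSeriesSummable (fun n => (F n : ℂ)) s)
    {L : ℕ → ℂ} (hL : ∀ p : ℕ, p.Prime → p ≠ 2 →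
      HasSum (fun e : ℕ => (F (p ^ e) : ℂ) * ((p : ℂ) ^ (-s)) ^ e) (L p)) :
    HasProd (fun p : {p : ℕ // p.Prime ∧ p ≠ 2} => L p) (LSeries (fun n => (F n : ℂ)) s) := by
  have hterm : ∀ n : ℕ, LSeries.term (fun n => (F n : ℂ)) s n = F n * (n : ℂ) ^ (-s) := by
    intro n
    rw [LSeries.term_def]
    split_ifs with h
    · rw [h, h0, Nat.cast_zero, zero_mul]
    · rw [Complex.cpow_neg, div_eq_mul_inv]
  have hpow : ∀ p e : ℕ, LSeries.term (fun n => (F n : ℂ)) s (p ^ e) =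
      F (p ^ e) * ((p : ℂ) ^ (-s)) ^ e := by
    intro p e
    rw [hterm, Nat.cast_pow, ← Complex.natCast_cpow_natCast_mul, Complex.cpow_nat_mul]
  have hE : HasProd (fun p : Nat.Primes => ∑' e : ℕ, LSeries.term (fun n => (F n : ℂ)) s (p ^ e))
      (LSeries (fun n => (F n : ℂ)) s) := by
    refine EulerProduct.eulerProduct_hasProd ?_ ?_ hs.norm (LSeries.term_zero _ _)
    · rw [hterm, h1]; simp
    · intro m n hmn
      rw [hterm, hterm, hterm, hmul hmn]
      push_cast
      rw [Complex.natCast_mul_natCast_cpow]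
      ring
  let i : {p : ℕ // p.Prime ∧ p ≠ 2} → Nat.Primes := fun p => ⟨p.1, p.2.1⟩
  have hi : Function.Injective i := fun a b h =>
    Subtype.ext (congrArg (fun q : Nat.Primes => (q : ℕ)) h)
  rw [← hi.hasProd_iff] at hE
  · convert hE using 1
    funext p
    have := hL p.1 p.2.1 p.2.2
    rw [← this.tsum_eq]
    exact tsum_congr fun e => (hpow p.1 e).symm
  · rintro ⟨q, hq⟩ hn
    have hq2 : q = 2 := by
      by_contra h
      exact hn ⟨⟨q, hq, h⟩, rfl⟩
    subst hq2
    rw [tsum_eq_single 0]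
    · rw [hpow, pow_zero, h1]; simp
    · intro e he
      rw [hpow, h2 e (Nat.one_le_iff_ne_zero.2 he), Nat.cast_zero, zero_mul]

theorem sum_sq_mul_sq_divisorsAntidiagonal (n : ℕ) :
    ∑ x ∈ n.divisorsAntidiagonal, x.1 ^ 2 * x.2 ^ 2 = n ^ 2 * n.divisors.card := by
  rw [Finset.sum_congr rfl fun x hx => by
    rw [← mul_pow, (Nat.mem_divisorsAntidiagonal.1 hx).1], Finset.sum_const, smul_eq_mul, mul_comm,
    ← Nat.map_div_right_divisors, Finset.card_map]

/-- n² d(n) is the Dirichlet convolution of n² with itself, and Σ n^(2-s) converges absolutely for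
Re s > 3. -/
theorem lSeriesSummable_of_le_sq_mul_card_divisors {F : ℕ → ℕ}
    (hF : ∀ n, F n ≤ n ^ 2 * n.divisors.card) {s : ℂ} (hs : 3 < s.re) :
    LSeriesSummable (fun n => (F n : ℂ)) s := by
  have hsq : LSeriesSummable (fun n => ((n ^ 2 : ℕ) : ℂ)) s := by
    refine LSeriesSummable_of_le_const_mul_rpow hs ⟨1, fun n _ => le_of_eq ?_⟩
    rw [Complex.norm_natCast, one_mul]
    norm_num
  have hconv := hsq.convolution hsq
  refine Summable.of_norm_bounded hconv.norm fun n => LSeries.norm_term_le s ?_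
  have : LSeries.convolution (fun n => ((n ^ 2 : ℕ) : ℂ)) (fun n => ((n ^ 2 : ℕ) : ℂ)) n =
      ((n ^ 2 * n.divisors.card : ℕ) : ℂ) := by
    rw [← sum_sq_mul_sq_divisorsAntidiagonal, LSeries.convolution_def]
    push_cast
    rfl
  rw [this, Complex.norm_natCast, Complex.norm_natCast]
  exact_mod_cast hF n

namespace HurwitzInt

theorem rotCount_zero : rotCount 0 = 0 := by simp [rotCount, coprimeSquarePairs]

theorem cslCount_zero : cslCount 0 = 0 := by simp [cslCount, coprimeSquarePairs]

theorem rotCount_prime_pow_le {p : ℕ} (hp : p.Prime) (h : p ≠ 2) (r : ℕ) :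
    rotCount (p ^ (r + 1)) ≤ (p ^ (r + 1)) ^ 2 * (r + 2) := by
  have hp3 : (3 : ℚ) ≤ p := by
    exact_mod_cast (show 3 ≤ p by have := hp.two_le; omega)
  have hp1 : (0 : ℚ) < p - 1 := by linarith
  rw [← Nat.cast_le (α := ℚ), rotCount_prime_pow_succ hp (hp.odd_of_ne_two h)]
  push_cast
  have hx : (1 : ℚ) ≤ (p : ℚ) ^ r := one_le_pow₀ (by linarith)
  have hmain : ((p : ℚ) + 1) * ((p : ℚ) ^ (r + 2) + (p : ℚ) ^ r - 2) ≤
      (p - 1) * (p : ℚ) ^ (r + 2) * (r + 2) := by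
    -- At exponent one the divisor count is only 2 and the bound is (p+1)² ≤ 2p², true from p = 3
    -- on; for higher exponents a factor of at least 3 is available.
    cases r with
    | zero => norm_num; nlinarith [mul_nonneg (sub_nonneg.2 hp3) hp1.le]
    | succ r =>
      have h3 : (p - 1) * (p : ℚ) ^ (r + 1 + 2) * 3 ≤
          (p - 1) * (p : ℚ) ^ (r + 1 + 2) * (((r + 1 : ℕ) : ℚ) + 2) := by
        refine mul_le_mul_of_nonneg_left ?_ (by positivity)
        push_cast
        have : (0 : ℚ) ≤ r := Nat.cast_nonneg r
        linarith
      refine le_trans ?_ h3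
      have h4 : ((p : ℚ) + 1) * (p ^ 2 + 1) ≤ (p - 1) * p ^ 2 * 3 := by
        nlinarith [mul_nonneg (sub_nonneg.2 hp3) (sub_nonneg.2 hp3), mul_nonneg
          (mul_nonneg (sub_nonneg.2 hp3) (sub_nonneg.2 hp3)) (sub_nonneg.2 hp3)]
      have h5 := mul_le_mul_of_nonneg_left h4 (zero_le_one.trans hx)
      have h6 : (p : ℚ) ^ (r + 1 + 2) = p ^ (r + 1) * p ^ 2 := pow_add _ _ _
      rw [h6]
      linarith
  rw [div_mul_eq_mul_div, div_mul_eq_mul_div, div_le_iff₀ hp1]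
  have h5 := mul_le_mul_of_nonneg_left hmain (zero_le_one.trans hx)
  calc _ = (p : ℚ) ^ r * (((p : ℚ) + 1) * ((p : ℚ) ^ (r + 2) + (p : ℚ) ^ r - 2)) := by ring
    _ ≤ _ := h5
    _ = _ := by ring

theorem rotCount_le (n : ℕ) : rotCount n ≤ n ^ 2 * n.divisors.card := by
  induction n using Nat.recOnPosPrimePosCoprime with
  | prime_pow p r hp hr =>
    by_cases h : p = 2
    · rw [h, rotCount_two_pow hr]
      exact Nat.zero_le _
    · obtain ⟨r, rfl⟩ : ∃ c, r = c + 1 := ⟨r - 1, by omega⟩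
      rw [Nat.divisors_prime_pow hp, Finset.card_map, Finset.card_range]
      exact rotCount_prime_pow_le hp h r
  | zero => rw [rotCount_zero]; exact Nat.zero_le _
  | one => rw [rotCount_one]; simp
  | coprime a b _ _ hab iha ihb =>
    rw [rotCount_mul hab, hab.card_divisors_mul]
    calc _ ≤ _ := Nat.mul_le_mul iha ihb
      _ = _ := by ring

theorem lSeriesSummable_rotCount {s : ℂ} (hs : 3 < s.re) :
    LSeriesSummable (fun n => (rotCount n : ℂ)) s :=
  lSeriesSummable_of_le_sq_mul_card_divisors rotCount_le hs

theorem lSeriesSummable_cslCount {s : ℂ} (hs : 3 < s.re) :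
    LSeriesSummable (fun n => (cslCount n : ℂ)) s :=
  lSeriesSummable_of_le_sq_mul_card_divisors
    (fun n => (cslCount_le_rotCount n).trans (rotCount_le n)) hs

/-- Beyond the constant term, the closed form splits into geometric series of ratios p²x and px. -/
theorem hasSum_rotCount_prime_pow {p : ℕ} (hp : p.Prime) (h : p ≠ 2) {x : ℂ}
    (hx : ‖(p : ℂ) ^ 2 * x‖ < 1) :
    HasSum (fun e : ℕ => (rotCount (p ^ e) : ℂ) * x ^ e)
      ((1 + x) * (1 + p * x) / ((1 - p * x) * (1 - (p : ℂ) ^ 2 * x))) := by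
  have hx1 : ‖(p : ℂ) * x‖ < 1 := by
    refine lt_of_le_of_lt ?_ hx
    rw [norm_mul, norm_mul, norm_pow, Complex.norm_natCast]
    have : (1 : ℝ) ≤ p := by exact_mod_cast hp.one_le
    exact mul_le_mul_of_nonneg_right (by nlinarith) (norm_nonneg x)
  have n1 : 1 - (p : ℂ) ^ 2 * x ≠ 0 := fun h => by
    rw [← sub_eq_zero.1 h] at hx; simp at hx
  have n2 : 1 - (p : ℂ) * x ≠ 0 := fun h => by
    rw [← sub_eq_zero.1 h] at hx1; simp at hx1
  have n3 := natCast_sub_one_ne_zero (K := ℂ) hp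
  have hs := (((hasSum_geometric_of_norm_lt_one hx).mul_left (((p : ℂ) ^ 2 + 1))).sub
    ((hasSum_geometric_of_norm_lt_one hx1).mul_left 2)).mul_left (((p : ℂ) + 1) / (p - 1) * x)
  have hs' := hs.congr_fun (g := fun e : ℕ => (rotCount (p ^ (e + 1)) : ℂ) * x ^ (e + 1))
    fun e => by rw [rotCount_prime_pow_succ hp (hp.odd_of_ne_two h)]; ring
  have := HasSum.zero_add (f := fun e : ℕ => (rotCount (p ^ e) : ℂ) * x ^ e) hs'
  convert this using 1
  rw [pow_zero, rotCount_one, Nat.cast_one, pow_zero]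
  generalize hA : 1 - (p : ℂ) ^ 2 * x = A at *
  generalize hB : 1 - (p : ℂ) * x = B at *
  field_simp
  rw [← hA, ← hB]
  ring

/-- Odd and even exponents are summed separately, each as a combination of geometric series of
ratios p⁴x² and px². -/
theorem hasSum_cslCount_prime_pow {p : ℕ} (hp : p.Prime) (h : p ≠ 2) {x : ℂ}
    (hx : ‖(p : ℂ) ^ 2 * x‖ < 1) :
    HasSum (fun e : ℕ => (cslCount (p ^ e) : ℂ) * x ^ e)
      ((1 + x + 2 * (p * x) + 2 * x ^ 2 + p * x ^ 2 + p * x ^ 3) /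
        ((1 - (p : ℂ) ^ 2 * x) * (1 - p * x ^ 2))) := by
  have hp1 : (1 : ℝ) ≤ p := by exact_mod_cast hp.one_le
  have hx2 : ‖((p : ℂ) ^ 2 * x) ^ 2‖ < 1 := by
    rw [norm_pow]
    exact pow_lt_one₀ (norm_nonneg _) hx two_ne_zero
  have hx1 : ‖(p : ℂ) * x ^ 2‖ < 1 := by
    refine lt_of_le_of_lt ?_ hx2
    rw [mul_pow, norm_mul, norm_mul, norm_pow, norm_pow, norm_pow, Complex.norm_natCast, ← pow_mul]
    exact mul_le_mul_of_nonneg_right (le_self_pow₀ hp1 (by norm_num)) (by positivity)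
  have n1 : 1 - (p : ℂ) ^ 2 * x ≠ 0 := fun h => by
    rw [← sub_eq_zero.1 h] at hx; simp at hx
  have n1' : 1 - ((p : ℂ) ^ 2 * x) ^ 2 ≠ 0 := fun h => by
    rw [← sub_eq_zero.1 h] at hx2; simp at hx2
  have n2 : 1 - (p : ℂ) * x ^ 2 ≠ 0 := fun h => by
    rw [← sub_eq_zero.1 h] at hx1; simp at hx1
  have n3 := natCast_cube_sub_one_ne_zero (K := ℂ) hp
  have n4 : 1 + (p : ℂ) ≠ 0 := by rw [add_comm]; exact Nat.cast_add_one_ne_zero p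
  have hodd := (((hasSum_geometric_of_norm_lt_one hx2).mul_left ((p : ℂ) ^ 3 + 1)).sub
    ((hasSum_geometric_of_norm_lt_one hx1).mul_left 2)).mul_left
      (((p : ℂ) + 1) ^ 2 / ((p : ℂ) ^ 3 - 1) * x)
  have heven := (((hasSum_geometric_of_norm_lt_one hx2).mul_left ((p : ℂ) ^ 5 + p ^ 2)).sub
    ((hasSum_geometric_of_norm_lt_one hx1).mul_left (2 * ((1 + (p : ℂ) ^ 2) / (1 + p))))).mul_left
      (((p : ℂ) + 1) ^ 2 / ((p : ℂ) ^ 3 - 1) * x ^ 2)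
  have hodd' := hodd.congr_fun
    (g := fun e : ℕ => (cslCount (p ^ (2 * e + 1)) : ℂ) * x ^ (2 * e + 1))
    fun e => by rw [cslCount_prime_pow_odd hp (hp.odd_of_ne_two h)]; ring
  have heven' := heven.congr_fun
    (g := fun e : ℕ => (cslCount (p ^ (2 * e + 2)) : ℂ) * x ^ (2 * e + 2))
    fun e => by rw [cslCount_prime_pow_even hp (hp.odd_of_ne_two h)]; ring
  have := HasSum.zero_add (f := fun e : ℕ => (cslCount (p ^ e) : ℂ) * x ^ e)
    (HasSum.even_add_odd (f := fun e : ℕ => (cslCount (p ^ (e + 1)) : ℂ) * x ^ (e + 1)) hodd' heven')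
  convert this using 1
  rw [pow_zero, cslCount_one, add_comm (p : ℂ) 1]
  -- The factor 1 + p²x comes only from splitting by parity; it is nonzero and cancels in the total.
  have e : 1 - ((p : ℂ) ^ 2 * x) ^ 2 = (1 - (p : ℂ) ^ 2 * x) * (1 + (p : ℂ) ^ 2 * x) := by ring
  have n5 : 1 + (p : ℂ) ^ 2 * x ≠ 0 := right_ne_zero_of_mul (e ▸ n1')
  rw [e, pow_zero, Nat.cast_one]
  clear e
  generalize hA : 1 - (p : ℂ) ^ 2 * x = A at *
  generalize hB : 1 - (p : ℂ) * x ^ 2 = B at *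
  generalize hC : 1 + (p : ℂ) ^ 2 * x = C at *
  field_simp
  rw [← hA, ← hB, ← hC]
  ring

theorem rotCount_of_even {n : ℕ} (hn : Even n) : rotCount n = 0 := by
  rcases eq_or_ne n 0 with rfl | h0
  · exact rotCount_zero
  obtain ⟨r, m, hm, rfl⟩ := Nat.exists_eq_two_pow_mul_odd h0
  have hr : 1 ≤ r := by
    by_contra h
    rw [show r = 0 by omega, pow_zero, one_mul] at hn
    exact Nat.not_even_iff_odd.2 hm hn
  rw [rotCount_mul (Nat.Coprime.pow_left _ hm.coprime_two_left), rotCount_two_pow hr, zero_mul]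

theorem cslCount_of_even {n : ℕ} (hn : Even n) : cslCount n = 0 :=
  Nat.le_zero.1 ((cslCount_le_rotCount n).trans (rotCount_of_even hn).le)

theorem rotCount_prime {p : ℕ} (hp : p.Prime) (hpo : Odd p) : rotCount p = (p + 1) ^ 2 := by
  have h := rotCount_prime_pow hp 1
  rw [pow_one, ← pow_one p, psi_prime_pow hp hpo 0] at h
  simpa [sq] using h

theorem cslCount_prime {p : ℕ} (hp : p.Prime) (hpo : Odd p) : cslCount p = (p + 1) ^ 2 := by
  have h := cslCount_prime_pow hp 1
  rw [← zero_add 1, psi_prime_pow hp hpo 0] at h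
  simpa using h

theorem rotCount_table : (List.range' 1 17).map (fun n => rotCount n) =
    [1, 0, 16, 0, 36, 0, 64, 0, 168, 0, 144, 0, 196, 0, 576, 0, 324] := by
  have h9 : rotCount 9 = 168 := by
    have h := rotCount_prime_pow_succ (K := ℚ) Nat.prime_three (by decide) 1
    norm_num at h
    exact_mod_cast h
  have h15 : rotCount 15 = 576 := by
    rw [show 15 = 3 * 5 by norm_num, rotCount_mul (by norm_num),
      rotCount_prime Nat.prime_three (by decide), rotCount_prime Nat.prime_five (by decide)]
    norm_num
  have hodd : ∀ p : ℕ, p.Prime → Odd p → rotCount p = (p + 1) ^ 2 := fun _ => rotCount_prime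
  have heven : ∀ n : ℕ, Even n → rotCount n = 0 := fun _ => rotCount_of_even
  simp only [List.range'_succ, List.range'_zero, List.map_cons, List.map_nil, Nat.reduceAdd,
    rotCount_one, h9, h15, hodd 3 (by norm_num) (by decide), hodd 5 (by norm_num) (by decide),
    hodd 7 (by norm_num) (by decide), hodd 11 (by norm_num) (by decide),
    hodd 13 (by norm_num) (by decide), hodd 17 (by norm_num) (by decide), heven 2 (by decide),
    heven 4 (by decide), heven 6 (by decide), heven 8 (by decide), heven 10 (by decide),
    heven 12 (by decide), heven 14 (by decide), heven 16 (by decide), Nat.reducePow]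

theorem cslCount_table : (List.range' 1 17).map (fun n => cslCount n) =
    [1, 0, 16, 0, 36, 0, 64, 0, 152, 0, 144, 0, 196, 0, 576, 0, 324] := by
  have h9 : cslCount 9 = 152 := by
    have h := cslCount_prime_pow_even (K := ℚ) Nat.prime_three (by decide) 0
    norm_num at h
    exact_mod_cast h
  have h15 : cslCount 15 = 576 := by
    rw [show 15 = 3 * 5 by norm_num, cslCount_mul (by norm_num),
      cslCount_prime Nat.prime_three (by decide), cslCount_prime Nat.prime_five (by decide)]
    norm_num
  have hodd : ∀ p : ℕ, p.Prime → Odd p → cslCount p = (p + 1) ^ 2 := fun _ => cslCount_prime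
  have heven : ∀ n : ℕ, Even n → cslCount n = 0 := fun _ => cslCount_of_even
  simp only [List.range'_succ, List.range'_zero, List.map_cons, List.map_nil, Nat.reduceAdd,
    cslCount_one, h9, h15, hodd 3 (by norm_num) (by decide), hodd 5 (by norm_num) (by decide),
    hodd 7 (by norm_num) (by decide), hodd 11 (by norm_num) (by decide),
    hodd 13 (by norm_num) (by decide), hodd 17 (by norm_num) (by decide), heven 2 (by decide),
    heven 4 (by decide), heven 6 (by decide), heven 8 (by decide), heven 10 (by decide),
    heven 12 (by decide), heven 14 (by decide), heven 16 (by decide), Nat.reducePow]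

theorem norm_sq_mul_cpow_neg_lt_one {p : ℕ} (hp : p.Prime) {s : ℂ} (hs : 3 < s.re) :
    ‖(p : ℂ) ^ 2 * (p : ℂ) ^ (-s)‖ < 1 := by
  have h0 : (p : ℂ) ≠ 0 := Nat.cast_ne_zero.2 hp.ne_zero
  have h : (p : ℂ) ^ 2 * (p : ℂ) ^ (-s) = (p : ℂ) ^ (2 - s) := by
    rw [sub_eq_add_neg, Complex.cpow_add _ _ h0]
    norm_cast
  rw [h, Complex.norm_natCast_cpow_of_pos hp.pos]
  refine Real.rpow_lt_one_of_one_lt_of_neg (by exact_mod_cast hp.one_lt) ?_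
  simp only [Complex.sub_re, Complex.re_ofNat]
  linarith

theorem hasProd_rotCount {s : ℂ} (hs : 3 < s.re) :
    HasProd (fun p : {p : ℕ // p.Prime ∧ p ≠ 2} =>
      (1 + (p : ℂ) ^ (-s)) * (1 + (p : ℂ) ^ (1 - s)) /
        ((1 - (p : ℂ) ^ (1 - s)) * (1 - (p : ℂ) ^ (2 - s))))
      (LSeries (fun n => (rotCount n : ℂ)) s) := by
  refine hasProd_LSeries_of_mul (L := fun p => (1 + (p : ℂ) ^ (-s)) * (1 + (p : ℂ) ^ (1 - s)) /
      ((1 - (p : ℂ) ^ (1 - s)) * (1 - (p : ℂ) ^ (2 - s)))) rotCount_zero rotCount_one rotCount_mul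
    (fun r hr => rotCount_two_pow hr) (lSeriesSummable_rotCount hs) fun p hp h2 => ?_
  have h0 : (p : ℂ) ≠ 0 := Nat.cast_ne_zero.2 hp.ne_zero
  convert hasSum_rotCount_prime_pow hp h2 (norm_sq_mul_cpow_neg_lt_one hp hs) using 1
  rw [sub_eq_add_neg 1 s, sub_eq_add_neg 2 s, Complex.cpow_add _ _ h0, Complex.cpow_add _ _ h0,
    Complex.cpow_one, Complex.cpow_ofNat]

theorem hasProd_cslCount {s : ℂ} (hs : 3 < s.re) :
    HasProd (fun p : {p : ℕ // p.Prime ∧ p ≠ 2} =>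
      (1 + (p : ℂ) ^ (-s) + 2 * (p : ℂ) ^ (1 - s) + 2 * (p : ℂ) ^ (-2 * s) +
          (p : ℂ) ^ (1 - 2 * s) + (p : ℂ) ^ (1 - 3 * s)) /
        ((1 - (p : ℂ) ^ (2 - s)) * (1 - (p : ℂ) ^ (1 - 2 * s))))
      (LSeries (fun n => (cslCount n : ℂ)) s) := by
  refine hasProd_LSeries_of_mul (L := fun p => (1 + (p : ℂ) ^ (-s) + 2 * (p : ℂ) ^ (1 - s) +
        2 * (p : ℂ) ^ (-2 * s) + (p : ℂ) ^ (1 - 2 * s) + (p : ℂ) ^ (1 - 3 * s)) /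
      ((1 - (p : ℂ) ^ (2 - s)) * (1 - (p : ℂ) ^ (1 - 2 * s)))) cslCount_zero cslCount_one
    cslCount_mul (fun r hr => cslCount_two_pow hr) (lSeriesSummable_cslCount hs) fun p hp h2 => ?_
  have h0 : (p : ℂ) ≠ 0 := Nat.cast_ne_zero.2 hp.ne_zero
  convert hasSum_cslCount_prime_pow hp h2 (norm_sq_mul_cpow_neg_lt_one hp hs) using 1
  have e1 : (p : ℂ) ^ (1 - s) = p * (p : ℂ) ^ (-s) := by
    rw [sub_eq_add_neg, Complex.cpow_add _ _ h0, Complex.cpow_one]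
  have e2 : (p : ℂ) ^ (2 - s) = (p : ℂ) ^ 2 * (p : ℂ) ^ (-s) := by
    rw [sub_eq_add_neg, Complex.cpow_add _ _ h0, Complex.cpow_ofNat]
  have e3 : (p : ℂ) ^ (-2 * s) = ((p : ℂ) ^ (-s)) ^ 2 := by
    rw [← Complex.cpow_nat_mul]
    congr 1
    push_cast
    ring
  have e4 : (p : ℂ) ^ (1 - 2 * s) = p * ((p : ℂ) ^ (-s)) ^ 2 := by
    rw [← e3, sub_eq_add_neg, Complex.cpow_add _ _ h0, Complex.cpow_one, neg_mul]
  have e5 : (p : ℂ) ^ (1 - 3 * s) = p * ((p : ℂ) ^ (-s)) ^ 3 := by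
    rw [← Complex.cpow_nat_mul, sub_eq_add_neg, Complex.cpow_add _ _ h0, Complex.cpow_one]
    congr 2
    push_cast
    ring
  rw [e1, e2, e3, e4, e5]

end HurwitzInt

/-! ### The main theorem -/

open HurwitzInt in
theorem mainTheorem3 :
    ∃ fRot f : ArithmeticFunction ℕ,
      -- the number of coincidence rotations of index `n` is `576 * fRot n`
      (∀ n : ℕ, (coincidenceRotationsOfIndex latticeD4Star n).Finite ∧
        (coincidenceRotationsOfIndex latticeD4Star n).ncard = 576 * fRot n) ∧
      fRot.IsMultiplicative ∧
      (∀ r : ℕ, 1 ≤ r → fRot (2 ^ r) = 0) ∧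
      (∀ p r : ℕ, p.Prime → p ≠ 2 → 1 ≤ r →
        (fRot (p ^ r) : ℚ) =
          ((p : ℚ) + 1) / ((p : ℚ) - 1) * (p : ℚ) ^ (r - 1) *
            ((p : ℚ) ^ (r + 1) + (p : ℚ) ^ (r - 1) - 2)) ∧
      (∀ s : ℂ, 3 < s.re →
        LSeriesSummable (fun n => (fRot n : ℂ)) s ∧
        HasProd (fun p : {p : ℕ // p.Prime ∧ p ≠ 2} =>
          (1 + (p : ℂ) ^ (-s)) * (1 + (p : ℂ) ^ (1 - s)) /
            ((1 - (p : ℂ) ^ (1 - s)) * (1 - (p : ℂ) ^ (2 - s))))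
          (LSeries (fun n => (fRot n : ℂ)) s)) ∧
      (List.range' 1 17).map (fun n => fRot n) =
        [1, 0, 16, 0, 36, 0, 64, 0, 168, 0, 144, 0, 196, 0, 576, 0, 324] ∧
      -- the number of distinct coincidence site lattices of index `n` is `f n`
      (∀ n : ℕ, (cslsOfIndex latticeD4Star n).Finite ∧
        (cslsOfIndex latticeD4Star n).ncard = f n) ∧
      f.IsMultiplicative ∧
      (∀ r : ℕ, 1 ≤ r → f (2 ^ r) = 0) ∧
      (∀ p r : ℕ, p.Prime → p ≠ 2 → Odd r →
        (f (p ^ r) : ℚ) =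
          ((p : ℚ) + 1) ^ 2 / ((p : ℚ) ^ 3 - 1) *
            ((p : ℚ) ^ (2 * r + 1) + (p : ℚ) ^ (2 * r - 2) - 2 * (p : ℚ) ^ ((r - 1) / 2))) ∧
      (∀ p r : ℕ, p.Prime → p ≠ 2 → 2 ≤ r → Even r →
        (f (p ^ r) : ℚ) =
          ((p : ℚ) + 1) ^ 2 / ((p : ℚ) ^ 3 - 1) *
            ((p : ℚ) ^ (2 * r + 1) + (p : ℚ) ^ (2 * r - 2) -
              2 * (p : ℚ) ^ (r / 2 - 1) * ((1 + (p : ℚ) ^ 2) / (1 + (p : ℚ))))) ∧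
      (∀ s : ℂ, 3 < s.re →
        LSeriesSummable (fun n => (f n : ℂ)) s ∧
        HasProd (fun p : {p : ℕ // p.Prime ∧ p ≠ 2} =>
          (1 + (p : ℂ) ^ (-s) + 2 * (p : ℂ) ^ (1 - s) + 2 * (p : ℂ) ^ (-2 * s) +
              (p : ℂ) ^ (1 - 2 * s) + (p : ℂ) ^ (1 - 3 * s)) /
            ((1 - (p : ℂ) ^ (2 - s)) * (1 - (p : ℂ) ^ (1 - 2 * s))))
          (LSeries (fun n => (f n : ℂ)) s)) ∧
      (List.range' 1 17).map (fun n => f n) =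
        [1, 0, 16, 0, 36, 0, 64, 0, 152, 0, 144, 0, 196, 0, 576, 0, 324] := by
  refine ⟨⟨rotCount, rotCount_zero⟩, ⟨cslCount, cslCount_zero⟩,
    fun n => ⟨finite_coincidenceRotationsOfIndex n, ncard_coincidenceRotationsOfIndex n⟩,
    ⟨rotCount_one, rotCount_mul⟩, fun r hr => rotCount_two_pow hr, ?_,
    fun s hs => ⟨lSeriesSummable_rotCount hs, hasProd_rotCount hs⟩, rotCount_table,
    fun n => ⟨finite_cslsOfIndex n, ncard_cslsOfIndex n⟩,
    ⟨cslCount_one, cslCount_mul⟩, fun r hr => cslCount_two_pow hr, ?_, ?_,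
    fun s hs => ⟨lSeriesSummable_cslCount hs, hasProd_cslCount hs⟩, cslCount_table⟩
  · intro p r hp h2 hr
    obtain ⟨r, rfl⟩ : ∃ c, r = c + 1 := ⟨r - 1, by omega⟩
    exact rotCount_prime_pow_succ hp (hp.odd_of_ne_two h2) r
  · rintro p r hp h2 ⟨m, rfl⟩
    have h := cslCount_prime_pow_odd (K := ℚ) hp (hp.odd_of_ne_two h2) m
    rw [show 2 * (2 * m + 1) + 1 = 4 * m + 3 by ring, show 2 * (2 * m + 1) - 2 = 4 * m by omega,
      show (2 * m + 1 - 1) / 2 = m by omega]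
    exact h
  · rintro p r hp h2 hr ⟨m, rfl⟩
    obtain ⟨m, rfl⟩ : ∃ c, m = c + 1 := ⟨m - 1, by omega⟩
    have h := cslCount_prime_pow_even (K := ℚ) hp (hp.odd_of_ne_two h2) m
    rw [show m + 1 + (m + 1) = 2 * m + 2 by ring, show 2 * (2 * m + 2) + 1 = 4 * m + 5 by ring,
      show 2 * (2 * m + 2) - 2 = 4 * m + 2 by omega, show (2 * m + 2) / 2 - 1 = m by omega]
    exact h
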